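/- Let $R$ be a principal ideal domain and $\mathbb F$ a field. All homology is reduced simplicial homology with coefficients in $R$. **Setting.** For a graph $G$ on a vertex set $V$, let $\overrightarrow{\mathrm{Ind}}(G)$ be the directed simplicial complex of all non-empty finite sequences of distinct, mutually non-adjacent vertices, and let $\mathrm{Ind}(G)$ be the simplicial complex of all non-empty finite sets of mutually non-adjacent vertices; $\mathrm{sk}^{k-1}$ denotes the subcomplex of simplices with at most $k$ vertices. A map $f:V\to\mathbb F^N$ is *$k$-regular* on $G$ if the images of any $l\le k$ distinct, mutually non-adjacent vertices are linearly independent. For a finite set $S\subseteq\mathbb F^N$, let $\mathcal M$ be the matroid on $S$ whose independent sets are the linearly independent subsets of $S$ and let $\vec{\mathcal M}$ be the directed matroid of all sequences of distinct elements of $S$ that are linearly independent; we regard them as the (directed) simplicial complexes of their non-empty members. If $f(V)\subseteq S$, a $k$-regular $f$ induces a directed simplicial map $\overrightarrow{\mathrm{Ind}}(f):\mathrm{sk}^{k-1}\overrightarrow{\mathrm{Ind}}(G)\to\vec{\mathcal M}$ and a simplicial map $\mathrm{Ind}(f):\mathrm{sk}^{k-1}\mathrm{Ind}(G)\to\mathcal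 M$. Fix total orders on $V$ and $S$ and on the second pair $V'$, $S'$ below. On disjoint unions use the order in which every element of the first set precedes every element of the second. For a directed simplicial complex $\vec{\mathcal K}$ with underlying simplicial complex $\mathcal K$, the map $\pi_*:\tilde H_\bullet(\vec{\mathcal K})\to\tilde H_\bullet(\mathcal K)$ is induced by $(v_{s(0)},\dots,v_{s(p)})\mapsto\mathrm{sgn}(s)\,(v_0,\dots,v_p)$ for $v_0<\dots<v_p$ and permutations $s$. For (directed) simplicial complexes $\mathcal K,\mathcal K'$ on disjoint vertex sets, with join $\mathcal K*\mathcal K'$ (in the directed case: sequences of $\mathcal K$ followed by sequences of $\mathcal K'$), let $\mathrm{KU}(\mathcal K,\mathcal K')$ denote, for all $n\ge0$, the sequences $$0\to\bigoplus_{i+j=n}\tilde H_{i-1}(\mathcal K)\otimes\tilde H_{j-1}(\mathcal K')\to\tilde H_{n-1}(\mathcal K*\mathcal K')\to\bigoplus_{i+j=n-1}\mathrm{Tor}_1^R\big(\tilde H_{i-1}(\mathcal K),\tilde H_{j-1}(\mathcal K')\big)\to0\qquad(i,j\ge0),$$ in which the first map is $[x]\otimes[y]\mapsto[x*y]$ and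 the second is a connecting map. **Theorem.** There are connecting maps, depending only on the two (directed) simplicial complexes (and, in the undirected case, on the total orders of their vertex sets), which make all the sequences $\mathrm{KU}$ short exact and natural with respect to pairs of directed simplicial maps, pairs of simplicial maps, and the projections $\pi$ of directed simplicial complexes to their underlying simplicial complexes, such that the following holds. Let $G$ and $G'$ be graphs with disjoint vertex sets $V$ and $V'$, let $S\subseteq\mathbb F^N$ and $S'\subseteq\mathbb F^{N'}$ be finite with (directed) matroids $\mathcal M,\vec{\mathcal M}$ and $\mathcal M',\vec{\mathcal M}'$, let $f$ be $k$-regular on $G$ with $f(V)\subseteq S$, and let $f'$ be $k'$-regular on $G'$ with $f'(V')\subseteq S'$. Then the diagram $$\begin{array}{ccc}\mathrm{KU}\big(\mathrm{sk}^{k-1}\overrightarrow{\mathrm{Ind}}(G),\mathrm{sk}^{k'-1}\overrightarrow{\mathrm{Ind}}(G')\big)&\longrightarrow&\mathrm{KU}(\vec{\mathcal M},\vec{\mathcal M}')\\ \downarrow{\scriptstyle\pi_*}&&\downarrow{\scriptstyle\pi_*}\\ \mathrm{KU}\big(\mathrm{sk}^{k-1}\mathrm{Ind}(G),\mathrm{sk}^{k'-1}\mathrm{Ind}(G')\big)&\longrightarrow&\mathrm{KU}(\mathcal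 M,\mathcal M')\end{array}$$ of morphisms of short exact sequences commutes. Here the horizontal morphisms are induced by $f$ and $f'$ on the two outer terms ($\bigoplus f_*\otimes f'_*$ and $\bigoplus\mathrm{Tor}_1(f_*,f'_*)$) and by $(f,f'):V\sqcup V'\to\mathbb F^N\times\mathbb F^{N'}$, $v\mapsto(f(v),0)$, $v'\mapsto(0,f'(v'))$, on the middle term: the map $(f,f')$ is $(G,k;G',k')$-regular, that is, it sends any at most $k$ distinct, mutually non-adjacent vertices of $G$ together with any at most $k'$ distinct, mutually non-adjacent vertices of $G'$ to linearly independent vectors; it is the vertex map of the join of the maps induced by $f$ and $f'$; and the simplices of $\mathcal M*\mathcal M'$ are the non-empty sets of elements of $S\sqcup S'$, viewed through $s\mapsto(s,0)$, $s'\mapsto(0,s')$, that are linearly independent. The vertical morphisms are induced by the projections $\pi$ on all three terms. Moreover, the diagram is functorial with respect to inclusions of induced subgraphs into $G$ and $G'$ (in particular with respect to those given by filtrations of $V$ and $V'$): for embeddings of graphs $e:H\to G$ and $e':H'\to G'$ onto induced subgraphs, with total orders on the vertex sets of $H$ and $H'$, the induced morphisms $\mathrm{KU}(\mathrm{sk}^{k-1}\overrightarrow{\mathrm{Ind}}(H),\mathrm{sk}^{k'-1}\overrightarrow{\mathrm{Ind}}(H'))\to\mathrm{KU}(\mathrm{sk}^{k-1}\overrightarrow{\mathrm{Ind}}(G),\mathrm{sk}^{k'-1}\overrightarrow{\mathrm{Ind}}(G'))$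 and $\mathrm{KU}(\mathrm{sk}^{k-1}\mathrm{Ind}(H),\mathrm{sk}^{k'-1}\mathrm{Ind}(H'))\to\mathrm{KU}(\mathrm{sk}^{k-1}\mathrm{Ind}(G),\mathrm{sk}^{k'-1}\mathrm{Ind}(G'))$ commute with $\pi_*$, preserve identities and compositions, and composed with the horizontal morphisms induced by $f,f'$ give those induced by $f\circ e,f'\circ e'$. -/

import Mathlib

universe u

namespace RegularKunneth

noncomputable section

open CategoryTheory TensorProduct

section Chains

variable (R : Type u) [CommRing R] {V W : Type u}

/-- The free `R`-module on all finite sequences of elements of `V`. A sequence with `p + 1` entries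
stands for an (ordered) `p`-simplex; the empty sequence stands for the empty simplex, which has
dimension `-1`. -/
abbrev SeqModule (V : Type u) : Type u := List V →₀ R

/-- The boundary map: `(v₀, …, v_p) ↦ ∑ i, (-1)^i (v₀, …, v̂ᵢ, …, v_p)`. In particular `(v) ↦ ()`
(the augmentation) and `() ↦ 0`. -/
def boundary : SeqModule R V →ₗ[R] SeqModule R V :=
  Finsupp.linearCombination R fun l : List V =>
    ∑ i ∈ Finset.range l.length, (-1 : R) ^ i • Finsupp.single (l.eraseIdx i) (1 : R)

/-- Apply a map of vertices to every entry of every sequence. -/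
def pushSeq (φ : V → W) : SeqModule R V →ₗ[R] SeqModule R W :=
  Finsupp.lmapDomain R R (List.map φ)

/-- The number of inversions of a sequence; its parity is the sign of the sorting permutation. -/
def inversions [LinearOrder V] : List V → ℕ
  | [] => 0
  | a :: l => l.countP (fun b => b < a) + inversions l

/-- `(v_{s(0)}, …, v_{s(p)}) ↦ sgn(s) (v₀, …, v_p)` for `v₀ < ⋯ < v_p` and a permutation `s`;
sequences with a repeated entry are sent to `0`. -/
def orient [LinearOrder V] : SeqModule R V →ₗ[R] SeqModule R V :=
  Finsupp.linearCombination R fun l : List V =>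
    open Classical in
    if l.Nodup then
      (-1 : R) ^ inversions l • Finsupp.single (l.insertionSort (· ≤ ·)) (1 : R)
    else 0

/-- Put a vertex in front of every sequence. -/
def consMap (a : V) : SeqModule R V →ₗ[R] SeqModule R V :=
  Finsupp.lmapDomain R R (List.cons a)

@[simp] lemma consMap_single (a : V) (l : List V) (r : R) :
    consMap R a (Finsupp.single l r) = Finsupp.single (a :: l) r := by
  simp [consMap]

@[simp] lemma pushSeq_single (φ : V → W) (l : List V) (r : R) :
    pushSeq R φ (Finsupp.single l r) = Finsupp.single (l.map φ) r := by
  simp [pushSeq]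

@[simp] lemma boundary_nil : boundary R (Finsupp.single ([] : List V) (1 : R)) = 0 := by
  simp [boundary]

lemma boundary_cons_single (a : V) (l : List V) :
    boundary R (Finsupp.single (a :: l) (1 : R)) =
      Finsupp.single l 1 - consMap R a (boundary R (Finsupp.single l 1)) := by
  simp only [boundary, Finsupp.linearCombination_single, one_smul, List.length_cons,
    Finset.sum_range_succ', List.eraseIdx_cons_succ, pow_zero, List.eraseIdx_zero, List.tail_cons,
    map_sum, map_smul, consMap_single]
  rw [add_comm, sub_eq_add_neg, ← Finset.sum_neg_distrib]
  congr 1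
  refine Finset.sum_congr rfl fun i _ => ?_
  rw [pow_succ]
  simp

lemma boundary_consMap (a : V) (x : SeqModule R V) :
    boundary R (consMap R a x) = x - consMap R a (boundary R x) := by
  have : boundary R ∘ₗ consMap R a = LinearMap.id - consMap R a ∘ₗ boundary R := by
    refine Finsupp.lhom_ext' fun l => LinearMap.ext_ring ?_
    simpa using boundary_cons_single R a l
  exact LinearMap.congr_fun this x

/-- The boundary map squares to zero. -/
lemma boundary_boundary (x : SeqModule R V) : boundary R (boundary R x) = 0 := by
  have : boundary R ∘ₗ boundary R = (0 : SeqModule R V →ₗ[R] SeqModule R V) := by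
    refine Finsupp.lhom_ext' fun l => LinearMap.ext_ring ?_
    simp only [LinearMap.comp_apply, Finsupp.lsingle_apply, LinearMap.zero_apply]
    induction l with
    | nil => simp
    | cons a l ih => simp [boundary_cons_single, boundary_consMap, ih]
  exact LinearMap.congr_fun this x

lemma pushSeq_boundary (φ : V → W) :
    pushSeq R φ ∘ₗ boundary R = boundary R ∘ₗ pushSeq R φ := by
  refine Finsupp.lhom_ext' fun l => LinearMap.ext_ring ?_
  simp [boundary, List.eraseIdx_map]

section Orient

variable [LinearOrder V]

/-- Signed insertion of a vertex (auxiliary, used to show that `orient` is a chain map). -/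
def signedInsert (a : V) : List V → SeqModule R V
  | [] => Finsupp.single [a] 1
  | b :: t =>
    if a < b then Finsupp.single (a :: b :: t) 1
    else if a = b then 0 else - consMap R b (signedInsert a t)

lemma signedInsert_eq (a : V) (s : List V) (hs : s.Pairwise (· < ·)) :
    signedInsert R a s =
      if a ∈ s then 0
      else (-1 : R) ^ s.countP (fun b => b < a) • Finsupp.single (s.orderedInsert (· ≤ ·) a) 1 := by
  induction s with
  | nil => simp [signedInsert]
  | cons b t ih =>
    rw [List.pairwise_cons] at hs
    have ih := ih hs.2
    rcases lt_trichotomy a b with h | h | h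
    · have hm : a ∉ b :: t := by
        intro hm
        rcases List.mem_cons.1 hm with h' | h'
        · exact h.ne h'
        · exact lt_asymm h (hs.1 a h')
      have hc : (b :: t).countP (fun c => c < a) = 0 := by
        rw [List.countP_eq_zero]
        intro c hc
        rcases List.mem_cons.1 hc with rfl | h'
        · simpa using h.le
        · simpa using (h.trans (hs.1 c h')).le
      rw [if_neg hm, hc]
      simp [signedInsert, h, h.le]
    · subst h
      simp [signedInsert]
    · simp only [signedInsert, not_lt_of_gt h, h.ne', if_false, ih, List.mem_cons, false_or]
      by_cases hm : a ∈ t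
      · simp [hm]
      · simp [hm, h, not_le_of_gt h, pow_succ]

/-- Linear extension of `signedInsert`. -/
def signedInsertL (a : V) : SeqModule R V →ₗ[R] SeqModule R V :=
  Finsupp.linearCombination R (signedInsert R a)

lemma signedInsertL_single (a : V) (s : List V) :
    signedInsertL R a (Finsupp.single s 1) = signedInsert R a s := by
  simp [signedInsertL]

lemma signedInsertL_consMap_lt {a b : V} (h : a < b) (x : SeqModule R V) :
    signedInsertL R a (consMap R b x) = consMap R a (consMap R b x) := by
  have : signedInsertL R a ∘ₗ consMap R b = consMap R a ∘ₗ consMap R b := by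
    refine Finsupp.lhom_ext' fun l => LinearMap.ext_ring ?_
    simp [signedInsertL_single, signedInsert, h]
  exact LinearMap.congr_fun this x

lemma signedInsertL_consMap_self (a : V) (x : SeqModule R V) :
    signedInsertL R a (consMap R a x) = 0 := by
  have : signedInsertL R a ∘ₗ consMap R a = 0 := by
    refine Finsupp.lhom_ext' fun l => LinearMap.ext_ring ?_
    simp [signedInsertL_single, signedInsert]
  exact LinearMap.congr_fun this x

lemma signedInsertL_consMap_gt {a b : V} (h : b < a) (x : SeqModule R V) :
    signedInsertL R a (consMap R b x) = - consMap R b (signedInsertL R a x) := by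
  have : signedInsertL R a ∘ₗ consMap R b = - consMap R b ∘ₗ signedInsertL R a := by
    refine Finsupp.lhom_ext' fun l => LinearMap.ext_ring ?_
    simp [signedInsertL_single, signedInsert, not_lt_of_gt h, h.ne']
  exact LinearMap.congr_fun this x

lemma boundary_signedInsert (a : V) (s : List V) (hs : s.Pairwise (· < ·)) :
    boundary R (signedInsert R a s) =
      Finsupp.single s 1 - signedInsertL R a (boundary R (Finsupp.single s 1)) := by
  induction s with
  | nil => simp [signedInsert, boundary_cons_single]
  | cons b t ih =>
    rw [List.pairwise_cons] at hs
    have ih := ih hs.2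
    have key : a ≤ b → signedInsert R a t = consMap R a (Finsupp.single t 1) := by
      intro hab
      cases t with
      | nil => simp [signedInsert]
      | cons c t =>
        have : a < c := lt_of_le_of_lt hab (hs.1 c (by simp))
        simp [signedInsert, this]
    rcases lt_trichotomy a b with h | h | h
    · simp only [signedInsert, h, if_true, boundary_cons_single, map_sub, signedInsertL_single,
        signedInsertL_consMap_lt R h, key h.le, consMap_single]
    · subst h
      simp only [signedInsert, lt_irrefl, if_false, if_true, map_zero, boundary_cons_single,
        map_sub, signedInsertL_single, signedInsertL_consMap_self, key le_rfl, consMap_single]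
      simp
    · simp only [signedInsert, not_lt_of_gt h, h.ne', if_false, map_neg, boundary_consMap,
        boundary_cons_single, map_sub, signedInsertL_single, signedInsertL_consMap_gt R h, ih,
        consMap_single]
      abel

lemma insertionSort_pairwise_lt {l : List V} (hl : l.Nodup) :
    (l.insertionSort (· ≤ ·)).Pairwise (· < ·) := by
  have h1 := List.pairwise_insertionSort (· ≤ ·) l
  have h2 : (l.insertionSort (· ≤ ·)).Nodup := (List.perm_insertionSort (· ≤ ·) l).nodup_iff.2 hl
  exact (h1.and h2).imp fun h => lt_of_le_of_ne h.1 h.2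

lemma orient_single (l : List V) :
    orient R (Finsupp.single l (1 : R)) = open Classical in if l.Nodup then
      (-1 : R) ^ inversions l • Finsupp.single (l.insertionSort (· ≤ ·)) (1 : R) else 0 := by
  simp [orient]

lemma orient_cons (a : V) (x : SeqModule R V) :
    orient R (consMap R a x) = signedInsertL R a (orient R x) := by
  have : orient R ∘ₗ consMap R a = signedInsertL R a ∘ₗ orient R := by
    refine Finsupp.lhom_ext' fun l => LinearMap.ext_ring ?_
    simp only [LinearMap.comp_apply, Finsupp.lsingle_apply, consMap_single, orient_single]
    by_cases hl : l.Nodup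
    · rw [if_pos hl, map_smul, signedInsertL_single,
        signedInsert_eq R a _ (insertionSort_pairwise_lt hl)]
      by_cases ha : a ∈ l
      · simp [ha]
      · have hc : (l.insertionSort (· ≤ ·)).countP (fun b => b < a) =
            l.countP (fun b => b < a) := (List.perm_insertionSort (· ≤ ·) l).countP_eq _
        rw [hc]
        simp [ha, hl, inversions, pow_add, mul_comm]
    · simp [hl]
  exact LinearMap.congr_fun this x

lemma orient_boundary : orient R ∘ₗ boundary R (V := V) = boundary R ∘ₗ orient R := by
  refine Finsupp.lhom_ext' fun l => LinearMap.ext_ring ?_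
  simp only [LinearMap.comp_apply, Finsupp.lsingle_apply]
  induction l with
  | nil => simp [orient_single, inversions]
  | cons a l ih =>
    rw [boundary_cons_single, map_sub, orient_cons, ih, ← consMap_single, orient_cons]
    by_cases hl : l.Nodup
    · simp only [orient_single, if_pos hl, map_smul, signedInsertL_single,
        boundary_signedInsert R a _ (insertionSort_pairwise_lt hl), smul_sub]
    · simp [orient_single, hl]

end Orient

end Chains

section Homology

variable (R : Type u) [CommRing R] {V V' W : Type u}

/-- For a set `X` of finite sequences, the free `R`-module on the members of `X` with `n` entries,
i.e. on the simplices of dimension `n - 1`. -/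
def chains (X : Set (List V)) (n : ℕ) : Submodule R (SeqModule R V) :=
  Finsupp.supported R R {l | l ∈ X ∧ l.length = n}

/-- Cycles of dimension `n - 1`. -/
def cycles (X : Set (List V)) (n : ℕ) : Submodule R (SeqModule R V) :=
  chains R X n ⊓ LinearMap.ker (boundary R)

/-- Boundaries of dimension `n - 1`. -/
def boundaries (X : Set (List V)) (n : ℕ) : Submodule R (SeqModule R V) :=
  (chains R X (n + 1)).map (boundary R)

/-- Mathlib's quotient of a module by a submodule, registered for submodules of `SeqModule R V`. -/
instance (c : Submodule R (SeqModule R V)) : HasQuotient c (Submodule R c) :=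
  Submodule.hasQuotient (M := c)

/-- The `R`-module cycles modulo boundaries, in dimension `n - 1`. It is used for sets `X` which
contain the empty sequence and are closed under subsequences; then it is the reduced homology
`H̃_{n-1}` (homology of the augmented chain complex). -/
def Homology (X : Set (List V)) (n : ℕ) : Type u :=
  cycles R X n ⧸ (boundaries R X n).comap (cycles R X n).subtype

instance (X : Set (List V)) (n : ℕ) : AddCommGroup (Homology R X n) :=
  inferInstanceAs (AddCommGroup (cycles R X n ⧸ _))

instance (X : Set (List V)) (n : ℕ) : Module R (Homology R X n) :=
  inferInstanceAs (Module R (cycles R X n ⧸ (boundaries R X n).comap (cycles R X n).subtype))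

/-- The boundary map of the members of `X` stays inside `X` if `X` is closed under subsequences;
together with `boundary_boundary` this says that `chains R X` is a chain complex. -/
lemma boundary_mem_chains {X : Set (List V)}
    (hX : ∀ l ∈ X, ∀ l' : List V, l'.Sublist l → l' ∈ X) {n : ℕ} {x : SeqModule R V}
    (hx : x ∈ chains R X (n + 1)) : boundary R x ∈ chains R X n := by
  have : chains R X (n + 1) ≤ (chains R X n).comap (boundary R) := by
    rw [chains, Finsupp.supported_eq_span_single, Submodule.span_le]
    rintro _ ⟨l, ⟨hl, hn⟩, rfl⟩
    simp only [Submodule.comap_coe, Set.mem_preimage, SetLike.mem_coe, boundary,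
      Finsupp.linearCombination_single, one_smul]
    refine Submodule.sum_mem _ fun i hi => Submodule.smul_mem _ _ ?_
    refine Finsupp.single_mem_supported R _ ⟨hX l hl _ (l.eraseIdx_sublist i), ?_⟩
    rw [List.length_eraseIdx_of_lt (Finset.mem_range.1 hi), hn]
    rfl
  exact this hx

lemma boundaries_le_cycles {X : Set (List V)}
    (hX : ∀ l ∈ X, ∀ l' : List V, l'.Sublist l → l' ∈ X) (n : ℕ) :
    boundaries R X n ≤ cycles R X n := by
  rintro _ ⟨x, hx, rfl⟩
  exact ⟨boundary_mem_chains R hX hx, boundary_boundary R x⟩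

/-- The homology class of a cycle. -/
def homologyClass (X : Set (List V)) (n : ℕ) : cycles R X n →ₗ[R] Homology R X n :=
  Submodule.mkQ _

/-- The map induced on homology by a linear map of sequence modules which commutes with the
boundary and maps chains of `X` to chains of `Y`. -/
def homologyMap {X : Set (List V)} {Y : Set (List W)} (φ : SeqModule R V →ₗ[R] SeqModule R W)
    (hφ : φ ∘ₗ boundary R = boundary R ∘ₗ φ)
    (h : ∀ n, chains R X n ≤ (chains R Y n).comap φ) (n : ℕ) :
    Homology R X n →ₗ[R] Homology R Y n :=
  Submodule.mapQ _ _
    (φ.restrict (p := cycles R X n) (q := cycles R Y n) fun x hx =>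
      ⟨h n hx.1, by
        have := LinearMap.congr_fun hφ x
        have hx2 : boundary R x = 0 := hx.2
        simp only [LinearMap.comp_apply, hx2, map_zero] at this
        exact this.symm⟩)
    (by
      rintro ⟨x, hx⟩ ⟨y, hy, hxy⟩
      exact ⟨φ y, h (n + 1) hy, by
        have := LinearMap.congr_fun hφ y
        simp only [LinearMap.comp_apply] at this
        rw [← this, hxy]
        rfl⟩)

/-- `pushSeq` preserves chains as soon as it preserves the sequences. -/
lemma chains_le_comap_pushSeq {X : Set (List V)} {Y : Set (List W)} (φ : V → W)
    (h : ∀ l ∈ X, l.map φ ∈ Y) (n : ℕ) :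
    chains R X n ≤ (chains R Y n).comap (pushSeq R φ) := by
  rw [chains, Finsupp.supported_eq_span_single, Submodule.span_le]
  rintro _ ⟨l, ⟨hl, hn⟩, rfl⟩
  simp only [Submodule.comap_coe, Set.mem_preimage, pushSeq_single]
  exact Finsupp.single_mem_supported R _ ⟨h l hl, by simpa using hn⟩

/-- `orient ∘ pushSeq` preserves chains as soon as the sorted image sequences lie in `Y`. -/
lemma chains_le_comap_orient_pushSeq [LinearOrder W] {X : Set (List V)} {Y : Set (List W)}
    (φ : V → W) (h : ∀ l ∈ X, (l.map φ).Nodup → (l.map φ).insertionSort (· ≤ ·) ∈ Y) (n : ℕ) :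
    chains R X n ≤ (chains R Y n).comap (orient R ∘ₗ pushSeq R φ) := by
  rw [chains, Finsupp.supported_eq_span_single, Submodule.span_le]
  rintro _ ⟨l, ⟨hl, hn⟩, rfl⟩
  simp only [Submodule.comap_coe, Set.mem_preimage, LinearMap.comp_apply, pushSeq_single,
    orient_single]
  split_ifs with hd
  · refine Submodule.smul_mem _ _ (Finsupp.single_mem_supported R _ ⟨h l hl hd, ?_⟩)
    simpa using hn
  · exact Submodule.zero_mem _

lemma orient_pushSeq_boundary [LinearOrder W] (φ : V → W) :
    (orient R ∘ₗ pushSeq R φ) ∘ₗ boundary R = boundary R ∘ₗ (orient R ∘ₗ pushSeq R φ) := by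
  rw [LinearMap.comp_assoc, pushSeq_boundary, ← LinearMap.comp_assoc, orient_boundary,
    LinearMap.comp_assoc]

end Homology

section Cross

variable (R : Type u) [CommRing R] {V V' : Type u}

/-- The concatenation of a sequence in `V` and a sequence in `V'`, as a sequence in `V ⊔ V'`. -/
def joinSeq (l : List V) (l' : List V') : List (V ⊕ₗ V') :=
  l.map Sum.inlₗ ++ l'.map Sum.inrₗ

/-- The bilinear extension of the concatenation of sequences. -/
def joinChain : SeqModule R V →ₗ[R] SeqModule R V' →ₗ[R] SeqModule R (V ⊕ₗ V') :=
  Finsupp.linearCombination R fun l : List V =>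
    Finsupp.linearCombination R fun l' : List V' => Finsupp.single (joinSeq l l') (1 : R)

@[simp] lemma joinChain_single (l : List V) (l' : List V') :
    joinChain R (Finsupp.single l 1) (Finsupp.single l' 1) = Finsupp.single (joinSeq l l') 1 := by
  simp [joinChain]

lemma joinChain_consMap (a : V) (x : SeqModule R V) (y : SeqModule R V') :
    joinChain R (consMap R a x) y = consMap R (Sum.inlₗ a) (joinChain R x y) := by
  have : joinChain R (V' := V') ∘ₗ consMap R a =
      (LinearMap.llcomp R _ _ _ (consMap R (Sum.inlₗ a))) ∘ₗ joinChain R := by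
    refine Finsupp.lhom_ext' fun l => LinearMap.ext_ring ?_
    refine Finsupp.lhom_ext' fun l' => LinearMap.ext_ring ?_
    simp [joinSeq]
  exact LinearMap.congr_fun (LinearMap.congr_fun this x) y

/-- The Leibniz rule, for a sequence with `l.length` entries. -/
lemma boundary_joinChain_single (l : List V) (y : SeqModule R V') :
    boundary R (joinChain R (Finsupp.single l 1) y) =
      joinChain R (boundary R (Finsupp.single l 1)) y +
        (-1 : R) ^ l.length • joinChain R (Finsupp.single l 1) (boundary R y) := by
  induction l with
  | nil =>
    have h1 : joinChain R (Finsupp.single ([] : List V) 1) = pushSeq R (V := V') Sum.inrₗ := by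
      refine Finsupp.lhom_ext' fun l' => LinearMap.ext_ring ?_
      simp [joinSeq]
    have h2 := LinearMap.congr_fun (pushSeq_boundary R (Sum.inrₗ : V' → V ⊕ₗ V')) y
    simp only [LinearMap.comp_apply] at h2
    rw [h1]
    simp [h2]
  | cons a l ih =>
    rw [← consMap_single, joinChain_consMap, boundary_consMap, ih, consMap_single,
      boundary_cons_single, map_sub, LinearMap.sub_apply, joinChain_consMap, ← consMap_single,
      joinChain_consMap, List.length_cons, pow_succ]
    simp only [map_add, map_smul, mul_neg, mul_one, neg_smul]
    abel

lemma boundary_joinChain {X : Set (List V)} {i : ℕ} {x : SeqModule R V} (hx : x ∈ chains R X i)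
    (y : SeqModule R V') :
    boundary R (joinChain R x y) =
      joinChain R (boundary R x) y + (-1 : R) ^ i • joinChain R x (boundary R y) := by
  rw [chains, Finsupp.supported_eq_span_single] at hx
  induction hx using Submodule.span_induction with
  | mem x hx =>
    obtain ⟨l, ⟨-, rfl⟩, rfl⟩ := hx
    exact boundary_joinChain_single R l y
  | zero => simp
  | add x z _ _ hx hz =>
    simp only [map_add, LinearMap.add_apply, hx, hz, smul_add]
    abel
  | smul r x _ hx =>
    simp only [map_smul, LinearMap.smul_apply, hx, smul_add]
    rw [smul_comm]

lemma joinChain_mem {X : Set (List V)} {X' : Set (List V')} {Y : Set (List (V ⊕ₗ V'))}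
    (h : ∀ l ∈ X, ∀ l' ∈ X', joinSeq l l' ∈ Y) {i j n : ℕ} (hn : i + j = n)
    {x : SeqModule R V} (hx : x ∈ chains R X i) {y : SeqModule R V'} (hy : y ∈ chains R X' j) :
    joinChain R x y ∈ chains R Y n := by
  rw [chains, Finsupp.supported_eq_span_single] at hx hy
  induction hx using Submodule.span_induction with
  | mem x hx =>
    obtain ⟨l, ⟨hl, hli⟩, rfl⟩ := hx
    induction hy using Submodule.span_induction with
    | mem y hy =>
      obtain ⟨l', ⟨hl', hlj⟩, rfl⟩ := hy
      simp only [joinChain_single]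
      exact Finsupp.single_mem_supported R _ ⟨h l hl l' hl', by simp [joinSeq, hli, hlj, hn]⟩
    | zero => simp
    | add y z _ _ hy hz => simpa using Submodule.add_mem _ hy hz
    | smul r y _ hy => simpa using Submodule.smul_mem _ r hy
  | zero => simp
  | add x z _ _ hx hz => simpa using Submodule.add_mem _ hx hz
  | smul r x _ hx => simpa using Submodule.smul_mem _ r hx

section

variable {X : Set (List V)} {X' : Set (List V')} {Y : Set (List (V ⊕ₗ V'))}
  (h : ∀ l ∈ X, ∀ l' ∈ X', joinSeq l l' ∈ Y) {i j n : ℕ} (hn : i + j = n)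

lemma joinChain_mem_cycles (h : ∀ l ∈ X, ∀ l' ∈ X', joinSeq l l' ∈ Y) (hn : i + j = n)
    {x : SeqModule R V} (hx : x ∈ cycles R X i) {y : SeqModule R V'}
    (hy : y ∈ cycles R X' j) : joinChain R x y ∈ cycles R Y n := by
  obtain ⟨hx1, hx2⟩ := Submodule.mem_inf.1 hx
  obtain ⟨hy1, hy2⟩ := Submodule.mem_inf.1 hy
  refine Submodule.mem_inf.2 ⟨joinChain_mem R h hn hx1 hy1, LinearMap.mem_ker.2 ?_⟩
  rw [boundary_joinChain R hx1, LinearMap.mem_ker.1 hx2, LinearMap.mem_ker.1 hy2]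
  simp

/-- The concatenation of cycles, followed by taking the homology class. -/
def crossCycles : cycles R X i →ₗ[R] cycles R X' j →ₗ[R] Homology R Y n :=
  LinearMap.mk₂ R
    (fun x y => homologyClass R Y n
      ⟨joinChain R x.1 y.1, joinChain_mem_cycles R h hn x.2 y.2⟩)
    (fun x x' y => (congrArg (homologyClass R Y n) (Subtype.ext (by simp))).trans
      (map_add (homologyClass R Y n) _ _))
    (fun r x y => (congrArg (homologyClass R Y n) (Subtype.ext (by simp))).trans
      (map_smul (homologyClass R Y n) r _))
    (fun x y y' => (congrArg (homologyClass R Y n) (Subtype.ext (by simp))).trans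
      (map_add (homologyClass R Y n) _ _))
    (fun r x y => (congrArg (homologyClass R Y n) (Subtype.ext (by simp))).trans
      (map_smul (homologyClass R Y n) r _))

/-- The homology cross product `[x] ⊗ [y] ↦ [x * y]`. -/
def cross : Homology R X i →ₗ[R] Homology R X' j →ₗ[R] Homology R Y n :=
  (Submodule.liftQ _ (Submodule.liftQ _ (crossCycles R h hn) (by
    rintro ⟨x, hx⟩ ⟨w, hw, hwx⟩
    refine LinearMap.mem_ker.2 (LinearMap.ext fun y => ?_)
    refine (Submodule.Quotient.mk_eq_zero _).2 ⟨joinChain R w y.1,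
      joinChain_mem R h (by omega) hw y.2.1, ?_⟩
    have hy : boundary R y.1 = 0 := y.2.2
    rw [boundary_joinChain R hw, hy, map_zero, smul_zero, add_zero, hwx]
    rfl)).flip (by
    rintro ⟨y, hy⟩ ⟨w, hw, hwy⟩
    refine LinearMap.mem_ker.2 (LinearMap.ext fun x => ?_)
    obtain ⟨x, rfl⟩ := Submodule.mkQ_surjective _ x
    refine (Submodule.Quotient.mk_eq_zero _).2 ⟨(-1 : R) ^ i • joinChain R x.1 w,
      Submodule.smul_mem _ _ (joinChain_mem R h (by omega) x.2.1 hw), ?_⟩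
    have hx : boundary R x.1 = 0 := x.2.2
    rw [map_smul, boundary_joinChain R x.2.1, hx, map_zero, LinearMap.zero_apply, zero_add, hwy,
      smul_smul, ← mul_pow]
    simp)).flip

end

end Cross

section Natural

variable {R : Type u} [CommRing R] {V V' W W' : Type u}

/-- The cross product is natural for chain maps which are compatible with concatenation. -/
lemma homologyMap_cross {X : Set (List V)} {X' : Set (List V')} {Y : Set (List (V ⊕ₗ V'))}
    {X₂ : Set (List W)} {X₂' : Set (List W')} {Y₂ : Set (List (W ⊕ₗ W'))}
    (h : ∀ l ∈ X, ∀ l' ∈ X', joinSeq l l' ∈ Y) (h₂ : ∀ l ∈ X₂, ∀ l' ∈ X₂', joinSeq l l' ∈ Y₂)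
    {ψ : SeqModule R V →ₗ[R] SeqModule R W} (hψ : ψ ∘ₗ boundary R = boundary R ∘ₗ ψ)
    (cψ : ∀ n, chains R X n ≤ (chains R X₂ n).comap ψ)
    {ψ' : SeqModule R V' →ₗ[R] SeqModule R W'} (hψ' : ψ' ∘ₗ boundary R = boundary R ∘ₗ ψ')
    (cψ' : ∀ n, chains R X' n ≤ (chains R X₂' n).comap ψ')
    {χ : SeqModule R (V ⊕ₗ V') →ₗ[R] SeqModule R (W ⊕ₗ W')}
    (hχ : χ ∘ₗ boundary R = boundary R ∘ₗ χ)
    (cχ : ∀ n, chains R Y n ≤ (chains R Y₂ n).comap χ)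
    (hm : ∀ x y, χ (joinChain R x y) = joinChain R (ψ x) (ψ' y)) {i j n : ℕ} (hn : i + j = n)
    (a : Homology R X i) (b : Homology R X' j) :
    homologyMap R χ hχ cχ n (cross R h hn a b) =
      cross R h₂ hn (homologyMap R ψ hψ cψ i a) (homologyMap R ψ' hψ' cψ' j b) := by
  obtain ⟨x, rfl⟩ := Submodule.mkQ_surjective _ a
  obtain ⟨y, rfl⟩ := Submodule.mkQ_surjective _ b
  exact congrArg (homologyClass R Y₂ n) (Subtype.ext (hm x.1 y.1))

lemma pushSeq_joinChain (φ : V → W) (φ' : V' → W') (x : SeqModule R V) (y : SeqModule R V') :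
    pushSeq R (fun v : V ⊕ₗ V' => toLex (Sum.map φ φ' (ofLex v))) (joinChain R x y) =
      joinChain R (pushSeq R φ x) (pushSeq R φ' y) := by
  have : (LinearMap.llcomp R _ _ _
        (pushSeq R (fun v : V ⊕ₗ V' => toLex (Sum.map φ φ' (ofLex v))))) ∘ₗ joinChain R =
      (joinChain R).compl₁₂ (pushSeq R φ) (pushSeq R φ') := by
    refine Finsupp.lhom_ext' fun l => LinearMap.ext_ring ?_
    refine Finsupp.lhom_ext' fun l' => LinearMap.ext_ring ?_
    simp [joinSeq, Function.comp_def]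
  exact LinearMap.congr_fun (LinearMap.congr_fun this x) y

lemma joinSeq_nodup {l : List V} {l' : List V'} :
    (joinSeq l l').Nodup ↔ l.Nodup ∧ l'.Nodup := by
  rw [joinSeq, List.nodup_append, List.nodup_map_iff, List.nodup_map_iff]
  · refine ⟨fun h => ⟨h.1, h.2.1⟩, fun h => ⟨h.1, h.2, ?_⟩⟩
    simp
  · intro a b h; simpa using h
  · intro a b h; simpa using h

section

variable [LinearOrder V] [LinearOrder V']

lemma joinSeq_pairwise {l : List V} {l' : List V'} :
    (joinSeq l l').Pairwise (· < ·) ↔ l.Pairwise (· < ·) ∧ l'.Pairwise (· < ·) := by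
  simp [joinSeq, List.pairwise_append, List.pairwise_map]

lemma inversions_joinSeq (l : List V) (l' : List V') :
    inversions (joinSeq l l') = inversions l + inversions l' := by
  induction l with
  | nil =>
    induction l' with
    | nil => rfl
    | cons b l' ih =>
      simp only [joinSeq, List.map_nil, List.nil_append, List.map_cons, inversions] at ih ⊢
      rw [ih, List.countP_map]
      simp [Function.comp_def]
  | cons a l ih =>
    have : joinSeq (a :: l) l' = Sum.inlₗ a :: joinSeq l l' := rfl
    rw [this, inversions, ih, inversions, joinSeq, List.countP_append, List.countP_map,
      List.countP_map]
    simp [Function.comp_def, add_assoc]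

lemma insertionSort_joinSeq {l : List V} {l' : List V'} (hl : l.Nodup) (hl' : l'.Nodup) :
    (joinSeq l l').insertionSort (· ≤ ·) =
      joinSeq (l.insertionSort (· ≤ ·)) (l'.insertionSort (· ≤ ·)) := by
  have h1 := insertionSort_pairwise_lt (joinSeq_nodup.2 ⟨hl, hl'⟩)
  have h2 := joinSeq_pairwise.2 ⟨insertionSort_pairwise_lt hl, insertionSort_pairwise_lt hl'⟩
  refine List.Perm.eq_of_pairwise (le := (· < ·)) (fun a b _ _ h h' => (lt_asymm h h').elim) h1 h2 ?_
  exact (List.perm_insertionSort _ _).trans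
    (((List.perm_insertionSort _ l).map _).append ((List.perm_insertionSort _ l').map _)).symm

lemma orient_joinChain (x : SeqModule R V) (y : SeqModule R V') :
    orient R (joinChain R x y) = joinChain R (orient R x) (orient R y) := by
  have : (LinearMap.llcomp R _ _ _ (orient R)) ∘ₗ joinChain R (V := V) (V' := V') =
      (joinChain R).compl₁₂ (orient R) (orient R) := by
    refine Finsupp.lhom_ext' fun l => LinearMap.ext_ring ?_
    refine Finsupp.lhom_ext' fun l' => LinearMap.ext_ring ?_
    simp only [LinearMap.comp_apply, Finsupp.lsingle_apply, LinearMap.llcomp_apply,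
      LinearMap.compl₁₂_apply, joinChain_single, orient_single, joinSeq_nodup]
    by_cases hl : l.Nodup
    · by_cases hl' : l'.Nodup
      · rw [if_pos ⟨hl, hl'⟩, if_pos hl, if_pos hl', LinearMap.map_smul₂, map_smul,
          joinChain_single, insertionSort_joinSeq hl hl', inversions_joinSeq, pow_add, mul_smul]
      · simp [hl']
    · simp [hl]
  exact LinearMap.congr_fun (LinearMap.congr_fun this x) y

end

end Natural

section Complexes

variable {V V' W W' : Type u}

/-- A directed simplicial complex on (a subset of) `V`: a set of non-empty finite sequences of
distinct vertices which is closed under non-empty subsequences. -/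
@[ext]
structure DirectedComplex (V : Type u) where
  /-- The directed simplices. -/
  faces : Set (List V)
  ne_nil : ∀ l ∈ faces, l ≠ []
  nodup : ∀ l ∈ faces, l.Nodup
  sublist_mem : ∀ l ∈ faces, ∀ l' : List V, l'.Sublist l → l' ≠ [] → l' ∈ faces

/-- The directed simplices together with the empty sequence. -/
def DirectedComplex.augmented (K : DirectedComplex V) : Set (List V) :=
  {l | l = [] ∨ l ∈ K.faces}

/-- The underlying simplicial complex: its simplices are the sets of entries of the directed
simplices. -/
def DirectedComplex.underlying (K : DirectedComplex V) : PreAbstractSimplicialComplex V where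
  faces := {σ | ∃ l ∈ K.faces, ∀ v, v ∈ σ ↔ v ∈ l}
  isRelLowerSet_faces := by
    classical
    rintro σ ⟨l, hl, h⟩
    refine ⟨?_, fun τ hτ hne => ⟨l.filter (· ∈ τ), ?_, fun v => ?_⟩⟩
    · obtain ⟨v, hv⟩ := List.exists_mem_of_ne_nil l (K.ne_nil l hl)
      exact ⟨v, (h v).2 hv⟩
    · refine K.sublist_mem l hl _ List.filter_sublist ?_
      obtain ⟨v, hv⟩ := hne
      exact List.ne_nil_of_mem (a := v) (by simpa using ⟨(h v).1 (hτ hv), hv⟩)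
    · simpa using fun hv => (h v).1 (hτ hv)

/-- The simplices of a simplicial complex on a totally ordered set, written as increasing
sequences, together with the empty sequence. -/
def ordered [LinearOrder V] (K : PreAbstractSimplicialComplex V) : Set (List V) :=
  {l | l.Pairwise (· < ·) ∧ (l = [] ∨ ∃ σ ∈ K.faces, ∀ v, v ∈ σ ↔ v ∈ l)}

/-- The join of directed simplicial complexes on `V` and `V'`, on the disjoint union of `V` and
`V'`: simplices of the first complex followed by simplices of the second, one of the two being
allowed to be empty. -/
def DirectedComplex.join (K : DirectedComplex V) (K' : DirectedComplex V') :
    DirectedComplex (V ⊕ₗ V') where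
  faces := {l | l ≠ [] ∧ ∃ a ∈ K.augmented, ∃ b ∈ K'.augmented, l = joinSeq a b}
  ne_nil _ h := h.1
  nodup := by
    rintro _ ⟨-, a, ha, b, hb, rfl⟩
    refine joinSeq_nodup.2 ⟨?_, ?_⟩
    · rcases ha with rfl | ha
      · exact List.nodup_nil
      · exact K.nodup a ha
    · rcases hb with rfl | hb
      · exact List.nodup_nil
      · exact K'.nodup b hb
  sublist_mem := by
    rintro _ ⟨-, a, ha, b, hb, rfl⟩ l' hl hne
    obtain ⟨l₁, l₂, rfl, h₁, h₂⟩ := List.sublist_append_iff.1 hl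
    obtain ⟨a', ha', rfl⟩ := List.sublist_map_iff.1 h₁
    obtain ⟨b', hb', rfl⟩ := List.sublist_map_iff.1 h₂
    refine ⟨hne, a', ?_, b', ?_, rfl⟩
    · by_cases h : a' = []
      · exact Or.inl h
      · rcases ha with rfl | ha
        · exact Or.inl (List.sublist_nil.1 ha')
        · exact Or.inr (K.sublist_mem a ha a' ha' h)
    · by_cases h : b' = []
      · exact Or.inl h
      · rcases hb with rfl | hb
        · exact Or.inl (List.sublist_nil.1 hb')
        · exact Or.inr (K'.sublist_mem b hb b' hb' h)

/-- The disjoint union `σ ⊔ σ'`, as a set of elements of the disjoint union of `V` and `V'`. -/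
def joinFinset (σ : Finset V) (σ' : Finset V') : Finset (V ⊕ₗ V') :=
  (σ.disjSum σ').map toLex.toEmbedding

@[simp] lemma inl_mem_joinFinset {σ : Finset V} {σ' : Finset V'} {v : V} :
    (Sum.inlₗ v : V ⊕ₗ V') ∈ joinFinset σ σ' ↔ v ∈ σ := by
  simp [joinFinset]

@[simp] lemma inr_mem_joinFinset {σ : Finset V} {σ' : Finset V'} {v : V'} :
    (Sum.inrₗ v : V ⊕ₗ V') ∈ joinFinset σ σ' ↔ v ∈ σ' := by
  simp [joinFinset]

@[simp] lemma inl_mem_joinSeq {l : List V} {l' : List V'} {v : V} :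
    (Sum.inlₗ v : V ⊕ₗ V') ∈ joinSeq l l' ↔ v ∈ l := by
  simp [joinSeq]

@[simp] lemma inr_mem_joinSeq {l : List V} {l' : List V'} {v : V'} :
    (Sum.inrₗ v : V ⊕ₗ V') ∈ joinSeq l l' ↔ v ∈ l' := by
  simp [joinSeq]

lemma forall_lexSum {p : V ⊕ₗ V' → Prop} :
    (∀ v, p v) ↔ (∀ v : V, p (Sum.inlₗ v)) ∧ ∀ v : V', p (Sum.inrₗ v) :=
  ⟨fun h => ⟨fun _ => h _, fun _ => h _⟩, fun h v => by
    rcases v with v | v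
    · exact h.1 v
    · exact h.2 v⟩

lemma support_join {σ : Finset V} {σ' : Finset V'} {l : List V} {l' : List V'} :
    (∀ v, v ∈ joinFinset σ σ' ↔ v ∈ joinSeq l l') ↔
      (∀ v, v ∈ σ ↔ v ∈ l) ∧ ∀ v, v ∈ σ' ↔ v ∈ l' := by
  simp

lemma exists_joinFinset (τ : Finset (V ⊕ₗ V')) :
    ∃ (σ : Finset V) (σ' : Finset V'), τ = joinFinset σ σ' := by
  classical
  have h1 : Function.Injective (Sum.inlₗ : V → V ⊕ₗ V') := fun a b h => by simpa using h
  have h2 : Function.Injective (Sum.inrₗ : V' → V ⊕ₗ V') := fun a b h => by simpa using h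
  refine ⟨τ.preimage Sum.inlₗ h1.injOn, τ.preimage Sum.inrₗ h2.injOn, ?_⟩
  refine Finset.ext (forall_lexSum.2 ⟨fun v => ?_, fun v => ?_⟩)
  · rw [inl_mem_joinFinset, Finset.mem_preimage]
  · rw [inr_mem_joinFinset, Finset.mem_preimage]

/-- The join of simplicial complexes on `V` and `V'`, on the disjoint union of `V` and `V'`:
its simplices are the non-empty `σ ⊔ σ'`, where each of `σ`, `σ'` is empty or a simplex. -/
def simplicialJoin (K : PreAbstractSimplicialComplex V) (K' : PreAbstractSimplicialComplex V') :
    PreAbstractSimplicialComplex (V ⊕ₗ V') where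
  faces := {τ | τ.Nonempty ∧ ∃ σ σ', (σ = ∅ ∨ σ ∈ K.faces) ∧ (σ' = ∅ ∨ σ' ∈ K'.faces) ∧
    τ = joinFinset σ σ'}
  isRelLowerSet_faces := by
    rintro _ ⟨hne, σ, σ', h, h', rfl⟩
    refine ⟨hne, fun τ hτ hτne => ⟨hτne, ?_⟩⟩
    obtain ⟨ρ, ρ', rfl⟩ := exists_joinFinset τ
    refine ⟨ρ, ρ', ?_, ?_, rfl⟩
    · have hs : ρ ⊆ σ := fun v hv => inl_mem_joinFinset.1 (hτ (inl_mem_joinFinset.2 hv))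
      rcases ρ.eq_empty_or_nonempty with h0 | h0
      · exact Or.inl h0
      · rcases h with rfl | h
        · exact Or.inl (Finset.subset_empty.1 hs)
        · exact Or.inr ((K.isRelLowerSet_faces h).2 hs h0)
    · have hs : ρ' ⊆ σ' := fun v hv => inr_mem_joinFinset.1 (hτ (inr_mem_joinFinset.2 hv))
      rcases ρ'.eq_empty_or_nonempty with h0 | h0
      · exact Or.inl h0
      · rcases h' with rfl | h'
        · exact Or.inl (Finset.subset_empty.1 hs)
        · exact Or.inr ((K'.isRelLowerSet_faces h').2 hs h0)

/-- The underlying simplicial complex of the join is the join of the underlying complexes. -/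
lemma underlying_join {K : DirectedComplex V} {K' : DirectedComplex V'}
    {L : PreAbstractSimplicialComplex V} {L' : PreAbstractSimplicialComplex V'}
    (h : K.underlying = L) (h' : K'.underlying = L') :
    (K.join K').underlying = simplicialJoin L L' := by
  classical
  subst h h'
  ext τ
  constructor
  · rintro ⟨_, ⟨hne, a, ha, b, hb, rfl⟩, h⟩
    obtain ⟨v, hv⟩ := List.exists_mem_of_ne_nil _ hne
    refine ⟨⟨v, (h v).2 hv⟩, ?_⟩
    obtain ⟨σ, σ', rfl⟩ := exists_joinFinset τ
    obtain ⟨h1, h2⟩ := support_join.1 h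
    refine ⟨σ, σ', ?_, ?_, rfl⟩
    · rcases ha with rfl | ha
      · exact Or.inl (Finset.eq_empty_of_forall_notMem fun v hv => by simpa using (h1 v).1 hv)
      · exact Or.inr ⟨a, ha, h1⟩
    · rcases hb with rfl | hb
      · exact Or.inl (Finset.eq_empty_of_forall_notMem fun v hv => by simpa using (h2 v).1 hv)
      · exact Or.inr ⟨b, hb, h2⟩
  · rintro ⟨⟨v, hv⟩, σ, σ', h, h', rfl⟩
    have key : ∀ {U : Type u} (M : DirectedComplex U) (ρ : Finset U),
        (ρ = ∅ ∨ ρ ∈ M.underlying.faces) → ∃ c ∈ M.augmented, ∀ v, v ∈ ρ ↔ v ∈ c := by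
      rintro U M ρ (rfl | ⟨c, hc, h⟩)
      · exact ⟨[], Or.inl rfl, by simp⟩
      · exact ⟨c, Or.inr hc, h⟩
    obtain ⟨a, ha, h1⟩ := key K σ h
    obtain ⟨b, hb, h2⟩ := key K' σ' h'
    have hs := support_join.2 ⟨h1, h2⟩
    exact ⟨joinSeq a b, ⟨List.ne_nil_of_mem ((hs v).1 hv), a, ha, b, hb, rfl⟩, hs⟩

lemma joinSeq_mem_augmented (K : DirectedComplex V) (K' : DirectedComplex V') :
    ∀ l ∈ K.augmented, ∀ l' ∈ K'.augmented, joinSeq l l' ∈ (K.join K').augmented :=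
  fun l hl l' hl' => or_iff_not_imp_left.2 fun h => ⟨h, l, hl, l', hl', rfl⟩

lemma joinSeq_mem_ordered [LinearOrder V] [LinearOrder V'] (K : PreAbstractSimplicialComplex V)
    (K' : PreAbstractSimplicialComplex V') :
    ∀ l ∈ ordered K, ∀ l' ∈ ordered K', joinSeq l l' ∈ ordered (simplicialJoin K K') := by
  have key : ∀ {U : Type u} [LinearOrder U] (M : PreAbstractSimplicialComplex U) (c : List U),
      c ∈ ordered M → ∃ ρ : Finset U, (ρ = ∅ ∨ ρ ∈ M.faces) ∧ ∀ v, v ∈ ρ ↔ v ∈ c := by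
    rintro U _ M c ⟨-, rfl | ⟨ρ, hρ, h⟩⟩
    · exact ⟨∅, Or.inl rfl, by simp⟩
    · exact ⟨ρ, Or.inr hρ, h⟩
  intro l hl l' hl'
  refine ⟨joinSeq_pairwise.2 ⟨hl.1, hl'.1⟩, or_iff_not_imp_left.2 fun hne => ?_⟩
  obtain ⟨σ, hσ, h⟩ := key K l hl
  obtain ⟨σ', hσ', h'⟩ := key K' l' hl'
  have hs := support_join.2 ⟨h, h'⟩
  obtain ⟨v, hv⟩ := List.exists_mem_of_ne_nil _ hne
  exact ⟨joinFinset σ σ', ⟨⟨v, (hs v).2 hv⟩, σ, σ', hσ, hσ', rfl⟩, hs⟩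

/-- A directed simplicial map: a map of vertices which sends directed simplices to directed
simplices, entry by entry. -/
structure DirectedMap (K : DirectedComplex V) (L : DirectedComplex W) where
  /-- The map of vertices. -/
  toFun : V → W
  map_mem : ∀ l ∈ K.faces, l.map toFun ∈ L.faces

/-- A simplicial map: a map of vertices such that the image of every simplex is a simplex. -/
structure SimplicialMap (K : PreAbstractSimplicialComplex V) (L : PreAbstractSimplicialComplex W)
    where
  /-- The map of vertices. -/
  toFun : V → W
  image_mem : ∀ σ ∈ K.faces, ∃ τ ∈ L.faces, ∀ w, w ∈ τ ↔ ∃ v ∈ σ, toFun v = w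

/-- The map of disjoint unions given by a pair of maps. -/
def lexMap (φ : V → W) (φ' : V' → W') (v : V ⊕ₗ V') : W ⊕ₗ W' := toLex (Sum.map φ φ' (ofLex v))

@[simp] lemma lexMap_inl (φ : V → W) (φ' : V' → W') (v : V) :
    lexMap φ φ' (Sum.inlₗ v) = Sum.inlₗ (φ v) := rfl

@[simp] lemma lexMap_inr (φ : V → W) (φ' : V' → W') (v : V') :
    lexMap φ φ' (Sum.inrₗ v) = Sum.inrₗ (φ' v) := rfl

lemma map_joinSeq (φ : V → W) (φ' : V' → W') (l : List V) (l' : List V') :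
    (joinSeq l l').map (lexMap φ φ') = joinSeq (l.map φ) (l'.map φ') := by
  simp [joinSeq, Function.comp_def]

/-- The join of two directed simplicial maps. -/
def DirectedMap.join {K : DirectedComplex V} {L : DirectedComplex W} {K' : DirectedComplex V'}
    {L' : DirectedComplex W'} (φ : DirectedMap K L) (φ' : DirectedMap K' L') :
    DirectedMap (K.join K') (L.join L') where
  toFun := lexMap φ.toFun φ'.toFun
  map_mem := by
    rintro _ ⟨hne, a, ha, b, hb, rfl⟩
    refine ⟨by simpa using hne, _, ?_, _, ?_, map_joinSeq _ _ _ _⟩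
    · rcases ha with rfl | ha
      · exact Or.inl rfl
      · exact Or.inr (φ.map_mem a ha)
    · rcases hb with rfl | hb
      · exact Or.inl rfl
      · exact Or.inr (φ'.map_mem b hb)

/-- The join of two simplicial maps. -/
def SimplicialMap.join {K : PreAbstractSimplicialComplex V} {L : PreAbstractSimplicialComplex W}
    {K' : PreAbstractSimplicialComplex V'} {L' : PreAbstractSimplicialComplex W'}
    (φ : SimplicialMap K L) (φ' : SimplicialMap K' L') :
    SimplicialMap (simplicialJoin K K') (simplicialJoin L L') where
  toFun := lexMap φ.toFun φ'.toFun
  image_mem := by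
    rintro _ ⟨hne, σ, σ', h, h', rfl⟩
    have key : ∀ {U U' : Type u} {M : PreAbstractSimplicialComplex U}
        {M' : PreAbstractSimplicialComplex U'} (ψ : SimplicialMap M M') (ρ : Finset U),
        (ρ = ∅ ∨ ρ ∈ M.faces) → ∃ ρ' : Finset U', (ρ' = ∅ ∨ ρ' ∈ M'.faces) ∧
          ∀ w, w ∈ ρ' ↔ ∃ v ∈ ρ, ψ.toFun v = w := by
      rintro U U' M M' ψ ρ (rfl | hρ)
      · exact ⟨∅, Or.inl rfl, by simp⟩
      · obtain ⟨ρ', h1, h2⟩ := ψ.image_mem ρ hρ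
        exact ⟨ρ', Or.inr h1, h2⟩
    obtain ⟨ρ, hρ, h1⟩ := key φ σ h
    obtain ⟨ρ', hρ', h2⟩ := key φ' σ' h'
    have hs : ∀ w, w ∈ joinFinset ρ ρ' ↔
        ∃ v ∈ joinFinset σ σ', lexMap φ.toFun φ'.toFun v = w := by
      rw [forall_lexSum]
      refine ⟨fun w => ?_, fun w => ?_⟩
      · rw [inl_mem_joinFinset, h1]
        constructor
        · rintro ⟨v, hv, rfl⟩
          exact ⟨Sum.inlₗ v, by simpa using hv, rfl⟩
        · rintro ⟨v | v, hv, h⟩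
          · exact ⟨v, inl_mem_joinFinset.1 hv, Sum.inl_injective h⟩
          · cases h
      · rw [inr_mem_joinFinset, h2]
        constructor
        · rintro ⟨v, hv, rfl⟩
          exact ⟨Sum.inrₗ v, by simpa using hv, rfl⟩
        · rintro ⟨v | v, hv, h⟩
          · cases h
          · exact ⟨v, inr_mem_joinFinset.1 hv, Sum.inr_injective h⟩
    obtain ⟨v, hv⟩ := hne
    exact ⟨joinFinset ρ ρ', ⟨⟨_, (hs _).2 ⟨v, hv, rfl⟩⟩, ρ, ρ', hρ, hρ', rfl⟩, hs⟩

end Complexes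

section InducedMaps

variable (R : Type u) [CommRing R] {V V' W W' : Type u}

/-- The reduced homology `H̃_{n-1}` of a directed simplicial complex, with coefficients in `R`. -/
def DirectedComplex.homology (K : DirectedComplex V) (n : ℕ) : ModuleCat.{u} R :=
  ModuleCat.of R (Homology R K.augmented n)

/-- The reduced homology `H̃_{n-1}` of a simplicial complex on a totally ordered set, with
coefficients in `R`. -/
def simplicialHomology [LinearOrder V] (K : PreAbstractSimplicialComplex V) (n : ℕ) :
    ModuleCat.{u} R :=
  ModuleCat.of R (Homology R (ordered K) n)

lemma sort_mem_ordered [LinearOrder W] {L : PreAbstractSimplicialComplex W} {l : List W}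
    (hl : l.Nodup) (h : l = [] ∨ ∃ τ ∈ L.faces, ∀ w, w ∈ τ ↔ w ∈ l) :
    l.insertionSort (· ≤ ·) ∈ ordered L := by
  refine ⟨insertionSort_pairwise_lt hl, ?_⟩
  rcases h with rfl | ⟨τ, hτ, h⟩
  · exact Or.inl rfl
  · exact Or.inr ⟨τ, hτ, by simpa using h⟩

lemma DirectedMap.chains_le {K : DirectedComplex V} {L : DirectedComplex W} (φ : DirectedMap K L)
    (n : ℕ) : chains R K.augmented n ≤ (chains R L.augmented n).comap (pushSeq R φ.toFun) := by
  refine chains_le_comap_pushSeq R φ.toFun ?_ n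
  rintro l (rfl | hl)
  · exact Or.inl rfl
  · exact Or.inr (φ.map_mem l hl)

lemma SimplicialMap.chains_le [LinearOrder V] [LinearOrder W] {K : PreAbstractSimplicialComplex V}
    {L : PreAbstractSimplicialComplex W} (φ : SimplicialMap K L) (n : ℕ) :
    chains R (ordered K) n ≤
      (chains R (ordered L) n).comap (orient R ∘ₗ pushSeq R φ.toFun) := by
  refine chains_le_comap_orient_pushSeq R φ.toFun ?_ n
  rintro l ⟨-, rfl | ⟨σ, hσ, h⟩⟩ hd
  · exact sort_mem_ordered hd (Or.inl rfl)
  · obtain ⟨τ, hτ, h'⟩ := φ.image_mem σ hσ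
    exact sort_mem_ordered hd (Or.inr ⟨τ, hτ, fun w => by simp [h', h]⟩)

lemma chains_le_orient [LinearOrder V] {K : DirectedComplex V} {L : PreAbstractSimplicialComplex V}
    (h : K.underlying = L) (n : ℕ) :
    chains R K.augmented n ≤ (chains R (ordered L) n).comap (orient R) := by
  have := chains_le_comap_orient_pushSeq R (X := K.augmented) (Y := ordered L) _root_.id ?_ n
  · have hid : pushSeq R (_root_.id : V → V) = LinearMap.id := by
      refine Finsupp.lhom_ext' fun l => LinearMap.ext_ring ?_
      simp
    rwa [hid, LinearMap.comp_id] at this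
  · subst h
    rintro l (rfl | hl) hd
    · exact sort_mem_ordered hd (Or.inl rfl)
    · classical
      exact sort_mem_ordered hd (Or.inr ⟨l.toFinset, ⟨l, hl, by simp⟩, by simp⟩)

/-- The map induced on homology by a directed simplicial map. -/
def DirectedMap.onHomology {K : DirectedComplex V} {L : DirectedComplex W} (φ : DirectedMap K L)
    (n : ℕ) : K.homology R n ⟶ L.homology R n :=
  ModuleCat.ofHom (homologyMap R (pushSeq R φ.toFun) (pushSeq_boundary R _) (φ.chains_le R) n)

/-- The map induced on homology by a simplicial map. On chains, an increasing sequence is sent to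
its image, sorted and with the sign of the sorting permutation, or to `0` if the image is
degenerate. -/
def SimplicialMap.onHomology [LinearOrder V] [LinearOrder W] {K : PreAbstractSimplicialComplex V}
    {L : PreAbstractSimplicialComplex W} (φ : SimplicialMap K L) (n : ℕ) :
    simplicialHomology R K n ⟶ simplicialHomology R L n :=
  ModuleCat.ofHom
    (homologyMap R (orient R ∘ₗ pushSeq R φ.toFun) (orient_pushSeq_boundary R _) (φ.chains_le R) n)

/-- The map `π_*` induced on homology by the projection `π` of a directed simplicial complex to
its underlying simplicial complex. On chains, `(v_{s(0)}, …, v_{s(p)}) ↦ sgn(s) (v₀, …, v_p)` for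
`v₀ < ⋯ < v_p`. -/
def projection [LinearOrder V] {K : DirectedComplex V} {L : PreAbstractSimplicialComplex V}
    (h : K.underlying = L) (n : ℕ) : K.homology R n ⟶ simplicialHomology R L n :=
  ModuleCat.ofHom (homologyMap R (orient R) (orient_boundary R) (chains_le_orient R h) n)

end InducedMaps

section Kunneth

variable (R : Type u) [CommRing R]

/-- `⨁_{i + j = n} A i ⊗ B j`. -/
def tensorSum (A B : ℕ → ModuleCat.{u} R) (n : ℕ) : ModuleCat.{u} R :=
  ModuleCat.of R (DirectSum {p : ℕ × ℕ // p.1 + p.2 = n} fun p => A p.1.1 ⊗[R] B p.1.2)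

/-- `⨁_{i + j + 1 = n} Tor₁(A i, B j)`. -/
def torSum (A B : ℕ → ModuleCat.{u} R) (n : ℕ) : ModuleCat.{u} R :=
  ModuleCat.of R (DirectSum {p : ℕ × ℕ // p.1 + p.2 + 1 = n} fun p =>
    ((Tor (ModuleCat.{u} R) 1).obj (A p.1.1)).obj (B p.1.2))

variable {R}

/-- `⨁_{i + j = n} f i ⊗ g j`. -/
def tensorSumMap {A B A₂ B₂ : ℕ → ModuleCat.{u} R} (f : ∀ i, A i ⟶ A₂ i) (g : ∀ i, B i ⟶ B₂ i)
    (n : ℕ) : tensorSum R A B n ⟶ tensorSum R A₂ B₂ n :=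
  ModuleCat.ofHom (DirectSum.lmap fun p : {p : ℕ × ℕ // p.1 + p.2 = n} =>
    TensorProduct.map (f p.1.1).hom (g p.1.2).hom)

/-- The map out of `⨁_{i + j = n} A i ⊗ B j` given by bilinear maps. -/
def tensorSumDesc {A B : ℕ → ModuleCat.{u} R} {C : ModuleCat.{u} R} {n : ℕ}
    (c : ∀ p : {p : ℕ × ℕ // p.1 + p.2 = n}, A p.1.1 →ₗ[R] B p.1.2 →ₗ[R] C) :
    tensorSum R A B n ⟶ C :=
  ModuleCat.ofHom (DirectSum.toModule R _ _ fun p => TensorProduct.lift (c p))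

lemma tensorSumMap_desc {A B A₂ B₂ : ℕ → ModuleCat.{u} R} {C C₂ : ModuleCat.{u} R} {n : ℕ}
    (f : ∀ i, A i ⟶ A₂ i) (g : ∀ i, B i ⟶ B₂ i) (h : C ⟶ C₂)
    (c : ∀ p : {p : ℕ × ℕ // p.1 + p.2 = n}, A p.1.1 →ₗ[R] B p.1.2 →ₗ[R] C)
    (c₂ : ∀ p : {p : ℕ × ℕ // p.1 + p.2 = n}, A₂ p.1.1 →ₗ[R] B₂ p.1.2 →ₗ[R] C₂)
    (H : ∀ p a b, h.hom (c p a b) = c₂ p ((f p.1.1).hom a) ((g p.1.2).hom b)) :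
    tensorSumMap f g n ≫ tensorSumDesc c₂ = tensorSumDesc c ≫ h := by
  refine ModuleCat.hom_ext (DirectSum.linearMap_ext R fun p => TensorProduct.ext' fun a b => ?_)
  simp [tensorSumMap, tensorSumDesc, DirectSum.lmap_lof, H, tensorSum]

/-- `⨁_{i + j + 1 = n} Tor₁(f i, g j)`. -/
def torSumMap {A B A₂ B₂ : ℕ → ModuleCat.{u} R} (f : ∀ i, A i ⟶ A₂ i) (g : ∀ i, B i ⟶ B₂ i)
    (n : ℕ) : torSum R A B n ⟶ torSum R A₂ B₂ n :=
  ModuleCat.ofHom (DirectSum.lmap fun p : {p : ℕ × ℕ // p.1 + p.2 + 1 = n} =>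
    (((Tor (ModuleCat.{u} R) 1).map (f p.1.1)).app (B p.1.2) ≫
      ((Tor (ModuleCat.{u} R) 1).obj (A₂ p.1.1)).map (g p.1.2)).hom)

variable (R) {V V' W W' : Type u}

/-- The cross product `⨁_{i + j = n} H̃_{i-1}(K) ⊗ H̃_{j-1}(K') → H̃_{n-1}(K * K')`,
`[x] ⊗ [y] ↦ [x * y]`, for directed simplicial complexes. -/
def directedCross (K : DirectedComplex V) (K' : DirectedComplex V') (n : ℕ) :
    tensorSum R (K.homology R) (K'.homology R) n ⟶ (K.join K').homology R n :=
  tensorSumDesc fun p => cross R (joinSeq_mem_augmented K K') p.2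

/-- The cross product `⨁_{i + j = n} H̃_{i-1}(K) ⊗ H̃_{j-1}(K') → H̃_{n-1}(K * K')`,
`[x] ⊗ [y] ↦ [x * y]`, for simplicial complexes. -/
def simplicialCross [LinearOrder V] [LinearOrder V'] (K : PreAbstractSimplicialComplex V)
    (K' : PreAbstractSimplicialComplex V') (n : ℕ) :
    tensorSum R (simplicialHomology R K) (simplicialHomology R K') n ⟶
      simplicialHomology R (simplicialJoin K K') n :=
  tensorSumDesc fun p => cross R (joinSeq_mem_ordered K K') p.2

lemma directedCross_natural {K : DirectedComplex V} {K' : DirectedComplex V'}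
    {L : DirectedComplex W} {L' : DirectedComplex W'} (φ : DirectedMap K L)
    (φ' : DirectedMap K' L') (n : ℕ) :
    tensorSumMap (φ.onHomology R) (φ'.onHomology R) n ≫ directedCross R L L' n =
      directedCross R K K' n ≫ (φ.join φ').onHomology R n := by
  refine tensorSumMap_desc _ _ _ _ _ fun p a b => ?_
  exact homologyMap_cross (joinSeq_mem_augmented K K') (joinSeq_mem_augmented L L')
    (pushSeq_boundary R φ.toFun) (φ.chains_le R) (pushSeq_boundary R φ'.toFun) (φ'.chains_le R)
    (pushSeq_boundary R (φ.join φ').toFun) ((φ.join φ').chains_le R)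
    (pushSeq_joinChain φ.toFun φ'.toFun) p.2 a b

lemma simplicialCross_natural [LinearOrder V] [LinearOrder V'] [LinearOrder W] [LinearOrder W']
    {K : PreAbstractSimplicialComplex V} {K' : PreAbstractSimplicialComplex V'}
    {L : PreAbstractSimplicialComplex W} {L' : PreAbstractSimplicialComplex W'}
    (φ : SimplicialMap K L) (φ' : SimplicialMap K' L') (n : ℕ) :
    tensorSumMap (φ.onHomology R) (φ'.onHomology R) n ≫ simplicialCross R L L' n =
      simplicialCross R K K' n ≫ (φ.join φ').onHomology R n := by
  refine tensorSumMap_desc _ _ _ _ _ fun p a b => ?_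
  exact homologyMap_cross (joinSeq_mem_ordered K K') (joinSeq_mem_ordered L L')
    (orient_pushSeq_boundary R φ.toFun) (φ.chains_le R)
    (orient_pushSeq_boundary R φ'.toFun) (φ'.chains_le R)
    (orient_pushSeq_boundary R (φ.join φ').toFun) ((φ.join φ').chains_le R)
    (fun x y => (congrArg (orient R) (pushSeq_joinChain φ.toFun φ'.toFun x y)).trans
      (orient_joinChain _ _)) p.2 a b

lemma cross_projection [LinearOrder V] [LinearOrder V'] {K : DirectedComplex V}
    {L : PreAbstractSimplicialComplex V} (h : K.underlying = L) {K' : DirectedComplex V'}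
    {L' : PreAbstractSimplicialComplex V'} (h' : K'.underlying = L') (n : ℕ) :
    tensorSumMap (projection R h) (projection R h') n ≫ simplicialCross R L L' n =
      directedCross R K K' n ≫ projection R (underlying_join h h') n := by
  refine tensorSumMap_desc _ _ _ _ _ fun p a b => ?_
  exact homologyMap_cross (joinSeq_mem_augmented K K') (joinSeq_mem_ordered L L')
    (orient_boundary R) (chains_le_orient R h) (orient_boundary R) (chains_le_orient R h')
    (orient_boundary R) (chains_le_orient R (underlying_join h h')) orient_joinChain p.2 a b

/-- Connecting maps which complete the cross products, for all directed simplicial complexes and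
for all simplicial complexes on totally ordered sets, to short exact sequences
`0 → ⨁_{i + j = n} H̃_{i-1}(K) ⊗ H̃_{j-1}(K') → H̃_{n-1}(K * K') →
⨁_{i + j + 1 = n} Tor₁(H̃_{i-1}(K), H̃_{j-1}(K')) → 0`,
and which are natural for directed simplicial maps, for simplicial maps, and for the projections
of directed simplicial complexes to their underlying simplicial complexes. -/
structure KunnethSequences where
  /-- The connecting maps for directed simplicial complexes. -/
  directed : ∀ {V V' : Type u} (K : DirectedComplex V) (K' : DirectedComplex V') (n : ℕ),
    (K.join K').homology R n ⟶ torSum R (K.homology R) (K'.homology R) n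
  /-- The connecting maps for simplicial complexes. -/
  simplicial : ∀ {V V' : Type u} [LinearOrder V] [LinearOrder V']
    (K : PreAbstractSimplicialComplex V) (K' : PreAbstractSimplicialComplex V') (n : ℕ),
    simplicialHomology R (simplicialJoin K K') n ⟶
      torSum R (simplicialHomology R K) (simplicialHomology R K') n
  directed_zero : ∀ {V V' : Type u} (K : DirectedComplex V) (K' : DirectedComplex V') (n : ℕ),
    directedCross R K K' n ≫ directed K K' n = 0
  simplicial_zero : ∀ {V V' : Type u} [LinearOrder V] [LinearOrder V']
    (K : PreAbstractSimplicialComplex V) (K' : PreAbstractSimplicialComplex V') (n : ℕ),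
    simplicialCross R K K' n ≫ simplicial K K' n = 0
  directed_shortExact : ∀ {V V' : Type u} (K : DirectedComplex V) (K' : DirectedComplex V')
    (n : ℕ), (ShortComplex.mk (directedCross R K K' n) (directed K K' n)
      (directed_zero K K' n)).ShortExact
  simplicial_shortExact : ∀ {V V' : Type u} [LinearOrder V] [LinearOrder V']
    (K : PreAbstractSimplicialComplex V) (K' : PreAbstractSimplicialComplex V') (n : ℕ),
    (ShortComplex.mk (simplicialCross R K K' n) (simplicial K K' n)
      (simplicial_zero K K' n)).ShortExact
  directed_natural : ∀ {V V' W W' : Type u} {K : DirectedComplex V} {K' : DirectedComplex V'}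
    {L : DirectedComplex W} {L' : DirectedComplex W'} (φ : DirectedMap K L)
    (φ' : DirectedMap K' L') (n : ℕ),
    (φ.join φ').onHomology R n ≫ directed L L' n =
      directed K K' n ≫ torSumMap (φ.onHomology R) (φ'.onHomology R) n
  simplicial_natural : ∀ {V V' W W' : Type u} [LinearOrder V] [LinearOrder V'] [LinearOrder W]
    [LinearOrder W'] {K : PreAbstractSimplicialComplex V} {K' : PreAbstractSimplicialComplex V'}
    {L : PreAbstractSimplicialComplex W} {L' : PreAbstractSimplicialComplex W'}
    (φ : SimplicialMap K L) (φ' : SimplicialMap K' L') (n : ℕ),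
    (φ.join φ').onHomology R n ≫ simplicial L L' n =
      simplicial K K' n ≫ torSumMap (φ.onHomology R) (φ'.onHomology R) n
  projection_natural : ∀ {V V' : Type u} [LinearOrder V] [LinearOrder V']
    {K : DirectedComplex V} {L : PreAbstractSimplicialComplex V} (h : K.underlying = L)
    {K' : DirectedComplex V'} {L' : PreAbstractSimplicialComplex V'} (h' : K'.underlying = L')
    (n : ℕ),
    projection R (underlying_join h h') n ≫ simplicial L L' n =
      directed K K' n ≫ torSumMap (projection R h) (projection R h') n

namespace KunnethSequences

variable {R} (κ : KunnethSequences R)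

/-- The Künneth sequence of two directed simplicial complexes, with middle term
`H̃_{n-1}(K * K')`. -/
def directedSeq (K : DirectedComplex V) (K' : DirectedComplex V') (n : ℕ) :
    ShortComplex (ModuleCat.{u} R) :=
  ShortComplex.mk (directedCross R K K' n) (κ.directed K K' n) (κ.directed_zero K K' n)

/-- The Künneth sequence of two simplicial complexes, with middle term `H̃_{n-1}(K * K')`. -/
def simplicialSeq [LinearOrder V] [LinearOrder V'] (K : PreAbstractSimplicialComplex V)
    (K' : PreAbstractSimplicialComplex V') (n : ℕ) : ShortComplex (ModuleCat.{u} R) :=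
  ShortComplex.mk (simplicialCross R K K' n) (κ.simplicial K K' n) (κ.simplicial_zero K K' n)

/-- The morphism of Künneth sequences induced by directed simplicial maps `φ` and `φ'`; it is
`⨁ φ_* ⊗ φ'_*`, `(φ * φ')_*` and `⨁ Tor₁(φ_*, φ'_*)` on the three terms. -/
def directedSeqMap {K : DirectedComplex V} {K' : DirectedComplex V'} {L : DirectedComplex W}
    {L' : DirectedComplex W'} (φ : DirectedMap K L) (φ' : DirectedMap K' L') (n : ℕ) :
    κ.directedSeq K K' n ⟶ κ.directedSeq L L' n where
  τ₁ := tensorSumMap (φ.onHomology R) (φ'.onHomology R) n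
  τ₂ := (φ.join φ').onHomology R n
  τ₃ := torSumMap (φ.onHomology R) (φ'.onHomology R) n
  comm₁₂ := directedCross_natural R φ φ' n
  comm₂₃ := κ.directed_natural φ φ' n

/-- The morphism of Künneth sequences induced by simplicial maps `φ` and `φ'`; it is
`⨁ φ_* ⊗ φ'_*`, `(φ * φ')_*` and `⨁ Tor₁(φ_*, φ'_*)` on the three terms. -/
def simplicialSeqMap [LinearOrder V] [LinearOrder V'] [LinearOrder W] [LinearOrder W']
    {K : PreAbstractSimplicialComplex V} {K' : PreAbstractSimplicialComplex V'}
    {L : PreAbstractSimplicialComplex W} {L' : PreAbstractSimplicialComplex W'}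
    (φ : SimplicialMap K L) (φ' : SimplicialMap K' L') (n : ℕ) :
    κ.simplicialSeq K K' n ⟶ κ.simplicialSeq L L' n where
  τ₁ := tensorSumMap (φ.onHomology R) (φ'.onHomology R) n
  τ₂ := (φ.join φ').onHomology R n
  τ₃ := torSumMap (φ.onHomology R) (φ'.onHomology R) n
  comm₁₂ := simplicialCross_natural R φ φ' n
  comm₂₃ := κ.simplicial_natural φ φ' n

/-- The morphism of Künneth sequences induced by the projections `π` of two directed simplicial
complexes and of their join to the underlying simplicial complexes. -/
def projectionSeq [LinearOrder V] [LinearOrder V'] {K : DirectedComplex V}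
    {L : PreAbstractSimplicialComplex V} (h : K.underlying = L) {K' : DirectedComplex V'}
    {L' : PreAbstractSimplicialComplex V'} (h' : K'.underlying = L') (n : ℕ) :
    κ.directedSeq K K' n ⟶ κ.simplicialSeq L L' n where
  τ₁ := tensorSumMap (projection R h) (projection R h') n
  τ₂ := projection R (underlying_join h h') n
  τ₃ := torSumMap (projection R h) (projection R h') n
  comm₁₂ := cross_projection R h h' n
  comm₂₃ := κ.projection_natural h h' n

end KunnethSequences

end Kunneth

section Graphs

variable {V V' W W' : Type u}

/-- The directed independence complex of a graph: the non-empty finite sequences of distinct,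
mutually non-adjacent vertices. -/
def directedInd (G : SimpleGraph V) : DirectedComplex V where
  faces := {l | l ≠ [] ∧ l.Nodup ∧ G.IsIndepSet {v | v ∈ l}}
  ne_nil _ h := h.1
  nodup _ h := h.2.1
  sublist_mem _ h _ hl hne := ⟨hne, h.2.1.sublist hl, h.2.2.mono fun _ hv => hl.subset hv⟩

/-- The independence complex of a graph: the non-empty finite sets of mutually non-adjacent
vertices. -/
def Ind (G : SimpleGraph V) : PreAbstractSimplicialComplex V where
  faces := {σ | σ.Nonempty ∧ G.IsIndepSet (σ : Set V)}
  isRelLowerSet_faces _ h := ⟨h.1, fun _ hτ hne => ⟨hne, h.2.mono (Finset.coe_subset.2 hτ)⟩⟩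

/-- The `(k - 1)`-skeleton of a directed simplicial complex: the directed simplices with at most
`k` vertices. -/
def DirectedComplex.skeleton (K : DirectedComplex V) (k : ℕ) : DirectedComplex V where
  faces := {l | l ∈ K.faces ∧ l.length ≤ k}
  ne_nil l h := K.ne_nil l h.1
  nodup l h := K.nodup l h.1
  sublist_mem l h l' hl hne := ⟨K.sublist_mem l h.1 l' hl hne, hl.length_le.trans h.2⟩

/-- The `(k - 1)`-skeleton of a simplicial complex: the simplices with at most `k` vertices. -/
def simplicialSkeleton (K : PreAbstractSimplicialComplex V) (k : ℕ) :
    PreAbstractSimplicialComplex V where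
  faces := {σ | σ ∈ K.faces ∧ σ.card ≤ k}
  isRelLowerSet_faces _ h := ⟨(K.isRelLowerSet_faces h.1).1, fun _ hτ hne =>
    ⟨(K.isRelLowerSet_faces h.1).2 hτ hne, (Finset.card_le_card hτ).trans h.2⟩⟩

lemma underlying_skeleton_directedInd (G : SimpleGraph V) (k : ℕ) :
    ((directedInd G).skeleton k).underlying = simplicialSkeleton (Ind G) k := by
  classical
  ext σ
  constructor
  · rintro ⟨l, ⟨⟨hne, hd, hi⟩, hk⟩, h⟩
    obtain rfl : σ = l.toFinset := by ext v; simp [h]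
    refine ⟨⟨?_, ?_⟩, ?_⟩
    · simpa using hne
    · simpa using hi
    · rwa [List.toFinset_card_of_nodup hd]
  · rintro ⟨⟨hne, hi⟩, hk⟩
    refine ⟨σ.toList, ⟨⟨?_, σ.nodup_toList, ?_⟩, ?_⟩, by simp⟩
    · simpa using hne.ne_empty
    · have hs : {v | v ∈ σ.toList} = (σ : Set V) := by ext; simp
      rwa [hs]
    · simpa using hk

/-- The simplicial complex of the non-empty finite independent sets of a matroid. -/
def matroidComplex (M : Matroid V) : PreAbstractSimplicialComplex V where
  faces := {σ | σ.Nonempty ∧ M.Indep (σ : Set V)}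
  isRelLowerSet_faces _ h := ⟨h.1, fun _ hτ hne => ⟨hne, h.2.subset (Finset.coe_subset.2 hτ)⟩⟩

/-- The directed simplicial complex of the non-empty independent sequences of a matroid, i.e. of
the sequences of distinct elements whose sets of entries are independent. -/
def directedMatroidComplex (M : Matroid V) : DirectedComplex V where
  faces := {l | l ≠ [] ∧ l.Nodup ∧ M.Indep {v | v ∈ l}}
  ne_nil _ h := h.1
  nodup _ h := h.2.1
  sublist_mem _ h _ hl hne := ⟨hne, h.2.1.sublist hl, h.2.2.subset fun _ hv => hl.subset hv⟩

lemma underlying_directedMatroidComplex (M : Matroid V) :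
    (directedMatroidComplex M).underlying = matroidComplex M := by
  classical
  ext σ
  constructor
  · rintro ⟨l, ⟨hne, hd, hi⟩, h⟩
    obtain rfl : σ = l.toFinset := by ext v; simp [h]
    exact ⟨by simpa using hne, by simpa using hi⟩
  · rintro ⟨hne, hi⟩
    refine ⟨σ.toList, ⟨by simpa using hne.ne_empty, σ.nodup_toList, ?_⟩, by simp⟩
    have hs : {v | v ∈ σ.toList} = (σ : Set V) := by ext; simp
    rwa [hs]

/-- The map of `(k - 1)`-skeleta of directed independence complexes given by an embedding of
graphs, i.e. by the inclusion of an induced subgraph. -/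
def directedIndMap {H : SimpleGraph W} {G : SimpleGraph V} (e : H ↪g G) (k : ℕ) :
    DirectedMap ((directedInd H).skeleton k) ((directedInd G).skeleton k) where
  toFun := e
  map_mem := by
    rintro l ⟨⟨hne, hd, hi⟩, hk⟩
    refine ⟨⟨by simpa using hne, hd.map e.injective, ?_⟩, by simpa using hk⟩
    intro v hv w hw hvw
    obtain ⟨a, ha, rfl⟩ := List.mem_map.1 hv
    obtain ⟨b, hb, rfl⟩ := List.mem_map.1 hw
    rw [e.map_adj_iff]
    exact hi ha hb fun h => hvw (congrArg e h)

/-- The map of `(k - 1)`-skeleta of independence complexes given by an embedding of graphs, i.e.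
by the inclusion of an induced subgraph. -/
def indMap {H : SimpleGraph W} {G : SimpleGraph V} (e : H ↪g G) (k : ℕ) :
    SimplicialMap (simplicialSkeleton (Ind H) k) (simplicialSkeleton (Ind G) k) where
  toFun := e
  image_mem := by
    rintro σ ⟨⟨hne, hi⟩, hk⟩
    refine ⟨σ.map e.toEmbedding, ⟨⟨by simpa using hne, ?_⟩, by simpa using hk⟩, by simp⟩
    intro v hv w hw hvw
    obtain ⟨a, ha, rfl⟩ := Finset.mem_map.1 hv
    obtain ⟨b, hb, rfl⟩ := Finset.mem_map.1 hw
    exact fun h => hi ha hb (fun h' => hvw (congrArg e h')) (e.map_adj_iff.1 h)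

end Graphs

section Regular

variable (F : Type u) [Field F] {V V' W : Type u} {N N' : ℕ}

/-- The matroid on a finite set `S` of vectors whose independent sets are the linearly
independent subsets of `S`. -/
def vectorMatroid (S : Finset (Fin N → F)) : Matroid S :=
  (IndepMatroid.ofFinite (E := Set.univ) Set.finite_univ
    (fun I : Set S => LinearIndepOn F (fun s : S => (s : Fin N → F)) I)
    (linearIndepOn_empty F _)
    (fun _ _ hJ hIJ => hJ.mono hIJ)
    (fun I J hI hJ hIJ => by
      classical
      by_contra! h
      have hs : ∀ e ∈ J, (e : Fin N → F) ∈ Submodule.span F ((fun s : S => (s : Fin N → F)) '' I) := by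
        intro e he
        by_cases heI : e ∈ I
        · exact Submodule.subset_span ⟨e, heI, rfl⟩
        · have := h e he heI
          rw [linearIndepOn_insert heI] at this
          by_contra h'
          exact this ⟨hI, h'⟩
      have hle : Submodule.span F ((fun s : S => (s : Fin N → F)) '' J) ≤
          Submodule.span F ((fun s : S => (s : Fin N → F)) '' I) := by
        rw [Submodule.span_le]
        rintro _ ⟨e, he, rfl⟩
        exact hs e he
      have card : ∀ T : Set S, LinearIndepOn F (fun s : S => (s : Fin N → F)) T →
          Module.finrank F (Submodule.span F ((fun s : S => (s : Fin N → F)) '' T)) = T.ncard := by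
        intro T hT
        rw [Set.image_eq_range, ← Nat.card_coe_set_eq, Nat.card_eq_fintype_card]
        exact finrank_span_eq_card hT
      have := Submodule.finrank_mono hle
      rw [card I hI, card J hJ] at this
      omega)
    (fun I _ => Set.subset_univ I)).matroid

lemma vectorMatroid_indep (S : Finset (Fin N → F)) (I : Set S) :
    (vectorMatroid F S).Indep I ↔ LinearIndepOn F (fun s : S => (s : Fin N → F)) I := Iff.rfl

/-- A map `f : V → F^N` is `k`-regular on a graph `G` if the images of any at most `k` distinct,
mutually non-adjacent vertices are linearly independent. -/
def IsRegular (G : SimpleGraph V) (k : ℕ) (f : V → Fin N → F) : Prop :=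
  ∀ σ : Finset V, G.IsIndepSet (σ : Set V) → σ.card ≤ k → LinearIndepOn F f (σ : Set V)

/-- A map `g` from the disjoint union of the vertex sets of `G` and `G'` to a vector space is
`(G, k; G', k')`-regular if the images of any at most `k` distinct, mutually non-adjacent vertices
of `G` together with any at most `k'` distinct, mutually non-adjacent vertices of `G'` are linearly
independent. -/
def IsPairRegular {E : Type u} [AddCommGroup E] [Module F E] (G : SimpleGraph V) (k : ℕ)
    (G' : SimpleGraph V') (k' : ℕ) (g : V ⊕ₗ V' → E) : Prop :=
  ∀ (σ : Finset V) (σ' : Finset V'), G.IsIndepSet (σ : Set V) → σ.card ≤ k →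
    G'.IsIndepSet (σ' : Set V') → σ'.card ≤ k' →
    LinearIndepOn F g (joinFinset σ σ' : Set (V ⊕ₗ V'))

/-- The map `(f, f')`, which sends `v` to `(f v, 0)` and `v'` to `(0, f' v')`. -/
def pairMap (f : V → Fin N → F) (f' : V' → Fin N' → F) (v : V ⊕ₗ V') :
    (Fin N → F) × (Fin N' → F) :=
  Sum.elim (fun a => (f a, 0)) (fun b => (0, f' b)) (ofLex v)

variable {F} {G : SimpleGraph V} {k : ℕ} {f : V → Fin N → F} {S : Finset (Fin N → F)}

lemma IsRegular.comp {H : SimpleGraph W} (hf : IsRegular F G k f) (e : H ↪g G) :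
    IsRegular F H k (f ∘ e) := by
  classical
  intro σ hσ hk
  have h := hf (σ.map e.toEmbedding) ?_ (by simpa using hk)
  · rw [Finset.coe_map] at h
    exact h.comp_of_image e.injective.injOn
  · intro v hv w hw hvw
    obtain ⟨a, ha, rfl⟩ := Finset.mem_map.1 hv
    obtain ⟨b, hb, rfl⟩ := Finset.mem_map.1 hw
    exact fun h => hσ ha hb (fun h' => hvw (congrArg e h')) (e.map_adj_iff.1 h)

lemma linearIndepOn_image {σ : Set V} (h : LinearIndepOn F f σ) (hS : ∀ v, f v ∈ S) :
    LinearIndepOn F (fun s : S => (s : Fin N → F)) ((fun v => (⟨f v, hS v⟩ : S)) '' σ) :=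
  LinearIndepOn.image_of_comp (fun v => (⟨f v, hS v⟩ : S)) _ h

/-- The directed simplicial map from the `(k - 1)`-skeleton of the directed independence complex
to the directed matroid on `S`, induced by a `k`-regular map with values in `S`. -/
def IsRegular.directedMap (hf : IsRegular F G k f) (hS : ∀ v, f v ∈ S) :
    DirectedMap ((directedInd G).skeleton k) (directedMatroidComplex (vectorMatroid F S)) where
  toFun v := ⟨f v, hS v⟩
  map_mem := by
    classical
    rintro l ⟨⟨hne, hd, hi⟩, hk⟩
    have hl : ((l.toFinset : Finset V) : Set V) = {v | v ∈ l} := by ext; simp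
    have h := hf l.toFinset (by rwa [hl]) (by rwa [List.toFinset_card_of_nodup hd])
    rw [hl] at h
    refine ⟨by simpa using hne, ?_, ?_⟩
    · refine List.Nodup.map_on (fun a ha b hb hab => h.injOn ha hb ?_) hd
      exact congrArg Subtype.val hab
    · have := linearIndepOn_image h hS
      rw [vectorMatroid_indep]
      convert this using 1
      ext s
      simp

/-- The simplicial map from the `(k - 1)`-skeleton of the independence complex to the matroid on
`S`, induced by a `k`-regular map with values in `S`. -/
def IsRegular.simplicialMap (hf : IsRegular F G k f) (hS : ∀ v, f v ∈ S) :
    SimplicialMap (simplicialSkeleton (Ind G) k) (matroidComplex (vectorMatroid F S)) where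
  toFun v := ⟨f v, hS v⟩
  image_mem := by
    classical
    rintro σ ⟨⟨hne, hi⟩, hk⟩
    refine ⟨σ.image fun v => ⟨f v, hS v⟩, ⟨hne.image _, ?_⟩, by simp⟩
    rw [vectorMatroid_indep, Finset.coe_image]
    exact linearIndepOn_image (hf σ hi hk) hS

end Regular

end

end RegularKunneth

open RegularKunneth CategoryTheory

-- Simplices are graded by their number of entries, so the empty sequence sits in degree zero. With
-- this grading every sequence of a join splits uniquely into a part in `V` followed by a part in
-- `V'`, and the Leibniz rule has sign `(-1)^i` with `i` the length of the first part. Hence the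
-- augmented chain complex of the join is exactly the total complex of the tensor product of the two
-- augmented chain complexes (`isTotal`), and the theorem becomes the algebraic Künneth theorem,
-- done naturally.
--
-- Write `C`, `Z`, `H` for chains, cycles and homology of the first factor, and `C'`, `Z'`, `B'`,
-- `H'` for those of the second together with its boundaries. Over a principal ideal domain `Z'` and
-- `B'` are free (`free_submodule`), so `0 → B'_j → Z'_j → H'_j → 0` is a projective resolution and
-- `Tor₁(H_i, H'_j)` is the kernel of `H_i ⊗ B'_j → H_i ⊗ Z'_j`, naturally in both arguments
-- (`torInclusion_exact`, `torInclusion_natural`). The connecting map sends a cycle of the total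
-- complex to `(1 ⊗ ∂')` of its component in bidegree `(i, j + 1)`. This lies in `Z_i ⊗ B'_j` by
-- flatness of `B'_j` and the Leibniz rule, its class in `H_i ⊗ B'_j` dies in `H_i ⊗ Z'_j`, and
-- boundaries go to zero, so it defines an element of `Tor₁`. Exactness is proved by hand in
-- `IsCross.injective`, `IsCross.exact_connecting` and `connecting_surjective`.
--
-- The connecting map involves no choices: the retractions `C'_j → Z'_j` are used only through their
-- existence, to prove vanishing statements. It is therefore natural for every pair of chain maps
-- covered by a chain map of the total complexes compatible with concatenation
-- (`connecting_natural`, `joinConnecting_natural`). Directed maps, simplicial maps and the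
-- projections `π` are three instances; the last two work because orienting a concatenation orients
-- each half, all of `V` preceding all of `V'`.
--
-- For the commutative diagram and its functoriality only vertex maps matter. The essential fact is
-- `orient_pushSeq_orient`: sorting before applying a vertex map does not change the sorted, signed
-- image. It makes simplicial maps functorial on homology and makes `π_*` commute with induced maps,
-- first on homology and then on the tensor, join and `Tor` terms. The statements about `(f, f')`
-- say that a block-diagonal family is linearly independent exactly when both blocks are
-- (`linearIndepOn_pairMap`).

namespace RegularKunneth

open TensorProduct CategoryTheory

-- Algebraic Künneth theorem for the total complex of two complexes.

section AlgebraicKunneth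

variable {R : Type u} [CommRing R]

lemma rTensor_lTensor_comm {M M₂ N N₂ : Type*} [AddCommGroup M] [AddCommGroup M₂]
    [AddCommGroup N] [AddCommGroup N₂] [Module R M] [Module R M₂] [Module R N] [Module R N₂]
    (f : M →ₗ[R] M₂) (g : N →ₗ[R] N₂) (x : M ⊗[R] N) :
    f.rTensor N₂ (g.lTensor M x) = g.lTensor M₂ (f.rTensor N x) := by
  rw [← LinearMap.comp_apply, ← LinearMap.comp_apply, LinearMap.rTensor_comp_lTensor,
    LinearMap.lTensor_comp_rTensor]

/-- Families of chains, cycles and homology modules, with the inclusions of the cycles, the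
boundary maps and the projections to homology. -/
structure IsCycleData {C Z H : ℕ → Type u} [∀ i, AddCommGroup (C i)] [∀ i, AddCommGroup (Z i)]
    [∀ i, AddCommGroup (H i)] [∀ i, Module R (C i)] [∀ i, Module R (Z i)] [∀ i, Module R (H i)]
    (ι : ∀ i, Z i →ₗ[R] C i) (b : ∀ i, C (i + 1) →ₗ[R] Z i) (π : ∀ i, Z i →ₗ[R] H i) :
    Prop where
  inj : ∀ i, Function.Injective (ι i)
  surj_zero : Function.Surjective (ι 0)
  exact_chains : ∀ i, Function.Exact (ι (i + 1)) (b i)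
  exact_cycles : ∀ i, Function.Exact (b i) (π i)
  surj : ∀ i, Function.Surjective (π i)

namespace IsCycleData

variable {C Z H : ℕ → Type u} [∀ i, AddCommGroup (C i)] [∀ i, AddCommGroup (Z i)]
    [∀ i, AddCommGroup (H i)] [∀ i, Module R (C i)] [∀ i, Module R (Z i)] [∀ i, Module R (H i)]
    {ι : ∀ i, Z i →ₗ[R] C i} {b : ∀ i, C (i + 1) →ₗ[R] Z i} {π : ∀ i, Z i →ₗ[R] H i}
    (E : IsCycleData ι b π)
include E

lemma b_ι (i : ℕ) (z : Z (i + 1)) : b i (ι (i + 1) z) = 0 := (E.exact_chains i).apply_apply_eq_zero z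

lemma π_b (i : ℕ) (x : C (i + 1)) : π i (b i x) = 0 := (E.exact_cycles i).apply_apply_eq_zero x

/-- Corestricting the boundary to its image makes it surjective, which is what right exactness of
the tensor product requires. -/
lemma exact_range (j : ℕ) : Function.Exact (ι (j + 1)) (b j).rangeRestrict := by
  intro x
  rw [← E.exact_chains j x, ← Subtype.val_inj]
  rfl

lemma rangeRestrict_comp_ι (j : ℕ) : (b j).rangeRestrict ∘ₗ ι (j + 1) = 0 :=
  LinearMap.ext fun z => Subtype.ext (E.b_ι j z)

lemma lTensor_exact_range (M : Type*) [AddCommGroup M] [Module R M] (j : ℕ) :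
    Function.Exact ((ι (j + 1)).lTensor M) ((b j).rangeRestrict.lTensor M) :=
  lTensor_exact M (E.exact_range j) (b j).surjective_rangeRestrict

lemma lTensor_rangeRestrict_ι (M : Type*) [AddCommGroup M] [Module R M] (j : ℕ)
    (x : M ⊗[R] Z (j + 1)) : (b j).rangeRestrict.lTensor M ((ι (j + 1)).lTensor M x) = 0 :=
  (E.lTensor_exact_range M j).apply_apply_eq_zero x

lemma rTensor_b_ι (M : Type*) [AddCommGroup M] [Module R M] (j : ℕ)
    (x : Z (j + 1) ⊗[R] M) : (b j).rTensor M ((ι (j + 1)).rTensor M x) = 0 := by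
  rw [← LinearMap.rTensor_comp_apply, (E.exact_chains j).linearMap_comp_eq_zero,
    LinearMap.rTensor_zero, LinearMap.zero_apply]

lemma rTensor_exact_cycles (M : Type*) [AddCommGroup M] [Module R M] (i : ℕ) :
    Function.Exact ((b i).rTensor M) ((π i).rTensor M) :=
  rTensor_exact M (E.exact_cycles i) (E.surj i)

lemma rTensor_inj (M : Type*) [AddCommGroup M] [Module R M] [Module.Flat R M] (i : ℕ) :
    Function.Injective ((ι i).rTensor M) :=
  Module.Flat.rTensor_preserves_injective_linearMap _ (E.inj i)

lemma rTensor_exact_chains (M : Type*) [AddCommGroup M] [Module R M] [Module.Flat R M] (i : ℕ) :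
    Function.Exact ((ι (i + 1)).rTensor M) ((b i).rTensor M) :=
  Module.Flat.rTensor_exact M (E.exact_chains i)

/-- For flat `M`, a tensor in `C (i + 1) ⊗ M` whose boundary vanishes comes from
`Z (i + 1) ⊗ M`. -/
lemma exists_rTensor {M : Type*} [AddCommGroup M] [Module R M] [Module.Flat R M] {i : ℕ}
    {y : C (i + 1) ⊗[R] M} (h : (ι i ∘ₗ b i).rTensor M y = 0) :
    ∃ z, (ι (i + 1)).rTensor M z = y := by
  refine (E.rTensor_exact_chains M i y).1 (E.rTensor_inj M i ?_)
  rw [← LinearMap.rTensor_comp_apply, h, map_zero]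

end IsCycleData

variable {C Z H C' Z' H' T ZT HT : ℕ → Type u}
  [∀ i, AddCommGroup (C i)] [∀ i, AddCommGroup (Z i)] [∀ i, AddCommGroup (H i)]
  [∀ i, Module R (C i)] [∀ i, Module R (Z i)] [∀ i, Module R (H i)]
  [∀ i, AddCommGroup (C' i)] [∀ i, AddCommGroup (Z' i)] [∀ i, AddCommGroup (H' i)]
  [∀ i, Module R (C' i)] [∀ i, Module R (Z' i)] [∀ i, Module R (H' i)]
  [∀ i, AddCommGroup (T i)] [∀ i, AddCommGroup (ZT i)] [∀ i, AddCommGroup (HT i)]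
  [∀ i, Module R (T i)] [∀ i, Module R (ZT i)] [∀ i, Module R (HT i)]
  {ι : ∀ i, Z i →ₗ[R] C i} {b : ∀ i, C (i + 1) →ₗ[R] Z i} {π : ∀ i, Z i →ₗ[R] H i}
  {ι' : ∀ i, Z' i →ₗ[R] C' i} {b' : ∀ i, C' (i + 1) →ₗ[R] Z' i} {π' : ∀ i, Z' i →ₗ[R] H' i}
  {ιT : ∀ i, ZT i →ₗ[R] T i} {bT : ∀ i, T (i + 1) →ₗ[R] ZT i} {πT : ∀ i, ZT i →ₗ[R] HT i}
  {c : ∀ n i j, T n →ₗ[R] C i ⊗[R] C' j}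

/-- `T` is the total complex of the tensor product of two complexes, with components `c`. -/
structure IsTotal (ι : ∀ i, Z i →ₗ[R] C i) (b : ∀ i, C (i + 1) →ₗ[R] Z i)
    (ι' : ∀ i, Z' i →ₗ[R] C' i) (b' : ∀ i, C' (i + 1) →ₗ[R] Z' i)
    (ιT : ∀ i, ZT i →ₗ[R] T i) (bT : ∀ i, T (i + 1) →ₗ[R] ZT i)
    (c : ∀ n i j, T n →ₗ[R] C i ⊗[R] C' j) : Prop where
  eq_zero : ∀ {n} {w : T n}, (∀ i j, i + j = n → c n i j w = 0) → w = 0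
  exists_eq : ∀ n (t : ∀ i j, C i ⊗[R] C' j), ∃ w : T n, ∀ i j, i + j = n → c n i j w = t i j
  leibniz : ∀ {n i j} (_ : i + j = n) (w : T (n + 1)), c n i j (ιT n (bT n w)) =
    (ι i ∘ₗ b i).rTensor (C' j) (c (n + 1) (i + 1) j w) +
      (-1 : R) ^ i • (ι' j ∘ₗ b' j).lTensor (C i) (c (n + 1) i (j + 1) w)

-- Construction of the connecting map.

section Connecting

variable (E : IsCycleData ι b π) (E' : IsCycleData ι' b' π') (ET : IsCycleData ιT bT πT)
  (D : IsTotal ι b ι' b' ιT bT c)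
  [∀ j, Module.Flat R (Z' j)] [∀ j, Module.Flat R (LinearMap.range (b' j))]

include E' D in
omit [∀ j, Module.Flat R (Z' j)] [∀ j, Module.Flat R (LinearMap.range (b' j))] in
/-- The boundary of `C'` kills the second summand of the Leibniz rule. -/
lemma lTensor_rangeRestrict_leibniz {n i j : ℕ} (h : i + (j + 1) = n) (w : T (n + 1)) :
    (b' j).rangeRestrict.lTensor (C i) (c n i (j + 1) (ιT n (bT n w))) =
      (ι i ∘ₗ b i).rTensor _ ((b' j).rangeRestrict.lTensor _ (c (n + 1) (i + 1) (j + 1) w)) := by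
  rw [D.leibniz h, map_add, map_smul, LinearMap.lTensor_comp_apply,
    E'.lTensor_rangeRestrict_ι, smul_zero, add_zero, rTensor_lTensor_comm]

include E E' D in
omit [∀ j, Module.Flat R (Z' j)] in
-- In degree `i = 0` every chain is a cycle. Otherwise the Leibniz rule in bidegree `(i - 1, j +
-- 1)`, after applying `1 ⊗ ∂'`, identifies `hw` with the vanishing of the first boundary of the
-- right-hand side, and flatness of the boundaries gives the lift. The hypothesis is weaker than `∂w
-- = 0`, so that the lemma also serves for the injectivity of the cross product.
lemma exists_rTensor_lTensor {n i j : ℕ} (h : i + j = n) (w : T (n + 1))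
    (hw : ∀ i', i' + (j + 1) = n → i' + 1 = i →
      (b' j).rangeRestrict.lTensor (C i') (c n i' (j + 1) (ιT n (bT n w))) = 0) :
    ∃ y, (ι i).rTensor (LinearMap.range (b' j)) y =
      (b' j).rangeRestrict.lTensor (C i) (c (n + 1) i (j + 1) w) := by
  cases i with
  | zero => exact LinearMap.rTensor_surjective _ E.surj_zero _
  | succ m =>
    have := hw m (by omega) rfl
    rw [lTensor_rangeRestrict_leibniz E' D (by omega)] at this
    exact E.exists_rTensor this

include E E' ET D in
omit [∀ j, Module.Flat R (Z' j)] in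
lemma exists_connecting {n i j : ℕ} (h : i + j + 1 = n) (z : ZT n) :
    ∃ y, (ι i).rTensor (LinearMap.range (b' j)) y =
      (b' j).rangeRestrict.lTensor (C i) (c n i (j + 1) (ιT n z)) := by
  -- The cycle is regarded as a chain of degree `(i + j) + 1` whose boundary is zero.
  subst h
  exact exists_rTensor_lTensor E E' D rfl (ιT _ z) fun _ _ _ => by simp [ET.b_ι]

/-- The map `ZT n → Z i ⊗ B' j` which applies the boundary of the second factor. -/
noncomputable def connectingCycles {n i j : ℕ} (h : i + j + 1 = n) :
    ZT n →ₗ[R] Z i ⊗[R] LinearMap.range (b' j) :=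
  LinearMap.codRestrictOfInjective
    ((b' j).rangeRestrict.lTensor (C i) ∘ₗ c n i (j + 1) ∘ₗ ιT n)
    ((ι i).rTensor (LinearMap.range (b' j))) (E.rTensor_inj _ i)
    (fun z => exists_connecting E E' ET D h z)

omit [∀ j, Module.Flat R (Z' j)] in
lemma rTensor_connectingCycles {n i j : ℕ} (h : i + j + 1 = n) (z : ZT n) :
    (ι i).rTensor _ (connectingCycles E E' ET D h z) =
      (b' j).rangeRestrict.lTensor (C i) (c n i (j + 1) (ιT n z)) :=
  LinearMap.codRestrictOfInjective_comp_apply _ _ _ _ _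

/-- For a cycle the two Leibniz terms in bidegree `(i, j)` cancel, so the image of the connecting
element in `Z_i ⊗ Z'_j` is, up to sign, `(∂ ⊗ ρ)` of the component in bidegree `(i + 1, j)`; such
elements vanish in `H_i ⊗ Z'_j`. This is what places the connecting element in `Tor₁`. -/
lemma lTensor_connectingCycles (hρ : ∀ j, ∃ ρ : C' j →ₗ[R] Z' j, ρ ∘ₗ ι' j = LinearMap.id)
    {n i j : ℕ} (h : i + j + 1 = n) (z : ZT n) :
    (LinearMap.range (b' j)).subtype.lTensor (H i)
      ((π i).rTensor _ (connectingCycles E E' ET D h z)) = 0 := by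
  subst h
  obtain ⟨ρ, hρ⟩ := hρ j
  rw [← rTensor_lTensor_comm]
  set v := (LinearMap.range (b' j)).subtype.lTensor (Z i) (connectingCycles E E' ET D rfl z)
    with hv
  have h1 := D.leibniz (i := i) (j := j) rfl (ιT _ z)
  rw [ET.b_ι, map_zero, map_zero] at h1
  -- The retraction moves the identity from `C_i ⊗ C'_j` to `C_i ⊗ Z'_j`, where the flatness of
  -- `Z'_j` allows `ι ⊗ 1` to be cancelled.
  have h2 := congrArg (ρ.lTensor (C i)) h1
  rw [map_zero, map_add, map_smul, ← LinearMap.lTensor_comp_apply, ← LinearMap.comp_assoc, hρ,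
    LinearMap.id_comp, ← rTensor_lTensor_comm] at h2
  have h3 : (b' j).lTensor (C i) (c _ i (j + 1) (ιT _ z)) = (ι i).rTensor _ v := by
    rw [hv, rTensor_lTensor_comm, rTensor_connectingCycles, ← LinearMap.lTensor_comp_apply,
      LinearMap.subtype_comp_codRestrict]
  rw [h3, LinearMap.rTensor_comp_apply, ← map_smul, ← map_add] at h2
  have h4 := E.rTensor_inj _ i (h2.symm.trans (map_zero _).symm)
  have h5 := congrArg ((π i).rTensor (Z' j)) h4
  rw [map_add, map_smul, (E.rTensor_exact_cycles _ i).apply_apply_eq_zero, zero_add,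
    map_zero] at h5
  -- Multiplying by the sign once more removes it.
  have h6 := congrArg (fun x => (-1 : R) ^ i • x) h5
  simpa [smul_smul, ← mul_pow] using h6

omit [∀ j, Module.Flat R (Z' j)] in
-- By the Leibniz rule the connecting element of `∂w` is `(∂ ⊗ ∂')` of the component of `w` in
-- bidegree `(i + 1, j + 1)`, hence a boundary in the first factor. The other Leibniz term contains
-- `∂'∂' = 0`.
lemma rTensor_connectingCycles_boundary {n i j : ℕ} (h : i + j + 1 = n) (w : T (n + 1)) :
    (π i).rTensor _ (connectingCycles E E' ET D h (bT n w)) = 0 := by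
  have h1 := rTensor_connectingCycles E E' ET D h (bT n w)
  rw [lTensor_rangeRestrict_leibniz E' D (by omega), LinearMap.rTensor_comp_apply] at h1
  rw [E.rTensor_inj _ i h1, (E.rTensor_exact_cycles _ i).apply_apply_eq_zero]

variable {Tr : ℕ → ℕ → Type u} [∀ i j, AddCommGroup (Tr i j)] [∀ i j, Module R (Tr i j)]
  (τ : ∀ i j, Tr i j →ₗ[R] H i ⊗[R] LinearMap.range (b' j))
  (hρ : ∀ j, ∃ ρ : C' j →ₗ[R] Z' j, ρ ∘ₗ ι' j = LinearMap.id)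
  (hτ : ∀ i j, Function.Injective (τ i j))
  (hτ' : ∀ i j, Function.Exact (τ i j) ((LinearMap.range (b' j)).subtype.lTensor (H i)))

/-- The connecting map in one bidegree. -/
noncomputable def connectingComponent {n i j : ℕ} (h : i + j + 1 = n) : HT n →ₗ[R] Tr i j :=
  (LinearMap.ker (πT n)).liftQ
    (LinearMap.codRestrictOfInjective ((π i).rTensor _ ∘ₗ connectingCycles E E' ET D h) (τ i j)
      (hτ i j) fun z => LinearMap.mem_range.2 <| (hτ' i j _).1 (lTensor_connectingCycles E E' ET D hρ h z))
    (fun z hz => by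
      obtain ⟨w, rfl⟩ := (ET.exact_cycles n z).1 hz
      refine hτ i j ?_
      rw [LinearMap.codRestrictOfInjective_comp_apply, LinearMap.comp_apply,
        rTensor_connectingCycles_boundary, map_zero]) ∘ₗ
    ((πT n).quotKerEquivOfSurjective (ET.surj n)).symm.toLinearMap

/-- Together with the injectivity of `τ`, this formula characterises the component; exactness and
naturality use nothing else about its definition. -/
lemma τ_connectingComponent {n i j : ℕ} (h : i + j + 1 = n) (z : ZT n) :
    τ i j (connectingComponent E E' ET D τ hρ hτ hτ' h (πT n z)) =
      (π i).rTensor _ (connectingCycles E E' ET D h z) := by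
  have : ((πT n).quotKerEquivOfSurjective (ET.surj n)).symm (πT n z) =
      Submodule.Quotient.mk z := by
    rw [LinearEquiv.symm_apply_eq]
    rfl
  rw [connectingComponent, LinearMap.comp_apply, LinearEquiv.coe_coe, this,
    Submodule.liftQ_apply, LinearMap.codRestrictOfInjective_comp_apply]
  rfl

instance finite_antidiagonal (n : ℕ) : Finite {p : ℕ × ℕ // p.1 + p.2 = n} :=
  Set.Finite.subset (t := {p : ℕ × ℕ | p.1 + p.2 = n})
    (Finset.HasAntidiagonal.antidiagonal n).finite_toSet
    fun p hp => by simpa using hp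

instance finite_antidiagonal_succ (n : ℕ) : Finite {p : ℕ × ℕ // p.1 + p.2 + 1 = n} :=
  Finite.of_injective (β := {p : ℕ × ℕ // p.1 + p.2 = n - 1})
    (fun p => ⟨p.1, by have := p.2; omega⟩) fun p q h => Subtype.ext (Subtype.mk.inj h)

lemma exists_directSum_eq {J : Type*} [Finite J] {M : J → Type*} [∀ j, AddCommGroup (M j)]
    (s : ∀ j, M j) : ∃ d : DirectSum J M, ∀ j, d j = s j := by
  classical
  have := Fintype.ofFinite J
  exact ⟨DFinsupp.equivFunOnFintype.symm s,
    congrFun (DFinsupp.equivFunOnFintype.apply_symm_apply s)⟩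

open Classical in
/-- The connecting map `H_n(T) → ⨁_{i + j + 1 = n} Tor₁(H_i, H'_j)`. -/
noncomputable def connecting (n : ℕ) :
    HT n →ₗ[R] DirectSum {p : ℕ × ℕ // p.1 + p.2 + 1 = n} fun p => Tr p.1.1 p.1.2 :=
  haveI := Fintype.ofFinite {p : ℕ × ℕ // p.1 + p.2 + 1 = n}
  (DirectSum.linearEquivFunOnFintype R _ _).symm.toLinearMap ∘ₗ
    LinearMap.pi fun p => connectingComponent E E' ET D τ hρ hτ hτ' p.2

lemma connecting_apply {n : ℕ} (x : HT n) (p : {p : ℕ × ℕ // p.1 + p.2 + 1 = n}) :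
    connecting E E' ET D τ hρ hτ hτ' n x p =
      connectingComponent E E' ET D τ hρ hτ hτ' p.2 x := by
  classical
  have := Fintype.ofFinite {p : ℕ × ℕ // p.1 + p.2 + 1 = n}
  rw [connecting, LinearMap.comp_apply, LinearEquiv.coe_coe]
  exact congrFun (LinearEquiv.apply_symm_apply (DirectSum.linearEquivFunOnFintype R
    {p : ℕ × ℕ // p.1 + p.2 + 1 = n} fun p => Tr p.1.1 p.1.2)
    ((LinearMap.pi fun p => connectingComponent E E' ET D τ hρ hτ hτ' p.2) x)) p


/-- `X` is the homology cross product. -/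
def IsCross (ι : ∀ i, Z i →ₗ[R] C i) (π : ∀ i, Z i →ₗ[R] H i) (ι' : ∀ i, Z' i →ₗ[R] C' i)
    (π' : ∀ i, Z' i →ₗ[R] H' i) (ιT : ∀ i, ZT i →ₗ[R] T i) (πT : ∀ i, ZT i →ₗ[R] HT i)
    (c : ∀ n i j, T n →ₗ[R] C i ⊗[R] C' j) (n : ℕ)
    (X : (DirectSum {p : ℕ × ℕ // p.1 + p.2 = n} fun p => H p.1.1 ⊗[R] H' p.1.2) →ₗ[R] HT n) :
    Prop :=
  ∀ (p : {p : ℕ × ℕ // p.1 + p.2 = n}) (x : Z p.1.1) (y : Z' p.1.2), ∃ z : ZT n,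
    X (DirectSum.lof R _ (fun p : {p : ℕ × ℕ // p.1 + p.2 = n} => H p.1.1 ⊗[R] H' p.1.2) p
      (π _ x ⊗ₜ π' _ y)) = πT n z ∧
    c n p.1.1 p.1.2 (ιT n z) = ι _ x ⊗ₜ ι' _ y ∧
    ∀ i j, i + j = n → i ≠ p.1.1 → c n i j (ιT n z) = 0

-- Exactness of the Künneth sequence.

section Exactness

variable {n : ℕ}
  {X : (DirectSum {p : ℕ × ℕ // p.1 + p.2 = n} fun p => H p.1.1 ⊗[R] H' p.1.2) →ₗ[R] HT n}
  (hX : IsCross ι π ι' π' ιT πT c n X)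

include hX in
omit [∀ j, Module.Flat R (Z' j)] in
-- The cross product is described through explicit cycles: a family of tensors of cycles is itself
-- the family of components of a cycle representing the cross product of its classes. The claim is
-- additive, so it reduces to pure tensors in one bidegree.
lemma IsCross.exists_cycle
    (s : DirectSum {p : ℕ × ℕ // p.1 + p.2 = n} fun p => Z p.1.1 ⊗[R] Z' p.1.2) :
    ∃ z : ZT n, X (DirectSum.lmap (fun p => TensorProduct.map (π p.1.1) (π' p.1.2)) s) = πT n z ∧
      ∀ p : {p : ℕ × ℕ // p.1 + p.2 = n},
        c n p.1.1 p.1.2 (ιT n z) = TensorProduct.map (ι p.1.1) (ι' p.1.2) (s p) := by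
  refine DirectSum.induction_lon (R := R)
    (motive := fun s => ∃ z : ZT n,
      X (DirectSum.lmap (fun p => TensorProduct.map (π p.1.1) (π' p.1.2)) s) = πT n z ∧
      ∀ p : {p : ℕ × ℕ // p.1 + p.2 = n},
        c n p.1.1 p.1.2 (ιT n z) = TensorProduct.map (ι p.1.1) (ι' p.1.2) (s p)) s ?_ (fun p t => ?_) ?_
  · exact ⟨0, by simp⟩
  · induction t with
    | zero => exact ⟨0, by simp⟩
    | tmul x y =>
      obtain ⟨z, h1, h2, h3⟩ := hX p x y
      refine ⟨z, ?_, fun q => ?_⟩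
      · rw [← h1, DirectSum.lmap_lof, TensorProduct.map_tmul]
      · by_cases hq : q = p
        · subst hq
          rw [DirectSum.lof_apply, h2, TensorProduct.map_tmul]
        · rw [h3 _ _ q.2, DirectSum.lof_eq_of, DirectSum.of_eq_of_ne _ _ _ hq, map_zero]
          intro h
          have h4 := p.2
          have h5 := q.2
          exact hq (Subtype.ext (Prod.ext h (by omega)))
    | add a b ha hb =>
      obtain ⟨z, h1, h2⟩ := ha
      obtain ⟨z', h1', h2'⟩ := hb
      refine ⟨z + z', ?_, fun q => ?_⟩
      · simp only [map_add, h1, h1']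
      · simp only [map_add, h2, h2', DirectSum.add_apply]
  · rintro a b ⟨z, h1, h2⟩ ⟨z', h1', h2'⟩
    exact ⟨z + z', by simp only [map_add, h1, h1'],
      fun q => by simp only [map_add, h2, h2', DirectSum.add_apply]⟩

include E E' ET D hX hρ in
-- Suppose the cycle with components `s` bounds `w`. In each bidegree the Leibniz rule and a
-- retraction write `s` in `Z_i ⊗ Z'_j` as an element coming from `B_i ⊗ Z'_j` plus one coming from
-- `Z_i ⊗ B'_j`; both vanish in `H_i ⊗ H'_j`.
theorem IsCross.injective : Function.Injective X := by
  rw [injective_iff_map_eq_zero]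
  intro t ht
  obtain ⟨s, rfl⟩ := (DirectSum.lmap_surjective
    (fun p : {p : ℕ × ℕ // p.1 + p.2 = n} => TensorProduct.map (π p.1.1) (π' p.1.2))).2
      (fun p => TensorProduct.map_surjective (E.surj _) (E'.surj _)) t
  obtain ⟨z, h1, h2⟩ := hX.exists_cycle s
  rw [ht] at h1
  obtain ⟨w, rfl⟩ := (ET.exact_cycles n z).1 h1.symm
  refine DFinsupp.ext fun p => ?_
  obtain ⟨⟨i, j⟩, hp : i + j = n⟩ := p
  rw [DirectSum.lmap_apply]
  change TensorProduct.map (π i) (π' j) (s ⟨(i, j), hp⟩) = 0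
  have h2p := h2 ⟨(i, j), hp⟩
  set t := s ⟨(i, j), hp⟩
  -- The components of `∂w` come from `Z ⊗ Z'` and are therefore killed by `1 ⊗ ∂'`, although `∂w`
  -- need not be zero.
  obtain ⟨y, hy⟩ := exists_rTensor_lTensor E E' D hp w fun i' hi' _ => by
    rw [h2 ⟨(i', j + 1), hi'⟩, ← LinearMap.comp_apply, LinearMap.lTensor_comp_map,
      E'.rangeRestrict_comp_ι, TensorProduct.map_zero_right, LinearMap.zero_apply]
  obtain ⟨ρ, hρ⟩ := hρ j
  rw [D.leibniz hp] at h2p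
  have h3 := congrArg (ρ.lTensor (C i)) h2p
  rw [map_add, map_smul, ← LinearMap.lTensor_comp_apply, ← LinearMap.comp_assoc, hρ,
    LinearMap.id_comp, ← rTensor_lTensor_comm, LinearMap.rTensor_comp_apply,
    ← LinearMap.comp_apply _ (TensorProduct.map _ _), LinearMap.lTensor_comp_map, hρ,
    ← LinearMap.subtype_comp_codRestrict (b' j) _ (fun x => LinearMap.mem_range_self _ x),
    LinearMap.lTensor_comp_apply] at h3
  change _ + (-1 : R) ^ i • (LinearMap.range (b' j)).subtype.lTensor (C i)
    ((b' j).rangeRestrict.lTensor (C i) (c (n + 1) i (j + 1) w)) = (ι i).rTensor (Z' j) t at h3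
  rw [← hy, ← rTensor_lTensor_comm, ← map_smul, ← map_add] at h3
  -- Cancelling `ι ⊗ 1` expresses the tensor by the two boundary terms, which `π ⊗ π'` sends to
  -- zero.
  rw [← E.rTensor_inj _ i h3, map_add, map_smul, ← LinearMap.comp_apply,
    ← LinearMap.comp_apply (TensorProduct.map _ _), LinearMap.map_comp_rTensor,
    LinearMap.map_comp_lTensor, (E.exact_cycles i).linearMap_comp_eq_zero]
  have : π' j ∘ₗ (LinearMap.range (b' j)).subtype = 0 := by
    ext ⟨_, x, rfl⟩
    exact E'.π_b j x
  rw [this, TensorProduct.map_zero_left, TensorProduct.map_zero_right]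
  simp

include hX in
omit [∀ j, Module.Flat R (Z' j)] in
lemma IsCross.exists_eq
    (t : DirectSum {p : ℕ × ℕ // p.1 + p.2 = n} fun p => H p.1.1 ⊗[R] H' p.1.2)
    (hπ : ∀ i, Function.Surjective (π i)) (hπ' : ∀ i, Function.Surjective (π' i)) :
    ∃ (s : DirectSum {p : ℕ × ℕ // p.1 + p.2 = n} fun p => Z p.1.1 ⊗[R] Z' p.1.2) (z : ZT n),
      X t = πT n z ∧ ∀ p : {p : ℕ × ℕ // p.1 + p.2 = n},
        c n p.1.1 p.1.2 (ιT n z) = TensorProduct.map (ι p.1.1) (ι' p.1.2) (s p) := by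
  obtain ⟨s, rfl⟩ := (DirectSum.lmap_surjective
    (fun p : {p : ℕ × ℕ // p.1 + p.2 = n} => TensorProduct.map (π p.1.1) (π' p.1.2))).2
      (fun p => TensorProduct.map_surjective (hπ _) (hπ' _)) t
  exact ⟨s, hX.exists_cycle s⟩

include E' in
omit [∀ j, Module.Flat R (Z' j)] [∀ j, Module.Flat R (LinearMap.range (b' j))] in
lemma lTensor_rangeRestrict_map {i j : ℕ} (t : Z i ⊗[R] Z' (j + 1)) :
    (b' j).rangeRestrict.lTensor (C i) (TensorProduct.map (ι i) (ι' (j + 1)) t) = 0 := by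
  rw [← LinearMap.comp_apply, LinearMap.lTensor_comp_map,
    E'.rangeRestrict_comp_ι, TensorProduct.map_zero_right, LinearMap.zero_apply]

include hX in
-- A cross product is represented by a cycle with components in `Z ⊗ Z'`, and `1 ⊗ ∂'` kills these
-- before any class is taken.
lemma IsCross.connecting_comp_apply
    (t : DirectSum {p : ℕ × ℕ // p.1 + p.2 = n} fun p => H p.1.1 ⊗[R] H' p.1.2) :
    connecting E E' ET D τ hρ hτ hτ' n (X t) = 0 := by
  obtain ⟨s, z, h1, h2⟩ := hX.exists_eq t E.surj E'.surj
  rw [h1]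
  refine DFinsupp.ext fun ⟨⟨i, j⟩, hp⟩ => ?_
  change connecting E E' ET D τ hρ hτ hτ' n (πT n z) ⟨⟨i, j⟩, hp⟩ = 0
  rw [connecting_apply]
  refine hτ i j ?_
  rw [τ_connectingComponent, map_zero]
  have h3 : (ι i).rTensor _ (connectingCycles E E' ET D hp z) = 0 := by
    rw [rTensor_connectingCycles, h2 ⟨(i, j + 1), hp⟩, lTensor_rangeRestrict_map E']
  rw [E.rTensor_inj _ i (h3.trans (map_zero _).symm), map_zero]

include E E' ET D hX hρ in
omit [∀ j, Module.Flat R (LinearMap.range (b' j))] in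
/-- A cycle all of whose components are cycles in the second factor represents a cross product. -/
lemma IsCross.exists_eq_of_components (z : ZT n)
    (hz : ∀ i j, i + j = n → ∃ x, c n i j (ιT n z) = (ι' j).lTensor (C i) x) :
    ∃ t, X t = πT n z := by
  have h : ∀ p : {p : ℕ × ℕ // p.1 + p.2 = n}, ∃ s,
      c n p.1.1 p.1.2 (ιT n z) = TensorProduct.map (ι p.1.1) (ι' p.1.2) s := by
    rintro ⟨⟨i, j⟩, hp : i + j = n⟩
    change ∃ s, c n i j (ιT n z) = TensorProduct.map (ι i) (ι' j) s
    obtain ⟨x, hx⟩ := hz i j hp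
    suffices h : ∃ s, (ι i).rTensor (Z' j) s = x by
      obtain ⟨s, rfl⟩ := h
      exact ⟨s, by rw [hx, ← LinearMap.comp_apply, LinearMap.lTensor_comp_rTensor]⟩
    cases i with
    | zero => exact LinearMap.rTensor_surjective _ E.surj_zero x
    | succ i =>
      obtain rfl : n = i + j + 1 := by omega
      refine E.exists_rTensor ?_
      have h1 := D.leibniz (i := i) (j := j) rfl (ιT _ z)
      have h2 : ∃ ρ : C' j →ₗ[R] Z' j, ρ ∘ₗ ι' j = LinearMap.id := hρ j
      -- Since the component in bidegree `(i, j + 1)` also consists of cycles in the second factor,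
      -- only the first Leibniz term survives. Once the retraction has removed `1 ⊗ ι'`, it says
      -- that `x` is a cycle in the first factor too.
      obtain ⟨x', hx'⟩ := hz i (j + 1) rfl
      rw [ET.b_ι, map_zero, map_zero, hx, hx', ← LinearMap.lTensor_comp_apply,
        LinearMap.comp_assoc, (E'.exact_chains j).linearMap_comp_eq_zero, LinearMap.comp_zero,
        LinearMap.lTensor_zero, LinearMap.zero_apply, smul_zero, add_zero,
        rTensor_lTensor_comm] at h1
      obtain ⟨ρ, hρ⟩ := h2
      have h3 := congrArg (ρ.lTensor (C i)) h1
      rw [map_zero, ← LinearMap.lTensor_comp_apply, hρ, LinearMap.lTensor_id,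
        LinearMap.id_apply] at h3
      exact h3.symm
  choose s hs using h
  obtain ⟨d, hd⟩ := exists_directSum_eq s
  obtain ⟨z', h1, h2⟩ := hX.exists_cycle d
  refine ⟨_, h1.trans (congrArg _ (ET.inj n ?_))⟩
  refine (sub_eq_zero.1 (D.eq_zero fun i j hij => ?_)).symm
  rw [map_sub, hs ⟨(i, j), hij⟩, h2 ⟨(i, j), hij⟩, hd, sub_self]

include hX in
-- If the connecting class of `z` vanishes, then `(1 ⊗ ∂')` of each component of `z` equals `(∂ ⊗
-- ∂')` of some tensor. Subtracting the boundary of the chain formed by these tensors leaves a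
-- homologous cycle with components in `C ⊗ Z'`, and such a cycle represents a cross product.
theorem IsCross.exact_connecting :
    Function.Exact X (connecting E E' ET D τ hρ hτ hτ' n) := by
  intro x
  constructor
  swap
  · rintro ⟨t, rfl⟩
    exact hX.connecting_comp_apply E E' ET D τ hρ hτ hτ' t
  intro hx
  obtain ⟨z, rfl⟩ := ET.surj n x
  have h : ∀ i j (h : i + j + 1 = n), ∃ w : C (i + 1) ⊗[R] C' (j + 1),
      (b i).rTensor _ ((b' j).rangeRestrict.lTensor _ w) = connectingCycles E E' ET D h z := by
    intro i j hij
    have h1 := congrArg (fun y => τ i j (y ⟨(i, j), hij⟩)) hx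
    simp only [connecting_apply, τ_connectingComponent] at h1
    obtain ⟨v, hv⟩ := (E.rTensor_exact_cycles _ i _).1 (h1.trans (map_zero _))
    obtain ⟨w, rfl⟩ := LinearMap.lTensor_surjective _ (b' j).surjective_rangeRestrict v
    exact ⟨w, hv⟩
  choose! v hv using h
  -- The shift by one in both indices matches `∂ ⊗ ∂'`; the components with `i = 0` or `j = 0` play
  -- no role and are set to zero.
  obtain ⟨w, hw⟩ := D.exists_eq (n + 1) fun i j =>
    match i, j with
    | i + 1, j + 1 => v i j
    | _, _ => 0
  -- For `j = 0` every chain of the second factor is a cycle. For `j + 1` the difference is killed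
  -- by `1 ⊗ ∂'` by the choice of `w`.
  obtain ⟨t, ht⟩ := hX.exists_eq_of_components E E' ET D hρ (z - bT n w) fun i j hij => by
    cases j with
    | zero =>
      obtain ⟨x, hx⟩ := LinearMap.lTensor_surjective (C i) E'.surj_zero
        (c n i 0 (ιT n (z - bT n w)))
      exact ⟨x, hx.symm⟩
    | succ j =>
      obtain ⟨x, hx⟩ := (E'.lTensor_exact_range (C i) j
        (c n i (j + 1) (ιT n (z - bT n w)))).1 (by
          rw [map_sub, map_sub, map_sub, lTensor_rangeRestrict_leibniz E' D hij,
            ← rTensor_connectingCycles E E' ET D hij, ← hv i j hij, hw _ _ (by omega),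
            LinearMap.rTensor_comp_apply, sub_self])
      exact ⟨x, hx.symm⟩
  refine ⟨t, ht.trans ?_⟩
  rw [map_sub, ET.π_b, sub_zero]

/-- An element of `Tor₁` lifts to `y` in `Z_i ⊗ C'_{j+1}`. Its vanishing in `H_i ⊗ Z'_j` means `(1 ⊗
∂') y = (∂ ⊗ 1) x` for some `x` in `C_{i+1} ⊗ Z'_j`, and `y` corrected by `x` with a sign is a cycle
of the total complex. -/
theorem connecting_surjective :
    Function.Surjective (connecting E E' ET D τ hρ hτ hτ' n) := by
  intro t
  -- The degree condition is an assumption inside the statement, so that `y` and `x` can be chosen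
  -- for all indices.
  have h : ∀ i j, ∃ (y : Z i ⊗[R] C' (j + 1)) (x : C (i + 1) ⊗[R] Z' j),
      ∀ h : i + j + 1 = n,
        (π i).rTensor _ ((b' j).rangeRestrict.lTensor _ y) = τ i j (t ⟨(i, j), h⟩) ∧
        (b' j).lTensor _ y = (b i).rTensor _ x := by
    intro i j
    by_cases h : i + j + 1 = n
    swap
    · exact ⟨0, 0, fun h' => (h h').elim⟩
    obtain ⟨u, hu⟩ := LinearMap.rTensor_surjective (LinearMap.range (b' j)) (E.surj i)
      (τ i j (t ⟨(i, j), h⟩))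
    obtain ⟨y, rfl⟩ := LinearMap.lTensor_surjective (Z i) (b' j).surjective_rangeRestrict u
    have h1 := (hτ' i j).apply_apply_eq_zero (t ⟨(i, j), h⟩)
    rw [← hu, ← rTensor_lTensor_comm, ← LinearMap.lTensor_comp_apply,
      LinearMap.subtype_comp_codRestrict] at h1
    obtain ⟨x, hx⟩ := (E.rTensor_exact_cycles _ i _).1 h1
    exact ⟨y, x, fun _ => ⟨hu, hx.symm⟩⟩
  choose y x hyx using h
  -- The tensor `y i j` is placed in bidegree `(i, j + 1)` and `(-1)^i x i j` in bidegree `(i + 1,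
  -- j)`. In bidegree `(i, j)` of the boundary of `a - e` the contributions are `(-1)^i (1 ⊗ ∂') y`
  -- and `-(-1)^i (∂ ⊗ 1) x`, which cancel.
  let a : ∀ i j, C i ⊗[R] C' j := fun i j =>
    match j with
    | 0 => 0
    | j + 1 => (ι i).rTensor _ (y i j)
  let e : ∀ i j, C i ⊗[R] C' j := fun i j =>
    match i with
    | 0 => 0
    | i + 1 => (-1 : R) ^ i • (ι' j).lTensor _ (x i j)
  obtain ⟨w, hw⟩ := D.exists_eq n fun i j => a i j - e i j
  have hb : ∃ z, ιT n z = w := by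
    cases n with
    | zero => exact ET.surj_zero w
    | succ n =>
      refine (ET.exact_chains n w).1 (ET.inj n ((D.eq_zero fun i j hij => ?_).trans
        (map_zero _).symm))
      rw [D.leibniz hij, hw _ _ (by omega), hw _ _ (by omega)]
      have h1 : (ι i ∘ₗ b i).rTensor (C' j) (a (i + 1) j) = 0 := by
        cases j with
        | zero => exact map_zero _
        | succ j =>
          change (ι i ∘ₗ b i).rTensor (C' (j + 1)) ((ι (i + 1)).rTensor _ (y (i + 1) j)) = 0
          rw [LinearMap.rTensor_comp_apply, E.rTensor_b_ι, map_zero]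
      have h2 : (ι' j ∘ₗ b' j).lTensor (C i) (e i (j + 1)) = 0 := by
        cases i with
        | zero => exact map_zero _
        | succ i =>
          change (ι' j ∘ₗ b' j).lTensor (C (i + 1))
            ((-1 : R) ^ i • (ι' (j + 1)).lTensor _ (x i (j + 1))) = 0
          rw [map_smul, ← LinearMap.lTensor_comp_apply, LinearMap.comp_assoc,
            (E'.exact_chains j).linearMap_comp_eq_zero, LinearMap.comp_zero,
            LinearMap.lTensor_zero, LinearMap.zero_apply, smul_zero]
      have h3 : (ι' j ∘ₗ b' j).lTensor (C i) (a i (j + 1)) =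
          TensorProduct.map (ι i) (ι' j) ((b i).rTensor _ (x i j)) := by
        change (ι' j ∘ₗ b' j).lTensor (C i) ((ι i).rTensor _ (y i j)) = _
        rw [← rTensor_lTensor_comm, LinearMap.lTensor_comp_apply, (hyx i j (by omega)).2,
          ← LinearMap.comp_apply, LinearMap.rTensor_comp_lTensor]
      have h4 : (ι i ∘ₗ b i).rTensor (C' j) (e (i + 1) j) =
          (-1 : R) ^ i • TensorProduct.map (ι i) (ι' j) ((b i).rTensor _ (x i j)) := by
        change (ι i ∘ₗ b i).rTensor (C' j) ((-1 : R) ^ i • (ι' j).lTensor _ (x i j)) = _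
        rw [map_smul, rTensor_lTensor_comm, LinearMap.rTensor_comp_apply,
          ← LinearMap.comp_apply _ ((ι i).rTensor _), LinearMap.lTensor_comp_rTensor]
      rw [map_sub, map_sub, h1, h2, h3, h4]
      simp
  obtain ⟨z, rfl⟩ := hb
  refine ⟨πT n z, DFinsupp.ext fun ⟨⟨i, j⟩, hp⟩ => hτ i j ?_⟩
  change τ i j (connecting E E' ET D τ hρ hτ hτ' n (πT n z) ⟨⟨i, j⟩, hp⟩) = _
  rw [connecting_apply, τ_connectingComponent, ← (hyx i j hp).1]
  congr 1
  refine E.rTensor_inj _ i ?_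
  rw [rTensor_connectingCycles, hw i (j + 1) hp, map_sub]
  -- The correction terms are cycles in the second factor, so the connecting map sees only `y`.
  have h2 : (b' j).rangeRestrict.lTensor (C i) (e i (j + 1)) = 0 := by
    cases i with
    | zero => exact map_zero _
    | succ i =>
      change (b' j).rangeRestrict.lTensor (C (i + 1))
        ((-1 : R) ^ i • (ι' (j + 1)).lTensor _ (x i (j + 1))) = 0
      rw [map_smul, E'.lTensor_rangeRestrict_ι, smul_zero]
  rw [h2, sub_zero, rTensor_lTensor_comm]

end Exactness

-- Naturality of the connecting map.

section Naturality

variable {C₂ Z₂ H₂ C₂' Z₂' H₂' T₂ ZT₂ HT₂ : ℕ → Type u}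
  [∀ i, AddCommGroup (C₂ i)] [∀ i, AddCommGroup (Z₂ i)] [∀ i, AddCommGroup (H₂ i)]
  [∀ i, Module R (C₂ i)] [∀ i, Module R (Z₂ i)] [∀ i, Module R (H₂ i)]
  [∀ i, AddCommGroup (C₂' i)] [∀ i, AddCommGroup (Z₂' i)] [∀ i, AddCommGroup (H₂' i)]
  [∀ i, Module R (C₂' i)] [∀ i, Module R (Z₂' i)] [∀ i, Module R (H₂' i)]
  [∀ i, AddCommGroup (T₂ i)] [∀ i, AddCommGroup (ZT₂ i)] [∀ i, AddCommGroup (HT₂ i)]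
  [∀ i, Module R (T₂ i)] [∀ i, Module R (ZT₂ i)] [∀ i, Module R (HT₂ i)]
  {ι₂ : ∀ i, Z₂ i →ₗ[R] C₂ i} {b₂ : ∀ i, C₂ (i + 1) →ₗ[R] Z₂ i} {π₂ : ∀ i, Z₂ i →ₗ[R] H₂ i}
  {ι₂' : ∀ i, Z₂' i →ₗ[R] C₂' i} {b₂' : ∀ i, C₂' (i + 1) →ₗ[R] Z₂' i}
  {π₂' : ∀ i, Z₂' i →ₗ[R] H₂' i}
  {ιT₂ : ∀ i, ZT₂ i →ₗ[R] T₂ i} {bT₂ : ∀ i, T₂ (i + 1) →ₗ[R] ZT₂ i}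
  {πT₂ : ∀ i, ZT₂ i →ₗ[R] HT₂ i} {c₂ : ∀ n i j, T₂ n →ₗ[R] C₂ i ⊗[R] C₂' j}
  (E₂ : IsCycleData ι₂ b₂ π₂) (E₂' : IsCycleData ι₂' b₂' π₂') (ET₂ : IsCycleData ιT₂ bT₂ πT₂)
  (D₂ : IsTotal ι₂ b₂ ι₂' b₂' ιT₂ bT₂ c₂)
  [∀ j, Module.Flat R (Z₂' j)] [∀ j, Module.Flat R (LinearMap.range (b₂' j))]
  {Tr₂ : ℕ → ℕ → Type u} [∀ i j, AddCommGroup (Tr₂ i j)] [∀ i j, Module R (Tr₂ i j)]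
  (τ₂ : ∀ i j, Tr₂ i j →ₗ[R] H₂ i ⊗[R] LinearMap.range (b₂' j))
  (hρ₂ : ∀ j, ∃ ρ : C₂' j →ₗ[R] Z₂' j, ρ ∘ₗ ι₂' j = LinearMap.id)
  (hτ₂ : ∀ i j, Function.Injective (τ₂ i j))
  (hτ₂' : ∀ i j, Function.Exact (τ₂ i j) ((LinearMap.range (b₂' j)).subtype.lTensor (H₂ i)))
  {fC : ∀ i, C i →ₗ[R] C₂ i} {fZ : ∀ i, Z i →ₗ[R] Z₂ i} {fH : ∀ i, H i →ₗ[R] H₂ i}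
  {gC : ∀ i, C' i →ₗ[R] C₂' i} {gB : ∀ i, LinearMap.range (b' i) →ₗ[R] LinearMap.range (b₂' i)}
  {hT : ∀ i, T i →ₗ[R] T₂ i} {hZT : ∀ i, ZT i →ₗ[R] ZT₂ i} {hHT : ∀ i, HT i →ₗ[R] HT₂ i}
  {fTr : ∀ i j, Tr i j →ₗ[R] Tr₂ i j}

/-- Each construction step commutes with the given maps, and each lift is unique because `ι ⊗ 1` and
`τ` are injective. No compatibility of the maps with the retractions is needed. -/
theorem connecting_natural (hι : ∀ i, ι₂ i ∘ₗ fZ i = fC i ∘ₗ ι i)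
    (hπ : ∀ i, π₂ i ∘ₗ fZ i = fH i ∘ₗ π i)
    (hgB : ∀ i, (b₂' i).rangeRestrict ∘ₗ gC (i + 1) = gB i ∘ₗ (b' i).rangeRestrict)
    (hιT : ∀ i, ιT₂ i ∘ₗ hZT i = hT i ∘ₗ ιT i) (hπT : ∀ i, πT₂ i ∘ₗ hZT i = hHT i ∘ₗ πT i)
    (hc : ∀ n i j, c₂ n i j ∘ₗ hT n = TensorProduct.map (fC i) (gC j) ∘ₗ c n i j)
    (hfTr : ∀ i j, τ₂ i j ∘ₗ fTr i j = TensorProduct.map (fH i) (gB j) ∘ₗ τ i j) (n : ℕ) :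
    connecting E₂ E₂' ET₂ D₂ τ₂ hρ₂ hτ₂ hτ₂' n ∘ₗ hHT n =
      DirectSum.lmap (fun p : {p : ℕ × ℕ // p.1 + p.2 + 1 = n} => fTr p.1.1 p.1.2) ∘ₗ
        connecting E E' ET D τ hρ hτ hτ' n := by
  refine LinearMap.ext fun x => ?_
  obtain ⟨z, rfl⟩ := ET.surj n x
  refine DFinsupp.ext fun ⟨⟨i, j⟩, hp⟩ => hτ₂ i j ?_
  -- Naturality already holds in `Z_i ⊗ B'_j`; it is checked after the injection into `C_i ⊗ B'_j`.
  have key : connectingCycles E₂ E₂' ET₂ D₂ hp (hZT n z) =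
      TensorProduct.map (fZ i) (gB j) (connectingCycles E E' ET D hp z) := by
    refine E₂.rTensor_inj _ i ?_
    rw [rTensor_connectingCycles, ← LinearMap.comp_apply (ιT₂ n), hιT, LinearMap.comp_apply,
      ← LinearMap.comp_apply (c₂ n i (j + 1)), hc, LinearMap.comp_apply, ← LinearMap.comp_apply,
      LinearMap.lTensor_comp_map, hgB, ← LinearMap.comp_apply (LinearMap.rTensor _ _),
      LinearMap.rTensor_comp_map, hι, ← LinearMap.map_comp_lTensor, ← LinearMap.map_comp_rTensor,
      LinearMap.comp_apply, LinearMap.comp_apply, rTensor_connectingCycles]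
  have h1 : hHT n (πT n z) = πT₂ n (hZT n z) := (LinearMap.congr_fun (hπT n) z).symm
  change τ₂ i j (connecting E₂ E₂' ET₂ D₂ τ₂ hρ₂ hτ₂ hτ₂' n (hHT n (πT n z)) ⟨⟨i, j⟩, hp⟩) =
    τ₂ i j (DirectSum.lmap (fun p : {p : ℕ × ℕ // p.1 + p.2 + 1 = n} => fTr p.1.1 p.1.2)
      (connecting E E' ET D τ hρ hτ hτ' n (πT n z)) ⟨⟨i, j⟩, hp⟩)
  rw [DirectSum.lmap_apply, connecting_apply, connecting_apply, h1, τ_connectingComponent, key,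
    ← LinearMap.comp_apply (τ₂ i j), hfTr, LinearMap.comp_apply, τ_connectingComponent,
    ← LinearMap.comp_apply, LinearMap.rTensor_comp_map, hπ, ← LinearMap.map_comp_rTensor,
    LinearMap.comp_apply]

end Naturality

end Connecting

end AlgebraicKunneth

-- Submodules of free modules over a principal ideal domain.

section FreeSubmodule

variable {R : Type*} [CommRing R] [IsDomain R] [IsPrincipalIdealRing R]

/-- A submodule of a free module over a principal ideal domain is free. -/
theorem free_submodule_finsupp {J : Type*} (N : Submodule R (J →₀ R)) : Module.Free R N := by
  classical
  let _ : LinearOrder J := IsWellOrder.linearOrder WellOrderingRel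
  have hwf : WellFounded ((· < ·) : J → J → Prop) := WellOrderingRel.isWellOrder.wf
  -- After well-ordering the index set, `I i` is the ideal of leading coefficients at `i`. The
  -- vectors `v i` realise generators `a i` of these ideals, and those with `a i ≠ 0` form a basis.
  let I : J → Ideal R := fun i =>
    (N ⊓ Finsupp.supported R R (Set.Iic i)).map (Finsupp.lapply i : (J →₀ R) →ₗ[R] R)
  let a : J → R := fun i => Submodule.IsPrincipal.generator (I i)
  have ha : ∀ i, ∃ x : J →₀ R, (x ∈ N ∧ x ∈ Finsupp.supported R R (Set.Iic i)) ∧ x i = a i :=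
    fun i => by
      obtain ⟨x, hx, h⟩ := Submodule.mem_map.1 (Submodule.IsPrincipal.generator_mem (I i))
      exact ⟨x, Submodule.mem_inf.1 hx, h⟩
  choose v hv hva using ha
  have hdiv : ∀ i, ∀ x ∈ N, x ∈ Finsupp.supported R R (Set.Iic i) → ∃ r : R, x i = r * a i := by
    intro i x hx hxi
    have : x i ∈ I i := Submodule.mem_map.2 ⟨x, Submodule.mem_inf.2 ⟨hx, hxi⟩, rfl⟩
    rw [← Submodule.IsPrincipal.span_singleton_generator (I i)] at this
    obtain ⟨r, hr⟩ := Submodule.mem_span_singleton.1 this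
    exact ⟨r, hr.symm⟩
  let w : {i // a i ≠ 0} → N := fun i => ⟨v i, (hv i).1⟩
  have hzero : ∀ i j, i < j → v i j = 0 := fun i j hij =>
    Finsupp.notMem_support_iff.1 fun h => not_lt_of_ge (show j ≤ i from (hv i).2 h) hij
  have hli : LinearIndependent R w := by
    refine LinearIndependent.of_comp N.subtype ?_
    rw [linearIndependent_iff]
    intro l hl
    by_contra hne
    have hs : l.support.Nonempty := Finsupp.support_nonempty_iff.2 hne
    have hmax := l.support.max'_mem hs
    set m := l.support.max' hs with hm
    -- At the largest index of a relation only one vector contributes, with coefficient `l m * a m`.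
    have h1 := DFunLike.congr_fun hl (m : J)
    rw [Finsupp.linearCombination_apply, Finsupp.sum, Finsupp.finsetSum_apply,
      Finset.sum_eq_single_of_mem m hmax] at h1
    · have h2 : l m * v m m = 0 := h1
      rw [hva] at h2
      exact (mul_ne_zero (Finsupp.mem_support_iff.1 hmax) m.2) h2
    · intro i hi him
      have h3 : i < m := lt_of_le_of_ne (l.support.le_max' i hi) him
      have h4 : v i m = 0 := hzero _ _ h3
      change l i * v i m = 0
      rw [h4, mul_zero]
  -- Well-founded induction on a bound for the support: a multiple of `v i` removes the coordinate
  -- at `i`, and the leading index of what remains is smaller. If `a i = 0` that coordinate is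
  -- already zero.
  have hspan : ∀ i, ∀ x : N, (x : J →₀ R) ∈ Finsupp.supported R R (Set.Iic i) →
      x ∈ Submodule.span R (Set.range w) := by
    intro i
    induction i using hwf.induction with
    | _ i ih =>
    intro x hx
    obtain ⟨r, hr⟩ := hdiv i x x.2 hx
    obtain ⟨y, hy, hyi, hxy⟩ : ∃ y : N, y ∈ Submodule.span R (Set.range w) ∧
        ((x - y : N) : J →₀ R) i = 0 ∧
        ((x - y : N) : J →₀ R) ∈ Finsupp.supported R R (Set.Iic i) := by
      by_cases h : a i = 0
      · exact ⟨0, Submodule.zero_mem _, by simp [hr, h], by simpa using hx⟩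
      · refine ⟨r • w ⟨i, h⟩, Submodule.smul_mem _ _ (Submodule.subset_span ⟨_, rfl⟩), ?_,
          Submodule.sub_mem _ hx (Submodule.smul_mem _ _ (hv i).2)⟩
        change (x : J →₀ R) i - r * v i i = 0
        rw [hr, hva, sub_self]
    rw [← sub_add_cancel x y]
    refine Submodule.add_mem _ ?_ hy
    set z := x - y
    by_cases hz : z = 0
    · rw [hz]; exact Submodule.zero_mem _
    have hs : (z : J →₀ R).support.Nonempty :=
      Finsupp.support_nonempty_iff.2 fun h => hz (Subtype.ext h)
    have hmem := (z : J →₀ R).support.max'_mem hs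
    refine ih _ (lt_of_le_of_ne (hxy hmem) fun h => ?_) z fun j hj =>
      (z : J →₀ R).support.le_max' j hj
    rw [h] at hmem
    exact Finsupp.mem_support_iff.1 hmem hyi
  refine Module.Free.of_basis (Module.Basis.mk hli fun x _ => ?_)
  by_cases hx : x = 0
  · rw [hx]; exact Submodule.zero_mem _
  have hs : (x : J →₀ R).support.Nonempty :=
    Finsupp.support_nonempty_iff.2 fun h => hx (Subtype.ext h)
  exact hspan ((x : J →₀ R).support.max' hs) x fun j hj => (x : J →₀ R).support.le_max' j hj

/-- A submodule of a free module over a principal ideal domain is free. -/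
theorem free_submodule {M : Type*} [AddCommGroup M] [Module R M] [Module.Free R M]
    (N : Submodule R M) : Module.Free R N := by
  let e := (Module.Free.chooseBasis R M).repr
  have := free_submodule_finsupp (N.map e.toLinearMap)
  exact Module.Free.of_equiv (e.submoduleMap N).symm

end FreeSubmodule

-- First left derived functors from resolutions of length one.

noncomputable section LengthOneResolution

open Limits ZeroObject

universe v w

variable {A : Type w} [Category.{v} A] [Abelian A]

/-- The terms of the complex `⋯ → 0 → X₁ → X₂`. -/
def twoTermX (S : ShortComplex A) : ℕ → A
  | 0 => S.X₂
  | 1 => S.X₁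
  | _ + 2 => 0

/-- The differentials of the complex `⋯ → 0 → X₁ → X₂`. -/
def twoTermD (S : ShortComplex A) : ∀ n, twoTermX S (n + 1) ⟶ twoTermX S n
  | 0 => S.f
  | _ + 1 => 0

/-- The complex `⋯ → 0 → X₁ → X₂`. -/
def twoTermComplex (S : ShortComplex A) : ChainComplex A ℕ :=
  ChainComplex.of (twoTermX S) (twoTermD S) fun _ => zero_comp

lemma twoTermComplex_d_one_zero (S : ShortComplex A) : (twoTermComplex S).d 1 0 = S.f :=
  ChainComplex.of_d (twoTermX S) (twoTermD S) 0

lemma twoTermComplex_d_two_one (S : ShortComplex A) : (twoTermComplex S).d 2 1 = 0 :=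
  ChainComplex.of_d (twoTermX S) (twoTermD S) 1

/-- The map of complexes induced by a morphism of short complexes. -/
def twoTermComplexMap {S S' : ShortComplex A} (φ : S ⟶ S') :
    twoTermComplex S ⟶ twoTermComplex S' :=
  ChainComplex.ofHom
    (fun n => match n with
      | 0 => φ.τ₂
      | 1 => φ.τ₁
      | _ + 2 => 0)
    (fun n => match n with
      | 0 => by
        refine (congrArg (φ.τ₁ ≫ ·) (twoTermComplex_d_one_zero S')).trans
          (φ.comm₁₂.trans (congrArg (· ≫ φ.τ₂) (twoTermComplex_d_one_zero S)).symm)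
      | 1 => by
        refine (congrArg ((0 : (0 : A) ⟶ 0) ≫ ·) (twoTermComplex_d_two_one S')).trans
          (comp_zero.trans (congrArg (· ≫ φ.τ₁) (twoTermComplex_d_two_one S) |>.trans
            zero_comp).symm)
      | n + 2 => (isZero_zero A).eq_of_src _ _)

/-- The augmentation of `⋯ → 0 → X₁ → X₂` with values in `X₃`. -/
def twoTermAugmentation (S : ShortComplex A) :
    twoTermComplex S ⟶ (ChainComplex.single₀ A).obj S.X₃ :=
  (ChainComplex.toSingle₀Equiv _ _).symm
    ⟨S.g, (congrArg (· ≫ S.g) (twoTermComplex_d_one_zero S)).trans S.zero⟩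

lemma twoTermAugmentation_f_zero (S : ShortComplex A) : (twoTermAugmentation S).f 0 = S.g :=
  ChainComplex.toSingle₀Equiv_symm_apply_f_zero _ _

/-- A short exact sequence with projective `X₁` and `X₂` is a projective resolution of `X₃`. -/
def ofShortExact {S : ShortComplex A} (hS : S.ShortExact) [Projective S.X₁] [Projective S.X₂] :
    ProjectiveResolution S.X₃ where
  complex := twoTermComplex S
  projective n := match n with
    | 0 => inferInstanceAs (Projective S.X₂)
    | 1 => inferInstanceAs (Projective S.X₁)
    | _ + 2 => inferInstanceAs (Projective (0 : A))
  π := twoTermAugmentation S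
  quasiIso := ⟨fun n => by
    match n with
    | 0 =>
      -- In degree zero the condition is exactness at `X₂` together with surjectivity onto `X₃`. In
      -- degree one it is injectivity of `X₁ → X₂`, and above that all terms vanish.
      rw [ChainComplex.quasiIsoAt₀_iff, ShortComplex.quasiIso_iff_of_zeros']
      · refine (ShortComplex.exact_and_epi_g_iff_of_iso ?_).2 ⟨hS.exact, hS.epi_g⟩
        exact ShortComplex.isoMk (Iso.refl _) (Iso.refl _) (Iso.refl _)
          ((Category.id_comp _).trans
            ((twoTermComplex_d_one_zero S).symm.trans (Category.comp_id _).symm))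
          ((Category.id_comp _).trans
            ((twoTermAugmentation_f_zero S).symm.trans (Category.comp_id _).symm))
      all_goals rfl
    | 1 =>
      rw [quasiIsoAt_iff_exactAt']
      · rw [HomologicalComplex.exactAt_iff' _ 2 1 0 (by simp) (by simp)]
        have := hS.mono_f
        refine (ShortComplex.exact_iff_mono _ (twoTermComplex_d_two_one S)).2 ?_
        change Mono ((twoTermComplex S).d 1 0)
        rw [twoTermComplex_d_one_zero]
        exact hS.mono_f
      · exact ChainComplex.exactAt_succ_single_obj _ _
    | n + 2 =>
      rw [quasiIsoAt_iff_exactAt']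
      · exact ShortComplex.exact_of_isZero_X₂ _ (isZero_zero A)
      · exact ChainComplex.exactAt_succ_single_obj _ _⟩

lemma ofShortExact_π_f_zero {S : ShortComplex A} (hS : S.ShortExact) [Projective S.X₁]
    [Projective S.X₂] : (ofShortExact hS).π.f 0 = S.g :=
  twoTermAugmentation_f_zero S

variable {B : Type*} [Category* B] [Abelian B]

/-- Homology at a spot with vanishing incoming differential, as a subobject of the chains. -/
def homologyInclusion (K : ChainComplex B ℕ) (h : K.d 2 1 = 0) : K.homology 1 ⟶ K.X 1 :=
  (K.isoHomologyπ 2 1 (by simp) h).inv ≫ K.iCycles 1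

instance (K : ChainComplex B ℕ) (h : K.d 2 1 = 0) : Mono (homologyInclusion K h) := by
  unfold homologyInclusion
  infer_instance

lemma homologyInclusion_d (K : ChainComplex B ℕ) (h : K.d 2 1 = 0) :
    homologyInclusion K h ≫ K.d 1 0 = 0 := by
  simp [homologyInclusion]

/-- With no incoming differential, homology equals cycles, and cycles are the kernel of the outgoing
differential. -/
lemma homologyInclusion_exact (K : ChainComplex B ℕ) (h : K.d 2 1 = 0) :
    (ShortComplex.mk _ _ (homologyInclusion_d K h)).Exact := by
  have h1 := ShortComplex.exact_of_f_is_kernel (ShortComplex.mk (K.iCycles 1) (K.d 1 0)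
    (K.iCycles_d 1 0)) (K.cyclesIsKernel 1 0 (by simp))
  refine (ShortComplex.exact_iff_of_iso ?_).2 h1
  exact ShortComplex.isoMk (K.isoHomologyπ 2 1 (by simp) h).symm (Iso.refl _) (Iso.refl _)
    (by simp [homologyInclusion]) (by simp)

lemma homologyInclusion_naturality {K L : ChainComplex B ℕ} (φ : K ⟶ L) (h : K.d 2 1 = 0)
    (h' : L.d 2 1 = 0) : HomologicalComplex.homologyMap φ 1 ≫ homologyInclusion L h' =
      homologyInclusion K h ≫ φ.f 1 := by
  rw [← cancel_epi (K.isoHomologyπ 2 1 (by simp) h).hom]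
  simp [homologyInclusion]

variable (F G : A ⥤ B) [F.Additive] [G.Additive]

lemma map_twoTermComplex_d_two_one (S : ShortComplex A) :
    ((F.mapHomologicalComplex _).obj (twoTermComplex S)).d 2 1 = 0 :=
  (congrArg F.map (twoTermComplex_d_two_one S)).trans (F.map_zero _ _)

variable [EnoughProjectives A]

/-- The first left derived functor as a subobject of `F(X₁)`, for a projective resolution
`0 → X₁ → X₂ → X₃ → 0`. -/
def leftDerivedInclusion {S : ShortComplex A} (hS : S.ShortExact) [Projective S.X₁]
    [Projective S.X₂] : (F.leftDerived 1).obj S.X₃ ⟶ F.obj S.X₁ :=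
  ((ofShortExact hS).isoLeftDerivedObj F 1).hom ≫
    homologyInclusion ((F.mapHomologicalComplex _).obj (twoTermComplex S))
      (map_twoTermComplex_d_two_one F S)

instance {S : ShortComplex A} (hS : S.ShortExact) [Projective S.X₁] [Projective S.X₂] :
    Mono (leftDerivedInclusion F hS) :=
  have : Mono (homologyInclusion ((F.mapHomologicalComplex _).obj (twoTermComplex S))
      (map_twoTermComplex_d_two_one F S)) := inferInstance
  mono_comp' (inferInstanceAs (Mono ((ofShortExact hS).isoLeftDerivedObj F 1).hom)) this

omit [EnoughProjectives A] in
lemma homologyInclusion_comp_map (S : ShortComplex A) :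
    homologyInclusion ((F.mapHomologicalComplex _).obj (twoTermComplex S))
      (map_twoTermComplex_d_two_one F S) ≫ F.map S.f = 0 :=
  (congrArg (homologyInclusion _ (map_twoTermComplex_d_two_one F S) ≫ ·)
    (congrArg F.map (twoTermComplex_d_one_zero S)).symm).trans (homologyInclusion_d _ _)

lemma leftDerivedInclusion_map {S : ShortComplex A} (hS : S.ShortExact) [Projective S.X₁]
    [Projective S.X₂] : leftDerivedInclusion F hS ≫ F.map S.f = 0 :=
  (Category.assoc _ _ _).trans
    ((congrArg (((ofShortExact hS).isoLeftDerivedObj F 1).hom ≫ ·)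
      (homologyInclusion_comp_map F S)).trans comp_zero)

lemma leftDerivedInclusion_exact {S : ShortComplex A} (hS : S.ShortExact) [Projective S.X₁]
    [Projective S.X₂] : (ShortComplex.mk _ _ (leftDerivedInclusion_map F hS)).Exact := by
  refine (ShortComplex.exact_iff_of_iso ?_).2
    (homologyInclusion_exact ((F.mapHomologicalComplex _).obj (twoTermComplex S))
      (map_twoTermComplex_d_two_one F S))
  refine ShortComplex.isoMk ((ofShortExact hS).isoLeftDerivedObj F 1) (Iso.refl _) (Iso.refl _)
    (Category.comp_id _).symm ?_
  exact (Category.id_comp _).trans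
    ((congrArg F.map (twoTermComplex_d_one_zero S)).trans (Category.comp_id _).symm)

/-- A morphism of short exact sequences is a lift of `φ.τ₃` to the two resolutions, and the
comparison isomorphisms are natural for such lifts. -/
lemma leftDerivedInclusion_naturality {S S' : ShortComplex A} (hS : S.ShortExact)
    [Projective S.X₁] [Projective S.X₂] (hS' : S'.ShortExact) [Projective S'.X₁]
    [Projective S'.X₂] (φ : S ⟶ S') :
    (F.leftDerived 1).map φ.τ₃ ≫ leftDerivedInclusion F hS' =
      leftDerivedInclusion F hS ≫ F.map φ.τ₁ := by
  have h0 : (twoTermComplexMap φ).f 0 ≫ (ofShortExact hS').π.f 0 =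
      (ofShortExact hS).π.f 0 ≫ φ.τ₃ :=
    (congrArg ((twoTermComplexMap φ).f 0 ≫ ·) (ofShortExact_π_f_zero hS')).trans
      (φ.comm₂₃.trans (congrArg (· ≫ φ.τ₃) (ofShortExact_π_f_zero hS).symm))
  have h1 := ProjectiveResolution.isoLeftDerivedObj_hom_naturality φ.τ₃ (ofShortExact hS)
    (ofShortExact hS') (twoTermComplexMap φ) h0 F 1
  have h2 := homologyInclusion_naturality ((F.mapHomologicalComplex _).map (twoTermComplexMap φ))
    (map_twoTermComplex_d_two_one F S) (map_twoTermComplex_d_two_one F S')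
  exact (Category.assoc _ _ _).symm.trans ((congrArg (· ≫ homologyInclusion _
    (map_twoTermComplex_d_two_one F S')) h1).trans ((Category.assoc _ _ _).trans
      ((congrArg (((ofShortExact hS).isoLeftDerivedObj F 1).hom ≫ ·) h2).trans
        (Category.assoc _ _ _).symm)))

variable {F G}

/-- On a fixed resolution the derived transformation is `α` applied termwise. -/
lemma leftDerivedInclusion_natTrans (α : F ⟶ G) {S : ShortComplex A} (hS : S.ShortExact)
    [Projective S.X₁] [Projective S.X₂] :
    (NatTrans.leftDerived α 1).app S.X₃ ≫ leftDerivedInclusion G hS =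
      leftDerivedInclusion F hS ≫ α.app S.X₁ := by
  have h1 : (NatTrans.leftDerived α 1).app S.X₃ ≫ ((ofShortExact hS).isoLeftDerivedObj G 1).hom =
      ((ofShortExact hS).isoLeftDerivedObj F 1).hom ≫
        (HomologicalComplex.homologyFunctor B (ComplexShape.down ℕ) 1).map
        ((NatTrans.mapHomologicalComplex α _).app (ofShortExact hS).complex) := by
    rw [ProjectiveResolution.leftDerived_app_eq α (ofShortExact hS), Category.assoc,
      Category.assoc, Iso.inv_hom_id, Category.comp_id]
  have h2 := homologyInclusion_naturality
    ((NatTrans.mapHomologicalComplex α _).app (twoTermComplex S))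
    (map_twoTermComplex_d_two_one F S) (map_twoTermComplex_d_two_one G S)
  exact (Category.assoc _ _ _).symm.trans ((congrArg (· ≫ homologyInclusion _
    (map_twoTermComplex_d_two_one G S)) h1).trans ((Category.assoc _ _ _).trans
      ((congrArg (((ofShortExact hS).isoLeftDerivedObj F 1).hom ≫ ·) h2).trans
        (Category.assoc _ _ _).symm)))

end LengthOneResolution

-- `Tor₁` as a kernel, naturally in both arguments.

noncomputable section TorInclusion

variable {R : Type u} [CommRing R]

instance projective_moduleCat (M : ModuleCat.{u} R) [Module.Projective R M] : Projective M :=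
  M.projective_of_categoryTheory_projective

/-- `Tor₁(M, X₃)` as a submodule of `M ⊗ X₁`, for a projective resolution
`0 → X₁ → X₂ → X₃ → 0`. -/
def torInclusion (M : ModuleCat.{u} R) {S : ShortComplex (ModuleCat.{u} R)} (hS : S.ShortExact)
    [Module.Projective R S.X₁] [Module.Projective R S.X₂] :
    ((Tor (ModuleCat.{u} R) 1).obj M).obj S.X₃ →ₗ[R] M ⊗[R] S.X₁ :=
  (leftDerivedInclusion ((MonoidalCategory.tensoringLeft _).obj M) hS).hom

variable (M : ModuleCat.{u} R) {S : ShortComplex (ModuleCat.{u} R)} (hS : S.ShortExact)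
    [Module.Projective R S.X₁] [Module.Projective R S.X₂]

lemma torInclusion_injective : Function.Injective (torInclusion M hS) :=
  (ModuleCat.mono_iff_injective _).1
    (inferInstanceAs (Mono (leftDerivedInclusion ((MonoidalCategory.tensoringLeft _).obj M) hS)))

lemma torInclusion_exact : Function.Exact (torInclusion M hS) (S.f.hom.lTensor M) :=
  (ShortComplex.ShortExact.moduleCat_exact_iff_function_exact _).1
    (leftDerivedInclusion_exact ((MonoidalCategory.tensoringLeft _).obj M) hS)

variable {M} {M' : ModuleCat.{u} R} {S' : ShortComplex (ModuleCat.{u} R)} {hS : S.ShortExact}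
  {hS' : S'.ShortExact} [Module.Projective R S'.X₁] [Module.Projective R S'.X₂]

/-- The two variables are handled separately: the second by mapping resolutions, the first by a
transformation of the tensor functors on a fixed resolution. -/
lemma torInclusion_natural (f : M ⟶ M') (φ : S ⟶ S') :
    torInclusion M' hS' ∘ₗ (((Tor (ModuleCat.{u} R) 1).map f).app S.X₃ ≫
        ((Tor (ModuleCat.{u} R) 1).obj M').map φ.τ₃).hom =
      TensorProduct.map f.hom φ.τ₁.hom ∘ₗ torInclusion M hS := by
  have h1 := leftDerivedInclusion_naturality ((MonoidalCategory.tensoringLeft _).obj M') hS hS' φ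
  have h2 := leftDerivedInclusion_natTrans ((MonoidalCategory.tensoringLeft _).map f) hS
  have h3 : torInclusion M' hS' ∘ₗ (((Tor (ModuleCat.{u} R) 1).obj M').map φ.τ₃).hom =
      φ.τ₁.hom.lTensor M' ∘ₗ torInclusion M' hS := congrArg ModuleCat.Hom.hom h1
  have h4 : torInclusion M' hS ∘ₗ (((Tor (ModuleCat.{u} R) 1).map f).app S.X₃).hom =
      f.hom.rTensor S.X₁ ∘ₗ torInclusion M hS := congrArg ModuleCat.Hom.hom h2
  rw [ModuleCat.hom_comp, ← LinearMap.comp_assoc, h3, LinearMap.comp_assoc, h4,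
    ← LinearMap.comp_assoc, LinearMap.lTensor_comp_rTensor]

end TorInclusion

-- The chain complexes of sets of sequences as instances of the algebraic data.

noncomputable section ChainLevel

variable (R : Type u) [CommRing R] {V V' W W' : Type u}

/-- The inclusion of the cycles into the chains. -/
def cyclesInclusion (X : Set (List V)) (n : ℕ) : cycles R X n →ₗ[R] chains R X n :=
  Submodule.inclusion inf_le_left

/-- A set of sequences which is closed under subsequences. -/
def SublistClosed (X : Set (List V)) : Prop := ∀ l ∈ X, ∀ l' : List V, l'.Sublist l → l' ∈ X

variable {X : Set (List V)} {X' : Set (List V')} {Y : Set (List (V ⊕ₗ V'))}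

/-- The boundary map from chains to cycles. -/
def boundaryCycles (hX : SublistClosed X) (n : ℕ) : chains R X (n + 1) →ₗ[R] cycles R X n :=
  (boundary R).restrict fun _ hx => ⟨boundary_mem_chains R hX hx, boundary_boundary R _⟩

lemma boundary_eq_zero_of_mem_chains_zero {x : SeqModule R V} (hx : x ∈ chains R X 0) :
    boundary R x = 0 := by
  rw [chains, Finsupp.supported_eq_span_single] at hx
  induction hx using Submodule.span_induction with
  | mem x hx =>
    obtain ⟨l, ⟨-, hl⟩, rfl⟩ := hx
    obtain rfl := List.length_eq_zero_iff.1 hl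
    exact boundary_nil R
  | zero => exact map_zero _
  | add x y _ _ hx hy => rw [map_add, hx, hy, add_zero]
  | smul r x _ hx => rw [map_smul, hx, smul_zero]

lemma isCycleData (hX : SublistClosed X) :
    IsCycleData (R := R) (C := fun i => chains R X i) (Z := fun i => cycles R X i)
      (H := fun i => Homology R X i) (cyclesInclusion R X) (boundaryCycles R hX) (homologyClass R X) where
  inj i := Submodule.inclusion_injective _
  -- Degree zero contains at most multiples of the empty sequence, whose boundary is zero.
  surj_zero x := ⟨⟨x, x.2, boundary_eq_zero_of_mem_chains_zero R x.2⟩, rfl⟩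
  exact_chains i x := by
    constructor
    · intro h
      exact ⟨⟨x, x.2, congrArg Subtype.val h⟩, rfl⟩
    · rintro ⟨z, rfl⟩
      exact Subtype.ext z.2.2
  exact_cycles i z := by
    constructor
    · intro h
      obtain ⟨x, hx, hxz⟩ := (Submodule.Quotient.mk_eq_zero _).1 h
      exact ⟨⟨x, hx⟩, Subtype.ext hxz⟩
    · rintro ⟨x, rfl⟩
      exact (Submodule.Quotient.mk_eq_zero _).2 ⟨x, x.2, rfl⟩
  surj i := Submodule.mkQ_surjective _

section Projection

/-- A sequence as a chain of `X` with `i` entries, or zero if it is not a member of `X` with `i`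
entries. -/
def chainSingle (X : Set (List V)) (i : ℕ) (l : List V) : chains R X i :=
  open Classical in
  if h : l ∈ X ∧ l.length = i then ⟨Finsupp.single l 1, Finsupp.single_mem_supported R _ h⟩ else 0

/-- The projection onto the chains of `X` with `i` entries. -/
def chainProj (X : Set (List V)) (i : ℕ) : SeqModule R V →ₗ[R] chains R X i :=
  Finsupp.linearCombination R (chainSingle R X i)

lemma chainProj_single (i : ℕ) (l : List V) :
    chainProj R X i (Finsupp.single l 1) = chainSingle R X i l := by
  rw [chainProj, Finsupp.linearCombination_single, one_smul]

lemma chainProj_of_mem {i : ℕ} {x : SeqModule R V} (hx : x ∈ chains R X i) :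
    chainProj R X i x = ⟨x, hx⟩ := by
  refine Subtype.ext ?_
  change ((chains R X i).subtype ∘ₗ chainProj R X i) x =
    (LinearMap.id : SeqModule R V →ₗ[R] SeqModule R V) x
  rw [chains, Finsupp.supported_eq_span_single] at hx
  refine LinearMap.eqOn_span' (f := (chains R X i).subtype ∘ₗ chainProj R X i)
    (g := LinearMap.id) ?_ hx
  rintro _ ⟨l, ⟨h1, h2⟩, rfl⟩
  rw [LinearMap.comp_apply, chainProj_single, chainSingle, dif_pos ⟨h1, h2⟩]
  rfl

lemma chainProj_of_mem_ne {i j : ℕ} (hij : i ≠ j) {x : SeqModule R V} (hx : x ∈ chains R X j) :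
    chainProj R X i x = 0 := by
  change chainProj R X i x = (0 : SeqModule R V →ₗ[R] chains R X i) x
  rw [chains, Finsupp.supported_eq_span_single] at hx
  refine LinearMap.eqOn_span' ?_ hx
  rintro _ ⟨l, hl, rfl⟩
  rw [chainProj_single, chainSingle, dif_neg fun h => hij (h.2.symm.trans hl.2)]
  rfl

lemma single_mem_chains {l : List V} (hl : l ∈ X) :
    Finsupp.single l (1 : R) ∈ chains R X l.length :=
  Finsupp.single_mem_supported R _ ⟨hl, rfl⟩

/-- The degree `m` of `x` is unrelated to `i`: off the matching degree both sides vanish. This lets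
the Leibniz rule be verified in all bidegrees at once. -/
lemma chainProj_boundary (hX : SublistClosed X) (i m : ℕ) {x : SeqModule R V}
    (hx : x ∈ chains R X m) : chainProj R X i (boundary R x) =
      (cyclesInclusion R X i ∘ₗ boundaryCycles R hX i) (chainProj R X (i + 1) x) := by
  by_cases h : i + 1 = m
  · subst h
    rw [chainProj_of_mem R hx, chainProj_of_mem R (boundary_mem_chains R hX hx)]
    rfl
  · rw [chainProj_of_mem_ne R h hx, map_zero]
    cases m with
    | zero => rw [boundary_eq_zero_of_mem_chains_zero R hx, map_zero]
    | succ m =>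
      exact chainProj_of_mem_ne R (fun h' => h (congrArg (· + 1) h')) (boundary_mem_chains R hX hx)

/-- The restriction of a chain map to chains. -/
def chainMap {X₂ : Set (List W)} (ψ : SeqModule R V →ₗ[R] SeqModule R W)
    (cψ : ∀ n, chains R X n ≤ (chains R X₂ n).comap ψ) (n : ℕ) :
    chains R X n →ₗ[R] chains R X₂ n :=
  ψ.restrict (cψ n)

lemma chainProj_chainMap {X₂ : Set (List W)} (ψ : SeqModule R V →ₗ[R] SeqModule R W)
    (cψ : ∀ n, chains R X n ≤ (chains R X₂ n).comap ψ) (i m : ℕ) {x : SeqModule R V}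
    (hx : x ∈ chains R X m) :
    chainProj R X₂ i (ψ x) = chainMap R ψ cψ i (chainProj R X i x) := by
  by_cases h : i = m
  · subst h
    rw [chainProj_of_mem R hx, chainProj_of_mem R (cψ i hx)]
    rfl
  · rw [chainProj_of_mem_ne R h hx, chainProj_of_mem_ne R h (cψ m hx), map_zero]

end Projection

-- The chains of a join as a total complex.

section Components

/-- The entries of a sequence in `V ⊔ V'` which belong to `V`. -/
def leftPart (l : List (V ⊕ₗ V')) : List V := l.filterMap fun v => (ofLex v).getLeft?

/-- The entries of a sequence in `V ⊔ V'` which belong to `V'`. -/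
def rightPart (l : List (V ⊕ₗ V')) : List V' := l.filterMap fun v => (ofLex v).getRight?

lemma leftPart_joinSeq (a : List V) (b : List V') : leftPart (joinSeq a b) = a := by
  simp [leftPart, joinSeq, List.filterMap_map, Function.comp_def]

lemma rightPart_joinSeq (a : List V) (b : List V') : rightPart (joinSeq a b) = b := by
  simp [rightPart, joinSeq, List.filterMap_map, Function.comp_def]

/-- The component of bidegree `(i, j)` of a chain of the join. -/
def joinComponent (X : Set (List V)) (X' : Set (List V')) (i j : ℕ) :
    SeqModule R (V ⊕ₗ V') →ₗ[R] chains R X i ⊗[R] chains R X' j :=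
  Finsupp.linearCombination R fun l =>
    chainSingle R X i (leftPart l) ⊗ₜ[R] chainSingle R X' j (rightPart l)

/-- A concatenation determines its two parts, so its component is the tensor of the projected
factors. Since chains of a join are spanned by concatenations, component identities reduce to this
formula. -/
lemma joinComponent_joinChain (i j : ℕ) (x : SeqModule R V) (y : SeqModule R V') :
    joinComponent R X X' i j (joinChain R x y) = chainProj R X i x ⊗ₜ[R] chainProj R X' j y := by
  have : (LinearMap.llcomp R _ _ _ (joinComponent R X X' i j)) ∘ₗ joinChain R =
      (TensorProduct.mk R _ _).compl₁₂ (chainProj R X i) (chainProj R X' j) := by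
    refine Finsupp.lhom_ext' fun l => LinearMap.ext_ring ?_
    refine Finsupp.lhom_ext' fun l' => LinearMap.ext_ring ?_
    simp only [LinearMap.comp_apply, Finsupp.lsingle_apply, LinearMap.llcomp_apply,
      LinearMap.compl₁₂_apply, joinChain_single, chainProj_single, TensorProduct.mk_apply]
    rw [joinComponent, Finsupp.linearCombination_single, one_smul, leftPart_joinSeq,
      rightPart_joinSeq]
  exact LinearMap.congr_fun (LinearMap.congr_fun this x) y

/-- The concatenation of chains of given lengths. -/
def joinTensor (X : Set (List V)) (X' : Set (List V')) (i j : ℕ) :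
    chains R X i ⊗[R] chains R X' j →ₗ[R] SeqModule R (V ⊕ₗ V') :=
  TensorProduct.lift ((joinChain R).compl₁₂ (chains R X i).subtype (chains R X' j).subtype)

lemma joinTensor_tmul (i j : ℕ) (x : chains R X i) (y : chains R X' j) :
    joinTensor R X X' i j (x ⊗ₜ y) = joinChain R x.1 y.1 := rfl

lemma joinComponent_joinTensor (i j : ℕ) (t : chains R X i ⊗[R] chains R X' j) :
    joinComponent R X X' i j (joinTensor R X X' i j t) = t := by
  have : joinComponent R X X' i j ∘ₗ joinTensor R X X' i j = LinearMap.id := by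
    refine TensorProduct.ext' fun x y => ?_
    rw [LinearMap.comp_apply, joinTensor_tmul, joinComponent_joinChain, chainProj_of_mem R x.2,
      chainProj_of_mem R y.2]
    rfl
  exact LinearMap.congr_fun this t

lemma joinComponent_joinTensor_ne {i j i' j' : ℕ} (h : i ≠ i' ∨ j ≠ j')
    (t : chains R X i' ⊗[R] chains R X' j') :
    joinComponent R X X' i j (joinTensor R X X' i' j' t) = 0 := by
  have : joinComponent R X X' i j ∘ₗ joinTensor R X X' i' j' = 0 := by
    refine TensorProduct.ext' fun x y => ?_
    rw [LinearMap.comp_apply, joinTensor_tmul, joinComponent_joinChain]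
    rcases h with h | h
    · rw [chainProj_of_mem_ne R h x.2, TensorProduct.zero_tmul, LinearMap.zero_apply]
    · rw [chainProj_of_mem_ne R h y.2, TensorProduct.tmul_zero, LinearMap.zero_apply]
  exact LinearMap.congr_fun this t

/-- `Y` consists of the concatenations of members of `X` and `X'`. -/
def IsJoin (X : Set (List V)) (X' : Set (List V')) (Y : Set (List (V ⊕ₗ V'))) : Prop :=
  ∀ l, l ∈ Y ↔ ∃ a ∈ X, ∃ b ∈ X', l = joinSeq a b

variable (hX : SublistClosed X) (hX' : SublistClosed X') (hY : IsJoin X X' Y)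

include hY in
lemma IsJoin.joinSeq_mem : ∀ a ∈ X, ∀ b ∈ X', joinSeq a b ∈ Y :=
  fun a ha b hb => (hY _).2 ⟨a, ha, b, hb, rfl⟩

include hY in
/-- Linear maps which agree on concatenations agree on the chains of the join. -/
lemma IsJoin.chains_ext {M : Type*} [AddCommMonoid M] [Module R M]
    {f g : SeqModule R (V ⊕ₗ V') →ₗ[R] M} {n : ℕ}
    (h : ∀ a ∈ X, ∀ b ∈ X', a.length + b.length = n →
      f (joinChain R (Finsupp.single a 1) (Finsupp.single b 1)) =
        g (joinChain R (Finsupp.single a 1) (Finsupp.single b 1)))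
    {w : SeqModule R (V ⊕ₗ V')} (hw : w ∈ chains R Y n) : f w = g w := by
  rw [chains, Finsupp.supported_eq_span_single] at hw
  refine LinearMap.eqOn_span' ?_ hw
  rintro _ ⟨l, ⟨hl, hn⟩, rfl⟩
  obtain ⟨a, ha, b, hb, rfl⟩ := (hY l).1 hl
  have := h a ha b hb (by simpa [joinSeq] using hn)
  rwa [joinChain_single] at this

include hY in
lemma IsJoin.joinTensor_mem {i j n : ℕ} (h : i + j = n) (t : chains R X i ⊗[R] chains R X' j) :
    joinTensor R X X' i j t ∈ chains R Y n := by
  induction t with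
  | zero => rw [map_zero]; exact Submodule.zero_mem _
  | tmul x y => exact joinChain_mem R hY.joinSeq_mem h x.2 y.2
  | add x y hx hy => rw [map_add]; exact Submodule.add_mem _ hx hy

include hY in
-- On a concatenation only the bidegree given by the lengths of its two parts contributes, and there
-- it is recovered.
lemma IsJoin.sum_joinTensor {n : ℕ} {w : SeqModule R (V ⊕ₗ V')} (hw : w ∈ chains R Y n) :
    ∑ p ∈ Finset.HasAntidiagonal.antidiagonal n,
      joinTensor R X X' p.1 p.2 (joinComponent R X X' p.1 p.2 w) = w := by
  have := hY.chains_ext R (f := ∑ p ∈ Finset.HasAntidiagonal.antidiagonal n,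
    joinTensor R X X' p.1 p.2 ∘ₗ joinComponent R X X' p.1 p.2) (g := LinearMap.id) ?_ hw
  · simpa using this
  intro a ha b hb hab
  rw [LinearMap.sum_apply, Finset.sum_eq_single (a.length, b.length)]
  · rw [LinearMap.comp_apply, joinComponent_joinChain, joinTensor_tmul,
      chainProj_of_mem R (single_mem_chains R ha), chainProj_of_mem R (single_mem_chains R hb)]
    rfl
  · rintro ⟨i, j⟩ - hij
    rw [LinearMap.comp_apply, joinComponent_joinChain]
    by_cases hi : i = a.length
    · have hj : j ≠ b.length := fun hj => hij (Prod.ext hi hj)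
      rw [chainProj_of_mem_ne R hj (single_mem_chains R hb), TensorProduct.tmul_zero, map_zero]
    · rw [chainProj_of_mem_ne R hi (single_mem_chains R ha), TensorProduct.zero_tmul, map_zero]
  · intro h
    exact (h (by simpa using hab)).elim

include hY in
lemma IsJoin.sublistClosed (hX : SublistClosed X) (hX' : SublistClosed X') : SublistClosed Y := by
  intro l hl l' hl'
  obtain ⟨a, ha, b, hb, rfl⟩ := (hY l).1 hl
  obtain ⟨l₁, l₂, rfl, h₁, h₂⟩ := List.sublist_append_iff.1 hl'
  obtain ⟨a', ha', rfl⟩ := List.sublist_map_iff.1 h₁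
  obtain ⟨b', hb', rfl⟩ := List.sublist_map_iff.1 h₂
  exact (hY _).2 ⟨a', hX a ha a' ha', b', hX' b hb b' hb', rfl⟩

/-- The components of the chains of the join. -/
def chainComponent (X : Set (List V)) (X' : Set (List V')) (Y : Set (List (V ⊕ₗ V')))
    (n i j : ℕ) : chains R Y n →ₗ[R] chains R X i ⊗[R] chains R X' j :=
  joinComponent R X X' i j ∘ₗ (chains R Y n).subtype

lemma isTotal : IsTotal (R := R) (C := fun i => chains R X i) (Z := fun i => cycles R X i)
    (C' := fun i => chains R X' i) (Z' := fun i => cycles R X' i) (T := fun i => chains R Y i)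
    (ZT := fun i => cycles R Y i) (cyclesInclusion R X) (boundaryCycles R hX) (cyclesInclusion R X')
    (boundaryCycles R hX') (cyclesInclusion R Y) (boundaryCycles R (hY.sublistClosed hX hX'))
    (chainComponent R X X' Y) where
  eq_zero {n w} h := by
    refine Subtype.ext ?_
    rw [← hY.sum_joinTensor R w.2]
    refine Finset.sum_eq_zero fun p hp => ?_
    have := h p.1 p.2 (by simpa using hp)
    rw [chainComponent, LinearMap.comp_apply, Submodule.subtype_apply] at this
    rw [this, map_zero]
  exists_eq n t := by
    refine ⟨⟨∑ p ∈ Finset.HasAntidiagonal.antidiagonal n, joinTensor R X X' p.1 p.2 (t p.1 p.2),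
      Submodule.sum_mem _ fun p hp => hY.joinTensor_mem R (by simpa using hp) _⟩,
      fun i j hij => ?_⟩
    rw [chainComponent, LinearMap.comp_apply, Submodule.subtype_apply, map_sum,
      Finset.sum_eq_single (i, j)]
    · exact joinComponent_joinTensor R i j _
    · rintro ⟨i', j'⟩ - h
      refine joinComponent_joinTensor_ne R ?_ _
      by_contra! h'
      exact h (Prod.ext h'.1.symm h'.2.symm)
    · intro h
      exact (h (by simpa using hij)).elim
  leibniz {n i j} h w := by
    have := hY.chains_ext R
      (f := joinComponent R X X' i j ∘ₗ boundary R)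
      (g := (cyclesInclusion R X i ∘ₗ boundaryCycles R hX i).rTensor (chains R X' j) ∘ₗ
          joinComponent R X X' (i + 1) j + (-1 : R) ^ i •
        (cyclesInclusion R X' j ∘ₗ boundaryCycles R hX' j).lTensor (chains R X i) ∘ₗ
          joinComponent R X X' i (j + 1)) ?_ w.2
    · exact this
    intro a ha b hb _
    have ha' := single_mem_chains R ha
    have hb' := single_mem_chains R hb
    rw [LinearMap.comp_apply, boundary_joinChain R ha', map_add, map_smul, LinearMap.add_apply,
      LinearMap.smul_apply, LinearMap.comp_apply, LinearMap.comp_apply,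
      joinComponent_joinChain, joinComponent_joinChain, joinComponent_joinChain,
      joinComponent_joinChain, LinearMap.rTensor_tmul, LinearMap.lTensor_tmul,
      chainProj_boundary R hX i _ ha', chainProj_boundary R hX' j _ hb']
    -- The Leibniz rule for `a` carries the sign of `a.length` and the claim that of `i`; when they
    -- differ the component in question is zero.
    by_cases hi : i = a.length
    · rw [hi]
    · rw [chainProj_of_mem_ne R hi ha', TensorProduct.zero_tmul,
        smul_zero, smul_zero]

lemma isCross (n : ℕ)
    {χ : (DirectSum {p : ℕ × ℕ // p.1 + p.2 = n} fun p =>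
      Homology R X p.1.1 ⊗[R] Homology R X' p.1.2) →ₗ[R] Homology R Y n}
    (hχ : χ = DirectSum.toModule R _ _ fun p =>
      TensorProduct.lift (cross R hY.joinSeq_mem p.2)) :
    IsCross (R := R) (C := fun i => chains R X i) (Z := fun i => cycles R X i)
      (H := fun i => Homology R X i) (C' := fun i => chains R X' i)
      (Z' := fun i => cycles R X' i) (H' := fun i => Homology R X' i)
      (T := fun i => chains R Y i) (ZT := fun i => cycles R Y i)
      (HT := fun i => Homology R Y i) (cyclesInclusion R X) (homologyClass R X) (cyclesInclusion R X') (homologyClass R X')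
      (cyclesInclusion R Y) (homologyClass R Y) (chainComponent R X X' Y) n χ := by
  intro p x y
  refine ⟨⟨joinChain R x.1 y.1, joinChain_mem_cycles R hY.joinSeq_mem p.2 x.2 y.2⟩, ?_, ?_, ?_⟩
  · rw [hχ, DirectSum.toModule_lof]
    rfl
  · refine (joinComponent_joinChain R _ _ x.1 y.1).trans ?_
    rw [chainProj_of_mem R x.2.1, chainProj_of_mem R y.2.1]
    rfl
  · intro i j _ hi
    refine (joinComponent_joinChain R _ _ x.1 y.1).trans ?_
    rw [chainProj_of_mem_ne R hi x.2.1, TensorProduct.zero_tmul]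

end Components

end ChainLevel

-- The Künneth sequence of two sets of sequences.

noncomputable section Connecting

variable (R : Type u) [CommRing R] {V V' W W' : Type u}
  {X : Set (List V)} {X' : Set (List V')} {Y : Set (List (V ⊕ₗ V'))}

/-- Projectivity of the boundaries splits `0 → Z → C → B → 0`. Degree zero is separate because there
the inclusion of cycles is already bijective. -/
lemma IsCycleData.exists_retraction {C Z H : ℕ → Type u} [∀ i, AddCommGroup (C i)]
    [∀ i, AddCommGroup (Z i)] [∀ i, AddCommGroup (H i)] [∀ i, Module R (C i)]
    [∀ i, Module R (Z i)] [∀ i, Module R (H i)] {ι : ∀ i, Z i →ₗ[R] C i}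
    {b : ∀ i, C (i + 1) →ₗ[R] Z i} {π : ∀ i, Z i →ₗ[R] H i} (E : IsCycleData ι b π)
    [∀ j, Module.Projective R (LinearMap.range (b j))] (j : ℕ) :
    ∃ ρ : C j →ₗ[R] Z j, ρ ∘ₗ ι j = LinearMap.id := by
  cases j with
  | zero =>
    let e := LinearEquiv.ofBijective (ι 0) ⟨E.inj 0, E.surj_zero⟩
    exact ⟨e.symm.toLinearMap, LinearMap.ext fun x => e.symm_apply_apply x⟩
  | succ j =>
    obtain ⟨s, hs⟩ := Module.projective_lifting_property (b j).rangeRestrict LinearMap.id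
      (b j).surjective_rangeRestrict
    have h := (E.exact_range j).split_tfae'.out 0 1
    exact (h.1 ⟨E.inj _, s, hs⟩).2

instance (hX : SublistClosed X) (n : ℕ) : AddCommGroup (LinearMap.range (boundaryCycles R hX n)) :=
  Submodule.addCommGroup (M := cycles R X n) _

lemma homologyClass_comp_subtype (hX : SublistClosed X) (j : ℕ) :
    homologyClass R X j ∘ₗ (LinearMap.range (boundaryCycles R hX j)).subtype = 0 := by
  refine LinearMap.ext ?_
  rintro ⟨_, x, rfl⟩
  exact (isCycleData R hX).π_b j x

/-- The short exact sequence of boundaries, cycles and homology. -/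
abbrev homologyShortComplex (hX : SublistClosed X) (j : ℕ) : ShortComplex (ModuleCat.{u} R) where
  X₁ := ModuleCat.of R (LinearMap.range (boundaryCycles R hX j))
  X₂ := ModuleCat.of R (cycles R X j)
  X₃ := ModuleCat.of R (Homology R X j)
  f := ModuleCat.ofHom (LinearMap.range (boundaryCycles R hX j)).subtype
  g := ModuleCat.ofHom (homologyClass R X j)
  zero := ModuleCat.hom_ext (homologyClass_comp_subtype R hX j)

lemma homologyShortComplex_shortExact (hX : SublistClosed X) (j : ℕ) :
    (homologyShortComplex R hX j).ShortExact := by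
  refine ModuleCat.shortComplex_shortExact _ (fun z => ?_) (Submodule.subtype_injective _)
    ((isCycleData R hX).surj j)
  refine ((isCycleData R hX).exact_cycles j z).trans ⟨?_, ?_⟩
  · rintro ⟨x, rfl⟩
    exact ⟨⟨_, x, rfl⟩, rfl⟩
  · rintro ⟨⟨_, x, rfl⟩, rfl⟩
    exact ⟨x, rfl⟩

variable [IsDomain R] [IsPrincipalIdealRing R]

instance free_cycles (X : Set (List V)) (n : ℕ) : Module.Free R (cycles R X n) :=
  free_submodule _

instance free_range_boundaryCycles (hX : SublistClosed X) (n : ℕ) :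
    Module.Free R (LinearMap.range (boundaryCycles R hX n)) :=
  free_submodule (M := cycles R X n) _

instance (hX : SublistClosed X) (n : ℕ) :
    Module.Projective R (homologyShortComplex R hX n).X₁ :=
  inferInstanceAs (Module.Projective R (LinearMap.range (boundaryCycles R hX n)))

instance (hX : SublistClosed X) (n : ℕ) :
    Module.Projective R (homologyShortComplex R hX n).X₂ :=
  inferInstanceAs (Module.Projective R (cycles R X n))

lemma exists_cycles_retraction (hX : SublistClosed X) (j : ℕ) :
    ∃ ρ : chains R X j →ₗ[R] cycles R X j, ρ ∘ₗ cyclesInclusion R X j = LinearMap.id :=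
  (isCycleData R hX).exists_retraction R j

/-- `Tor₁` of the homology modules, as a submodule of `H_i ⊗ B'_j`. -/
def torHomology (X : Set (List V)) (hX' : SublistClosed X') (i j : ℕ) :
    ((Tor (ModuleCat.{u} R) 1).obj (ModuleCat.of R (Homology R X i))).obj
      (ModuleCat.of R (Homology R X' j)) →ₗ[R]
      Homology R X i ⊗[R] LinearMap.range (boundaryCycles R hX' j) :=
  torInclusion (ModuleCat.of R (Homology R X i)) (homologyShortComplex_shortExact R hX' j)

lemma torHomology_injective (X : Set (List V)) (hX' : SublistClosed X') (i j : ℕ) :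
    Function.Injective (torHomology R X hX' i j) :=
  torInclusion_injective _ _

lemma torHomology_exact (X : Set (List V)) (hX' : SublistClosed X') (i j : ℕ) :
    Function.Exact (torHomology R X hX' i j)
      ((LinearMap.range (boundaryCycles R hX' j)).subtype.lTensor (Homology R X i)) :=
  torInclusion_exact (ModuleCat.of R (Homology R X i)) (homologyShortComplex_shortExact R hX' j)

variable (hX : SublistClosed X) (hX' : SublistClosed X') (hY : IsJoin X X' Y)

/-- The connecting map of the Künneth sequence of two sets of sequences. -/
def joinConnecting (n : ℕ) : ModuleCat.of R (Homology R Y n) ⟶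
    torSum R (fun i => ModuleCat.of R (Homology R X i)) (fun j => ModuleCat.of R (Homology R X' j))
      n :=
  ModuleCat.ofHom
    (Y := DirectSum {p : ℕ × ℕ // p.1 + p.2 + 1 = n} fun p => ((Tor (ModuleCat.{u} R) 1).obj
      (ModuleCat.of R (Homology R X p.1.1))).obj (ModuleCat.of R (Homology R X' p.1.2)))
    (connecting (isCycleData R hX) (isCycleData R hX')
    (isCycleData R (hY.sublistClosed hX hX')) (isTotal R hX hX' hY)
    (Tr := fun i j => ((Tor (ModuleCat.{u} R) 1).obj (ModuleCat.of R (Homology R X i))).obj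
      (ModuleCat.of R (Homology R X' j)))
    (torHomology R X hX')
    (exists_cycles_retraction R hX') (torHomology_injective R X hX') (torHomology_exact R X hX') n)

/-- The homology cross product on the sum of all bidegrees. -/
abbrev joinCross (n : ℕ) : tensorSum R (fun i => ModuleCat.of R (Homology R X i))
    (fun j => ModuleCat.of R (Homology R X' j)) n ⟶ ModuleCat.of R (Homology R Y n) :=
  tensorSumDesc fun p => cross R hY.joinSeq_mem p.2

lemma joinCross_connecting (n : ℕ) :
    joinCross R hY n ≫ joinConnecting R hX hX' hY n = 0 :=
  ModuleCat.hom_ext (LinearMap.ext fun t =>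
    (isCross R hY n (χ := (joinCross R hY n).hom) rfl).connecting_comp_apply
      (isCycleData R hX) (isCycleData R hX')
      (isCycleData R (hY.sublistClosed hX hX')) (isTotal R hX hX' hY)
      (torHomology R X hX') (exists_cycles_retraction R hX') (torHomology_injective R X hX')
      (torHomology_exact R X hX') t)

lemma join_shortExact (n : ℕ) : (ShortComplex.mk (joinCross R hY n) (joinConnecting R hX hX' hY n)
    (joinCross_connecting R hX hX' hY n)).ShortExact := by
  refine ModuleCat.shortComplex_shortExact _ ?_ ?_ ?_
  · exact (isCross R hY n (χ := (joinCross R hY n).hom) rfl).exact_connecting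
      (isCycleData R hX) (isCycleData R hX')
      (isCycleData R (hY.sublistClosed hX hX')) (isTotal R hX hX' hY)
      (torHomology R X hX') (exists_cycles_retraction R hX') (torHomology_injective R X hX')
      (torHomology_exact R X hX')
  · exact (isCross R hY n (χ := (joinCross R hY n).hom) rfl).injective
      (isCycleData R hX) (isCycleData R hX')
      (isCycleData R (hY.sublistClosed hX hX')) (isTotal R hX hX' hY)
      (exists_cycles_retraction R hX')
  · exact connecting_surjective
      (isCycleData R hX) (isCycleData R hX')
      (isCycleData R (hY.sublistClosed hX hX')) (isTotal R hX hX' hY)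
      (torHomology R X hX') (exists_cycles_retraction R hX') (torHomology_injective R X hX')
      (torHomology_exact R X hX')

-- Naturality for chain maps compatible with concatenation.

section Naturality

variable {X₂ : Set (List W)} {X₂' : Set (List W')} {Y₂ : Set (List (W ⊕ₗ W'))}
    {hX₂ : SublistClosed X₂} {hX₂' : SublistClosed X₂'} {hY₂ : IsJoin X₂ X₂' Y₂}
    {ψ : SeqModule R V →ₗ[R] SeqModule R W} (hψ : ψ ∘ₗ boundary R = boundary R ∘ₗ ψ)
    (cψ : ∀ n, chains R X n ≤ (chains R X₂ n).comap ψ)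
    {ψ' : SeqModule R V' →ₗ[R] SeqModule R W'} (hψ' : ψ' ∘ₗ boundary R = boundary R ∘ₗ ψ')
    (cψ' : ∀ n, chains R X' n ≤ (chains R X₂' n).comap ψ')
    {χ : SeqModule R (V ⊕ₗ V') →ₗ[R] SeqModule R (W ⊕ₗ W')}
    (hχ : χ ∘ₗ boundary R = boundary R ∘ₗ χ)
    (cχ : ∀ n, chains R Y n ≤ (chains R Y₂ n).comap χ)

/-- The restriction of a chain map to cycles. -/
def cyclesMap (n : ℕ) : cycles R X n →ₗ[R] cycles R X₂ n :=
  ψ.restrict fun x hx => ⟨cψ n hx.1, by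
    have h1 := LinearMap.congr_fun hψ x
    have h2 : boundary R x = 0 := hx.2
    rw [LinearMap.comp_apply, h2, map_zero] at h1
    exact h1.symm⟩

omit [IsDomain R] [IsPrincipalIdealRing R] in
lemma cyclesMap_boundaryCycles (hX : SublistClosed X) (hX₂ : SublistClosed X₂) (n : ℕ) :
    boundaryCycles R hX₂ n ∘ₗ chainMap R ψ cψ (n + 1) =
      cyclesMap R hψ cψ n ∘ₗ boundaryCycles R hX n :=
  LinearMap.ext fun x => Subtype.ext (LinearMap.congr_fun hψ x.1).symm

/-- The restriction of a chain map to boundaries. -/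
def boundariesMap (hX : SublistClosed X) (hX₂ : SublistClosed X₂) (n : ℕ) :
    LinearMap.range (boundaryCycles R hX n) →ₗ[R] LinearMap.range (boundaryCycles R hX₂ n) :=
  (cyclesMap R hψ cψ n).restrict (by
    rintro _ ⟨x, rfl⟩
    exact ⟨_, LinearMap.congr_fun (cyclesMap_boundaryCycles R hψ cψ hX hX₂ n) x⟩)

/-- The map of short exact sequences of boundaries, cycles and homology given by a chain map. -/
def homologyShortComplexMap (hX : SublistClosed X) (hX₂ : SublistClosed X₂) (n : ℕ) :
    homologyShortComplex R hX n ⟶ homologyShortComplex R hX₂ n where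
  τ₁ := ModuleCat.ofHom (boundariesMap R hψ cψ hX hX₂ n)
  τ₂ := ModuleCat.ofHom (cyclesMap R hψ cψ n)
  τ₃ := ModuleCat.ofHom (homologyMap R ψ hψ cψ n)
  comm₁₂ := rfl
  comm₂₃ := rfl

/-- Stated for arbitrary chain maps subject only to `hm`, so that directed maps, simplicial maps and
the projections are all instances. -/
lemma joinConnecting_natural (hm : ∀ x y, χ (joinChain R x y) = joinChain R (ψ x) (ψ' y)) (n : ℕ) :
    ModuleCat.ofHom (homologyMap R χ hχ cχ n) ≫ joinConnecting R hX₂ hX₂' hY₂ n =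
      joinConnecting R hX hX' hY n ≫
        torSumMap (fun i => ModuleCat.ofHom (homologyMap R ψ hψ cψ i))
          (fun j => ModuleCat.ofHom (homologyMap R ψ' hψ' cψ' j)) n := by
  refine ModuleCat.hom_ext ?_
  refine connecting_natural (R := R)
    (isCycleData R hX) (isCycleData R hX')
    (isCycleData R (hY.sublistClosed hX hX')) (isTotal R hX hX' hY)
    (torHomology R X hX') (exists_cycles_retraction R hX') (torHomology_injective R X hX')
    (torHomology_exact R X hX')
    (isCycleData R hX₂) (isCycleData R hX₂')
    (isCycleData R (hY₂.sublistClosed hX₂ hX₂')) (isTotal R hX₂ hX₂' hY₂)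
    (torHomology R X₂ hX₂') (exists_cycles_retraction R hX₂') (torHomology_injective R X₂ hX₂')
    (torHomology_exact R X₂ hX₂')
    (fC := chainMap R ψ cψ) (fZ := cyclesMap R hψ cψ) (fH := homologyMap R ψ hψ cψ)
    (gC := chainMap R ψ' cψ') (gB := boundariesMap R hψ' cψ' hX' hX₂')
    (hT := chainMap R χ cχ) (hZT := cyclesMap R hχ cχ) (hHT := homologyMap R χ hχ cχ)
    (fTr := fun i j => (((Tor (ModuleCat.{u} R) 1).map
        (ModuleCat.ofHom (homologyMap R ψ hψ cψ i))).app (ModuleCat.of R (Homology R X' j)) ≫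
      ((Tor (ModuleCat.{u} R) 1).obj (ModuleCat.of R (Homology R X₂ i))).map
        (ModuleCat.ofHom (homologyMap R ψ' hψ' cψ' j))).hom)
    (fun _ => rfl) (fun _ => rfl) (fun j => ?_) (fun _ => rfl) (fun _ => rfl)
    (fun m i j => ?_) (fun i j => ?_) n
  · exact LinearMap.ext fun x => Subtype.ext
      (LinearMap.congr_fun (cyclesMap_boundaryCycles R hψ' cψ' hX' hX₂' j) x)
  -- Compatibility with components is checked on concatenations, where `hm` separates the two
  -- factors.
  · refine LinearMap.ext fun w => ?_
    refine hY.chains_ext R (f := joinComponent R X₂ X₂' i j ∘ₗ χ)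
      (g := TensorProduct.map (chainMap R ψ cψ i) (chainMap R ψ' cψ' j) ∘ₗ
        joinComponent R X X' i j) ?_ w.2
    intro a ha b hb _
    rw [LinearMap.comp_apply, hm, joinComponent_joinChain, LinearMap.comp_apply,
      joinComponent_joinChain, TensorProduct.map_tmul,
      chainProj_chainMap R ψ cψ i _ (single_mem_chains R ha),
      chainProj_chainMap R ψ' cψ' j _ (single_mem_chains R hb)]
  · exact torInclusion_natural (hS := homologyShortComplex_shortExact R hX' j)
      (hS' := homologyShortComplex_shortExact R hX₂' j)
      (ModuleCat.ofHom (homologyMap R ψ hψ cψ i))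
      (homologyShortComplexMap R hψ' cψ' hX' hX₂' j)

end Naturality

end Connecting

-- The Künneth sequences of directed and simplicial complexes.

noncomputable section Sequences

variable {V V' : Type u}

lemma DirectedComplex.sublistClosed (K : DirectedComplex V) : SublistClosed K.augmented := by
  rintro l (rfl | hl) l' hl'
  · exact Or.inl (List.sublist_nil.1 hl')
  · exact or_iff_not_imp_left.2 fun h => K.sublist_mem l hl l' hl' h

lemma sublistClosed_ordered [LinearOrder V] (K : PreAbstractSimplicialComplex V) :
    SublistClosed (ordered K) := by
  classical
  rintro l ⟨hl, h⟩ l' hl'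
  refine ⟨hl.sublist hl', or_iff_not_imp_left.2 fun hne => ?_⟩
  rcases h with rfl | ⟨σ, hσ, h⟩
  · exact absurd (List.sublist_nil.1 hl') hne
  · refine ⟨l'.toFinset, (K.isRelLowerSet_faces hσ).2 (fun v hv => ?_) ?_, by simp⟩
    · exact (h v).2 (hl'.subset (List.mem_toFinset.1 hv))
    · simpa using hne

lemma isJoin_augmented (K : DirectedComplex V) (K' : DirectedComplex V') :
    IsJoin K.augmented K'.augmented (K.join K').augmented := by
  intro l
  constructor
  · rintro (rfl | ⟨-, h⟩)
    · exact ⟨[], Or.inl rfl, [], Or.inl rfl, rfl⟩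
    · exact h
  · rintro ⟨a, ha, b, hb, rfl⟩
    exact joinSeq_mem_augmented K K' a ha b hb

/-- Every element of `V` precedes every element of `V'`, so sorting `σ ⊔ σ'` gives the sorted `σ`
followed by the sorted `σ'`. Two strictly increasing sequences with the same entries coincide. -/
lemma isJoin_ordered [LinearOrder V] [LinearOrder V'] (K : PreAbstractSimplicialComplex V)
    (K' : PreAbstractSimplicialComplex V') :
    IsJoin (ordered K) (ordered K') (ordered (simplicialJoin K K')) := by
  classical
  have key : ∀ {U : Type u} [LinearOrder U] (M : PreAbstractSimplicialComplex U) (ρ : Finset U),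
      (ρ = ∅ ∨ ρ ∈ M.faces) → ρ.sort (· ≤ ·) ∈ ordered M := by
    intro U _ M ρ h
    refine ⟨(Finset.sortedLT_sort ρ).pairwise, ?_⟩
    rcases h with rfl | h
    · exact Or.inl (by simp)
    · exact Or.inr ⟨ρ, h, by simp⟩
  intro l
  constructor
  · rintro ⟨hl, h⟩
    rcases h with rfl | ⟨_, ⟨-, σ, σ', hσ, hσ', rfl⟩, h⟩
    · exact ⟨[], ⟨List.Pairwise.nil, Or.inl rfl⟩, [], ⟨List.Pairwise.nil, Or.inl rfl⟩, rfl⟩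
    · have h1 := key K σ hσ
      have h2 := key K' σ' hσ'
      have h3 := support_join (σ := σ) (σ' := σ') (l := σ.sort (· ≤ ·)) (l' := σ'.sort (· ≤ ·)) |>.2
        ⟨by simp, by simp⟩
      have h4 := joinSeq_pairwise.2 ⟨h1.1, h2.1⟩
      refine ⟨_, h1, _, h2, List.Perm.eq_of_pairwise (le := (· < ·))
        (fun a b _ _ h h' => (lt_asymm h h').elim) hl h4 ?_⟩
      exact (List.perm_ext_iff_of_nodup (hl.imp fun h => h.ne) (h4.imp fun h => h.ne)).2
        fun v => (h v).symm.trans (h3 v)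
  · rintro ⟨a, ha, b, hb, rfl⟩
    exact joinSeq_mem_ordered K K' a ha b hb

/-- The natural Künneth sequences. -/
def kunnethSequences (R : Type u) [CommRing R] [IsDomain R] [IsPrincipalIdealRing R] :
    KunnethSequences R where
  directed K K' n :=
    joinConnecting R K.sublistClosed K'.sublistClosed (isJoin_augmented K K') n
  simplicial K K' n :=
    joinConnecting R (sublistClosed_ordered K) (sublistClosed_ordered K') (isJoin_ordered K K') n
  directed_zero K K' n :=
    joinCross_connecting R K.sublistClosed K'.sublistClosed (isJoin_augmented K K') n
  simplicial_zero K K' n :=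
    joinCross_connecting R (sublistClosed_ordered K) (sublistClosed_ordered K')
      (isJoin_ordered K K') n
  directed_shortExact K K' n :=
    join_shortExact R K.sublistClosed K'.sublistClosed (isJoin_augmented K K') n
  simplicial_shortExact K K' n :=
    join_shortExact R (sublistClosed_ordered K) (sublistClosed_ordered K')
      (isJoin_ordered K K') n
  directed_natural {_ _ _ _ K K' L L'} φ φ' n :=
    joinConnecting_natural R K.sublistClosed K'.sublistClosed (isJoin_augmented K K')
      (hX₂ := L.sublistClosed) (hX₂' := L'.sublistClosed) (hY₂ := isJoin_augmented L L')
      (pushSeq_boundary R φ.toFun) (φ.chains_le R) (pushSeq_boundary R φ'.toFun) (φ'.chains_le R)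
      (pushSeq_boundary R (φ.join φ').toFun) ((φ.join φ').chains_le R)
      (pushSeq_joinChain φ.toFun φ'.toFun) n
  simplicial_natural {_ _ _ _ _ _ _ _ K K' L L'} φ φ' n :=
    joinConnecting_natural R (sublistClosed_ordered K) (sublistClosed_ordered K')
      (isJoin_ordered K K') (hX₂ := sublistClosed_ordered L) (hX₂' := sublistClosed_ordered L')
      (hY₂ := isJoin_ordered L L')
      (orient_pushSeq_boundary R φ.toFun) (φ.chains_le R)
      (orient_pushSeq_boundary R φ'.toFun) (φ'.chains_le R)
      (orient_pushSeq_boundary R (φ.join φ').toFun) ((φ.join φ').chains_le R)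
      (fun x y => (congrArg (orient R) (pushSeq_joinChain φ.toFun φ'.toFun x y)).trans
        (orient_joinChain _ _)) n
  projection_natural {_ _ _ _ K L} h {K' L'} h' n :=
    joinConnecting_natural R K.sublistClosed K'.sublistClosed (isJoin_augmented K K')
      (hX₂ := sublistClosed_ordered L) (hX₂' := sublistClosed_ordered L')
      (hY₂ := isJoin_ordered L L') (orient_boundary R) (chains_le_orient R h) (orient_boundary R)
      (chains_le_orient R h') (orient_boundary R) (chains_le_orient R (underlying_join h h'))
      orient_joinChain n

end Sequences

-- Functoriality of induced maps and of the Künneth sequences.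

noncomputable section Functoriality

section Orientation

variable (R : Type u) [CommRing R] {V W : Type u} [LinearOrder V] [LinearOrder W]

lemma signedInsertL_self (a : V) (x : SeqModule R V) :
    signedInsertL R a (signedInsertL R a x) = 0 := by
  have : signedInsertL R a ∘ₗ signedInsertL R a = 0 := by
    refine Finsupp.lhom_ext' fun l => LinearMap.ext_ring ?_
    simp only [LinearMap.comp_apply, Finsupp.lsingle_apply, LinearMap.zero_apply,
      signedInsertL_single]
    induction l with
    | nil => simp [signedInsert, signedInsertL_single]
    | cons c t ih =>
      rcases lt_trichotomy a c with h | h | h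
      · simp [signedInsert, h, signedInsertL_single]
      · simp [signedInsert, h]
      · simp [signedInsert, not_lt_of_gt h, h.ne', signedInsertL_consMap_gt R h, ih]
  exact LinearMap.congr_fun this x

/-- Signed insertion behaves like left multiplication in an exterior algebra: inserting a vertex
twice gives zero and two insertions anticommute. By symmetry only `a < b` needs the induction over
the sequence. -/
lemma signedInsertL_anticomm (a b : V) (x : SeqModule R V) :
    signedInsertL R a (signedInsertL R b x) = -signedInsertL R b (signedInsertL R a x) := by
  have of_lt : ∀ {a b : V}, a < b → ∀ x : SeqModule R V,
      signedInsertL R a (signedInsertL R b x) = -signedInsertL R b (signedInsertL R a x) := by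
    intro a b hab x
    have : signedInsertL R a ∘ₗ signedInsertL R b =
        -(signedInsertL R b ∘ₗ signedInsertL R a) := by
      refine Finsupp.lhom_ext' fun l => LinearMap.ext_ring ?_
      simp only [LinearMap.comp_apply, Finsupp.lsingle_apply, LinearMap.neg_apply,
        signedInsertL_single]
      induction l with
      | nil => simp [signedInsert, signedInsertL_single, hab, not_lt_of_gt hab, hab.ne']
      | cons c t ih =>
        rcases lt_trichotomy b c with h | h | h
        · simp [signedInsert, signedInsertL_single, h, hab, hab.trans h, not_lt_of_gt hab, hab.ne']
        · subst h
          simp [signedInsert, signedInsertL_single, hab, not_lt_of_gt hab, hab.ne']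
        · rcases lt_trichotomy a c with h' | h' | h'
          · simp [signedInsert, signedInsertL_single, h', not_lt_of_gt h, h.ne', not_lt_of_gt hab,
              hab.ne', signedInsertL_consMap_lt R h']
          · subst h'
            simp [signedInsert, not_lt_of_gt h, h.ne', signedInsertL_consMap_self]
          · simp [signedInsert, not_lt_of_gt h, h.ne', not_lt_of_gt h', h'.ne',
              signedInsertL_consMap_gt R h, signedInsertL_consMap_gt R h', ih]
    exact LinearMap.congr_fun this x
  rcases lt_trichotomy a b with h | rfl | h
  · exact of_lt h x
  · simp [signedInsertL_self]
  · rw [of_lt h, neg_neg]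

omit [LinearOrder V] [LinearOrder W] in
lemma pushSeq_consMap (φ : V → W) (a : V) (x : SeqModule R V) :
    pushSeq R φ (consMap R a x) = consMap R (φ a) (pushSeq R φ x) := by
  have : pushSeq R φ ∘ₗ consMap R a = consMap R (φ a) ∘ₗ pushSeq R φ := by
    refine Finsupp.lhom_ext' fun l => LinearMap.ext_ring ?_
    simp
  exact LinearMap.congr_fun this x

/-- This is the inductive step for `orient_pushSeq_orient`. An insertion that meets an equal vertex
gives zero on both sides, and one that passes a smaller vertex costs a sign, matched by
anticommutation after `φ`. -/
lemma orient_pushSeq_signedInsertL (φ : V → W) (a : V) (x : SeqModule R V) :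
    orient R (pushSeq R φ (signedInsertL R a x)) =
      signedInsertL R (φ a) (orient R (pushSeq R φ x)) := by
  have : orient R ∘ₗ pushSeq R φ ∘ₗ signedInsertL R a =
      signedInsertL R (φ a) ∘ₗ orient R ∘ₗ pushSeq R φ := by
    refine Finsupp.lhom_ext' fun l => LinearMap.ext_ring ?_
    simp only [LinearMap.comp_apply, Finsupp.lsingle_apply, signedInsertL_single]
    have hc : ∀ (c : V) (x : SeqModule R V), orient R (pushSeq R φ (consMap R c x)) =
        signedInsertL R (φ c) (orient R (pushSeq R φ x)) := fun c x => by
      rw [pushSeq_consMap, orient_cons]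
    induction l with
    | nil => rw [signedInsert, ← consMap_single, hc]
    | cons c t ih =>
      rcases lt_trichotomy a c with h | h | h
      · rw [signedInsert, if_pos h, ← consMap_single, hc]
      · rw [signedInsert, if_neg h.not_lt, if_pos h, ← consMap_single, hc, h, signedInsertL_self,
          map_zero, map_zero]
      · rw [signedInsert, if_neg (not_lt_of_gt h), if_neg h.ne', map_neg, map_neg, hc, ih,
          ← consMap_single, hc, signedInsertL_anticomm]
        simp
  exact LinearMap.congr_fun this x

/-- Sorting before applying a map of vertices does not change the sorted image. -/
lemma orient_pushSeq_orient (φ : V → W) (x : SeqModule R V) :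
    orient R (pushSeq R φ (orient R x)) = orient R (pushSeq R φ x) := by
  have : orient R ∘ₗ pushSeq R φ ∘ₗ orient R = orient R ∘ₗ pushSeq R φ := by
    refine Finsupp.lhom_ext' fun l => LinearMap.ext_ring ?_
    simp only [LinearMap.comp_apply, Finsupp.lsingle_apply]
    induction l with
    | nil => simp [orient_single, inversions]
    | cons a l ih =>
      rw [← consMap_single, orient_cons, orient_pushSeq_signedInsertL, ih, pushSeq_consMap,
        orient_cons]
  exact LinearMap.congr_fun this x

/-- Increasing sequences are already sorted and have no inversions. Hence the identity vertex map
induces the identity on simplicial homology. -/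
lemma orient_eq_self {K : PreAbstractSimplicialComplex V} {n : ℕ} {x : SeqModule R V}
    (hx : x ∈ chains R (ordered K) n) : orient R x = x := by
  have hinv : ∀ l : List V, l.Pairwise (· < ·) → inversions l = 0 := by
    intro l hl
    induction l with
    | nil => rfl
    | cons a l ih =>
      rw [List.pairwise_cons] at hl
      rw [inversions, ih hl.2, add_zero, List.countP_eq_zero]
      intro b hb
      simpa using (hl.1 b hb).le
  change orient R x = (LinearMap.id : SeqModule R V →ₗ[R] SeqModule R V) x
  rw [chains, Finsupp.supported_eq_span_single] at hx
  refine LinearMap.eqOn_span' ?_ hx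
  rintro _ ⟨l, ⟨⟨hl, -⟩, -⟩, rfl⟩
  have hs : l.insertionSort (· ≤ ·) = l :=
    List.Pairwise.insertionSort_eq (hl.imp fun h => h.le)
  have hd : l.Nodup := hl.imp fun h => h.ne
  rw [orient_single, if_pos hd, hinv l hl, hs, pow_zero, one_smul]
  rfl

omit [LinearOrder V] [LinearOrder W] in
lemma pushSeq_comp {U : Type u} (φ : V → W) (χ : U → V) (x : SeqModule R U) :
    pushSeq R φ (pushSeq R χ x) = pushSeq R (φ ∘ χ) x := by
  have : pushSeq R φ ∘ₗ pushSeq R χ = pushSeq R (φ ∘ χ) := by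
    refine Finsupp.lhom_ext' fun l => LinearMap.ext_ring ?_
    simp
  exact LinearMap.congr_fun this x

omit [LinearOrder V] in
lemma pushSeq_id (x : SeqModule R V) : pushSeq R id x = x := by
  have : pushSeq R (id : V → V) = LinearMap.id := by
    refine Finsupp.lhom_ext' fun l => LinearMap.ext_ring ?_
    simp
  exact LinearMap.congr_fun this x

end Orientation

-- Compositions, identities and projections on homology.

section HomologyMaps

variable {R : Type u} [CommRing R] {U V W U' V' W' : Type u}

lemma homologyMap_comp {X : Set (List U)} {Y : Set (List V)} {Z : Set (List W)}
    {ψ : SeqModule R U →ₗ[R] SeqModule R V} (hψ : ψ ∘ₗ boundary R = boundary R ∘ₗ ψ)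
    (cψ : ∀ n, chains R X n ≤ (chains R Y n).comap ψ)
    {χ : SeqModule R V →ₗ[R] SeqModule R W} (hχ : χ ∘ₗ boundary R = boundary R ∘ₗ χ)
    (cχ : ∀ n, chains R Y n ≤ (chains R Z n).comap χ)
    {ω : SeqModule R U →ₗ[R] SeqModule R W} (hω : ω ∘ₗ boundary R = boundary R ∘ₗ ω)
    (cω : ∀ n, chains R X n ≤ (chains R Z n).comap ω) {n : ℕ}
    (h : ∀ x, χ (ψ x) = ω x) :
    homologyMap R χ hχ cχ n ∘ₗ homologyMap R ψ hψ cψ n = homologyMap R ω hω cω n := by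
  refine LinearMap.ext fun a => ?_
  obtain ⟨x, rfl⟩ := Submodule.mkQ_surjective _ a
  exact congrArg (homologyClass R Z n) (Subtype.ext (h x.1))

lemma homologyMap_eq_id {X : Set (List U)} {ψ : SeqModule R U →ₗ[R] SeqModule R U}
    (hψ : ψ ∘ₗ boundary R = boundary R ∘ₗ ψ)
    (cψ : ∀ n, chains R X n ≤ (chains R X n).comap ψ) {n : ℕ}
    (h : ∀ x ∈ chains R X n, ψ x = x) : homologyMap R ψ hψ cψ n = LinearMap.id := by
  refine LinearMap.ext fun a => ?_
  obtain ⟨x, rfl⟩ := Submodule.mkQ_surjective _ a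
  exact congrArg (homologyClass R X n) (Subtype.ext (h x.1 x.2.1))

/-- The composite is an arbitrary map `ω` with the right vertex map, so that maps constructed in
different ways can be compared through their vertices alone. -/
lemma DirectedMap.onHomology_comp {K : DirectedComplex U} {L : DirectedComplex V}
    {M : DirectedComplex W} (φ : DirectedMap K L) (χ : DirectedMap L M) (ω : DirectedMap K M)
    (h : χ.toFun ∘ φ.toFun = ω.toFun) (n : ℕ) :
    φ.onHomology R n ≫ χ.onHomology R n = ω.onHomology R n :=
  ModuleCat.hom_ext (homologyMap_comp (pushSeq_boundary R _) (φ.chains_le R)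
    (pushSeq_boundary R _) (χ.chains_le R) (pushSeq_boundary R _) (ω.chains_le R)
    fun x => by rw [pushSeq_comp, h])

lemma DirectedMap.onHomology_id {K : DirectedComplex U} (φ : DirectedMap K K)
    (h : φ.toFun = id) (n : ℕ) : φ.onHomology R n = 𝟙 _ :=
  ModuleCat.hom_ext (homologyMap_eq_id (pushSeq_boundary R _) (φ.chains_le R)
    fun x _ => by rw [h, pushSeq_id])

variable [LinearOrder U] [LinearOrder V] [LinearOrder W]

lemma SimplicialMap.onHomology_comp {K : PreAbstractSimplicialComplex U}
    {L : PreAbstractSimplicialComplex V} {M : PreAbstractSimplicialComplex W}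
    (φ : SimplicialMap K L) (χ : SimplicialMap L M) (ω : SimplicialMap K M)
    (h : χ.toFun ∘ φ.toFun = ω.toFun) (n : ℕ) :
    φ.onHomology R n ≫ χ.onHomology R n = ω.onHomology R n :=
  ModuleCat.hom_ext (homologyMap_comp (orient_pushSeq_boundary R _) (φ.chains_le R)
    (orient_pushSeq_boundary R _) (χ.chains_le R) (orient_pushSeq_boundary R _) (ω.chains_le R)
    fun x => by
      simp only [LinearMap.comp_apply]
      rw [orient_pushSeq_orient, pushSeq_comp, h])

lemma SimplicialMap.onHomology_id {K : PreAbstractSimplicialComplex U} (φ : SimplicialMap K K)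
    (h : φ.toFun = id) (n : ℕ) : φ.onHomology R n = 𝟙 _ :=
  ModuleCat.hom_ext (homologyMap_eq_id (orient_pushSeq_boundary R _) (φ.chains_le R) fun x hx => by
    rw [h, LinearMap.comp_apply, pushSeq_id, orient_eq_self R hx])

/-- Both composites are the map induced by pushing forward and then orienting; for the one through
`K₂`, orienting beforehand makes no difference. -/
lemma onHomology_projection {K : DirectedComplex U} {L : DirectedComplex V}
    {K₂ : PreAbstractSimplicialComplex U} {L₂ : PreAbstractSimplicialComplex V}
    (hK : K.underlying = K₂) (hL : L.underlying = L₂) (φ : DirectedMap K L)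
    (φ₂ : SimplicialMap K₂ L₂) (h : φ.toFun = φ₂.toFun) (n : ℕ) :
    φ.onHomology R n ≫ projection R hL n = projection R hK n ≫ φ₂.onHomology R n :=
  have hω (n) : chains R K.augmented n ≤
      (chains R (ordered L₂) n).comap (orient R ∘ₗ pushSeq R φ₂.toFun) := by
    rw [← h]
    exact (φ.chains_le R n).trans (Submodule.comap_mono (chains_le_orient R hL n))
  (ModuleCat.hom_ext (homologyMap_comp (pushSeq_boundary R _) (φ.chains_le R) (orient_boundary R)
    (chains_le_orient R hL) (orient_pushSeq_boundary R _) hω fun x => by rw [h]; rfl)).trans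
  (ModuleCat.hom_ext (homologyMap_comp (orient_boundary R) (chains_le_orient R hK)
    (orient_pushSeq_boundary R _) (φ₂.chains_le R) (orient_pushSeq_boundary R _) hω
    fun x => by
      simp only [LinearMap.comp_apply]
      rw [orient_pushSeq_orient])).symm

end HomologyMaps

-- Functoriality of the tensor and `Tor` terms.

section Sums

variable {R : Type u} [CommRing R] {A B A₂ B₂ A₃ B₃ : ℕ → ModuleCat.{u} R}

lemma tensorSumMap_comp (f : ∀ i, A i ⟶ A₂ i) (g : ∀ i, B i ⟶ B₂ i) (f' : ∀ i, A₂ i ⟶ A₃ i)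
    (g' : ∀ i, B₂ i ⟶ B₃ i) (n : ℕ) : tensorSumMap f g n ≫ tensorSumMap f' g' n =
      tensorSumMap (fun i => f i ≫ f' i) (fun i => g i ≫ g' i) n :=
  ModuleCat.hom_ext ((DirectSum.lmap_comp _ _).symm.trans (congrArg DirectSum.lmap (funext fun _ =>
    (TensorProduct.map_comp _ _ _ _).symm)))

lemma tensorSumMap_id (n : ℕ) :
    tensorSumMap (fun i => 𝟙 (A i)) (fun i => 𝟙 (B i)) n = 𝟙 _ :=
  ModuleCat.hom_ext ((congrArg DirectSum.lmap (funext fun _ => TensorProduct.map_id)).trans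
    DirectSum.lmap_id)

lemma torSumMap_comp (f : ∀ i, A i ⟶ A₂ i) (g : ∀ i, B i ⟶ B₂ i) (f' : ∀ i, A₂ i ⟶ A₃ i)
    (g' : ∀ i, B₂ i ⟶ B₃ i) (n : ℕ) : torSumMap f g n ≫ torSumMap f' g' n =
      torSumMap (fun i => f i ≫ f' i) (fun i => g i ≫ g' i) n := by
  have h (i j : ℕ) : (((Tor (ModuleCat.{u} R) 1).map (f i)).app (B j) ≫
        ((Tor (ModuleCat.{u} R) 1).obj (A₂ i)).map (g j)) ≫
      ((Tor (ModuleCat.{u} R) 1).map (f' i)).app (B₂ j) ≫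
        ((Tor (ModuleCat.{u} R) 1).obj (A₃ i)).map (g' j) =
      ((Tor (ModuleCat.{u} R) 1).map (f i ≫ f' i)).app (B j) ≫
        ((Tor (ModuleCat.{u} R) 1).obj (A₃ i)).map (g j ≫ g' j) := by
    -- The two middle factors act on different arguments of `Tor`, and naturality interchanges them.
    rw [Functor.map_comp, Functor.map_comp, NatTrans.comp_app, Category.assoc, Category.assoc,
      NatTrans.naturality_assoc]
  exact ModuleCat.hom_ext ((DirectSum.lmap_comp _ _).symm.trans
    (congrArg DirectSum.lmap (funext fun p => congrArg ModuleCat.Hom.hom (h p.1.1 p.1.2))))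

lemma torSumMap_id (n : ℕ) :
    torSumMap (fun i => 𝟙 (A i)) (fun i => 𝟙 (B i)) n = 𝟙 _ := by
  have h (i j : ℕ) : (((Tor (ModuleCat.{u} R) 1).map (𝟙 (A i))).app (B j) ≫
      ((Tor (ModuleCat.{u} R) 1).obj (A i)).map (𝟙 (B j))).hom = LinearMap.id := by
    rw [CategoryTheory.Functor.map_id, CategoryTheory.Functor.map_id, NatTrans.id_app,
      Category.comp_id, ModuleCat.hom_id]
  refine ModuleCat.hom_ext (Eq.trans ?_ (DirectSum.lmap_id (R := R)
    (M := fun p : {p : ℕ × ℕ // p.1 + p.2 + 1 = n} =>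
      ((Tor (ModuleCat.{u} R) 1).obj (A p.1.1)).obj (B p.1.2))))
  exact congrArg DirectSum.lmap (funext fun p => h p.1.1 p.1.2)

end Sums

lemma lexMap_comp {U V W U' V' W' : Type u} (φ : V → W) (φ' : V' → W') (χ : U → V)
    (χ' : U' → V') : lexMap φ φ' ∘ lexMap χ χ' = lexMap (φ ∘ χ) (φ' ∘ χ') :=
  funext (forall_lexSum.2 ⟨fun _ => rfl, fun _ => rfl⟩)

lemma lexMap_id {V V' : Type u} : lexMap (id : V → V) (id : V' → V') = id :=
  funext (forall_lexSum.2 ⟨fun _ => rfl, fun _ => rfl⟩)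

-- Functoriality of morphisms of Künneth sequences, term by term.

namespace KunnethSequences

variable {R : Type u} [CommRing R] (κ : KunnethSequences R) {U V W U' V' W' : Type u}

lemma directedSeqMap_comp {K : DirectedComplex U} {L : DirectedComplex V} {M : DirectedComplex W}
    {K' : DirectedComplex U'} {L' : DirectedComplex V'} {M' : DirectedComplex W'}
    (φ : DirectedMap K L) (φ' : DirectedMap K' L') (χ : DirectedMap L M) (χ' : DirectedMap L' M')
    (ω : DirectedMap K M) (ω' : DirectedMap K' M') (h : χ.toFun ∘ φ.toFun = ω.toFun)
    (h' : χ'.toFun ∘ φ'.toFun = ω'.toFun) (n : ℕ) :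
    κ.directedSeqMap φ φ' n ≫ κ.directedSeqMap χ χ' n = κ.directedSeqMap ω ω' n := by
  have h₁ := funext (DirectedMap.onHomology_comp (R := R) φ χ ω h)
  have h₂ := funext (DirectedMap.onHomology_comp (R := R) φ' χ' ω' h')
  refine ShortComplex.hom_ext _ _ ?_ ?_ ?_
  · exact (tensorSumMap_comp _ _ _ _ n).trans
      (congrArg₂ (fun f g => tensorSumMap f g n) h₁ h₂)
  · refine DirectedMap.onHomology_comp _ _ (ω.join ω') ?_ n
    exact (lexMap_comp _ _ _ _).trans (congrArg₂ lexMap h h')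
  · exact (torSumMap_comp _ _ _ _ n).trans (congrArg₂ (fun f g => torSumMap f g n) h₁ h₂)

lemma directedSeqMap_id {K : DirectedComplex U} {K' : DirectedComplex U'} (φ : DirectedMap K K)
    (φ' : DirectedMap K' K') (h : φ.toFun = id) (h' : φ'.toFun = id) (n : ℕ) :
    κ.directedSeqMap φ φ' n = 𝟙 _ := by
  have h₁ := funext (DirectedMap.onHomology_id (R := R) φ h)
  have h₂ := funext (DirectedMap.onHomology_id (R := R) φ' h')
  refine ShortComplex.hom_ext _ _ ?_ ?_ ?_
  · exact (congrArg₂ (fun f g => tensorSumMap f g n) h₁ h₂).trans (tensorSumMap_id n)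
  · exact DirectedMap.onHomology_id _ ((congrArg₂ lexMap h h').trans lexMap_id) n
  · exact (congrArg₂ (fun f g => torSumMap f g n) h₁ h₂).trans (torSumMap_id n)

variable [LinearOrder U] [LinearOrder V] [LinearOrder W] [LinearOrder U'] [LinearOrder V']
  [LinearOrder W']

lemma simplicialSeqMap_comp {K : PreAbstractSimplicialComplex U}
    {L : PreAbstractSimplicialComplex V} {M : PreAbstractSimplicialComplex W}
    {K' : PreAbstractSimplicialComplex U'} {L' : PreAbstractSimplicialComplex V'}
    {M' : PreAbstractSimplicialComplex W'}
    (φ : SimplicialMap K L) (φ' : SimplicialMap K' L') (χ : SimplicialMap L M)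
    (χ' : SimplicialMap L' M') (ω : SimplicialMap K M) (ω' : SimplicialMap K' M')
    (h : χ.toFun ∘ φ.toFun = ω.toFun) (h' : χ'.toFun ∘ φ'.toFun = ω'.toFun) (n : ℕ) :
    κ.simplicialSeqMap φ φ' n ≫ κ.simplicialSeqMap χ χ' n = κ.simplicialSeqMap ω ω' n := by
  have h₁ := funext (SimplicialMap.onHomology_comp (R := R) φ χ ω h)
  have h₂ := funext (SimplicialMap.onHomology_comp (R := R) φ' χ' ω' h')
  refine ShortComplex.hom_ext _ _ ?_ ?_ ?_
  · exact (tensorSumMap_comp _ _ _ _ n).trans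
      (congrArg₂ (fun f g => tensorSumMap f g n) h₁ h₂)
  · refine SimplicialMap.onHomology_comp _ _ (ω.join ω') ?_ n
    exact (lexMap_comp _ _ _ _).trans (congrArg₂ lexMap h h')
  · exact (torSumMap_comp _ _ _ _ n).trans (congrArg₂ (fun f g => torSumMap f g n) h₁ h₂)

lemma simplicialSeqMap_id {K : PreAbstractSimplicialComplex U}
    {K' : PreAbstractSimplicialComplex U'} (φ : SimplicialMap K K) (φ' : SimplicialMap K' K')
    (h : φ.toFun = id) (h' : φ'.toFun = id) (n : ℕ) : κ.simplicialSeqMap φ φ' n = 𝟙 _ := by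
  have h₁ := funext (SimplicialMap.onHomology_id (R := R) φ h)
  have h₂ := funext (SimplicialMap.onHomology_id (R := R) φ' h')
  refine ShortComplex.hom_ext _ _ ?_ ?_ ?_
  · exact (congrArg₂ (fun f g => tensorSumMap f g n) h₁ h₂).trans (tensorSumMap_id n)
  · exact SimplicialMap.onHomology_id _ ((congrArg₂ lexMap h h').trans lexMap_id) n
  · exact (congrArg₂ (fun f g => torSumMap f g n) h₁ h₂).trans (torSumMap_id n)

/-- Maps of directed complexes and of underlying complexes with the same vertex maps induce
commutative squares of Künneth sequences. -/
lemma directedSeqMap_projectionSeq {K : DirectedComplex U} {L : DirectedComplex V}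
    {K₂ : PreAbstractSimplicialComplex U} {L₂ : PreAbstractSimplicialComplex V}
    {K' : DirectedComplex U'} {L' : DirectedComplex V'}
    {K₂' : PreAbstractSimplicialComplex U'} {L₂' : PreAbstractSimplicialComplex V'}
    (hK : K.underlying = K₂) (hL : L.underlying = L₂) (hK' : K'.underlying = K₂')
    (hL' : L'.underlying = L₂') (φ : DirectedMap K L) (φ₂ : SimplicialMap K₂ L₂)
    (φ' : DirectedMap K' L') (φ₂' : SimplicialMap K₂' L₂') (h : φ.toFun = φ₂.toFun)
    (h' : φ'.toFun = φ₂'.toFun) (n : ℕ) :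
    κ.directedSeqMap φ φ' n ≫ κ.projectionSeq hL hL' n =
      κ.projectionSeq hK hK' n ≫ κ.simplicialSeqMap φ₂ φ₂' n := by
  have h₁ := funext (onHomology_projection (R := R) hK hL φ φ₂ h)
  have h₂ := funext (onHomology_projection (R := R) hK' hL' φ' φ₂' h')
  refine ShortComplex.hom_ext _ _ ?_ ?_ ?_
  · exact ((tensorSumMap_comp _ _ _ _ n).trans
      (congrArg₂ (fun f g => tensorSumMap f g n) h₁ h₂)).trans (tensorSumMap_comp _ _ _ _ n).symm
  · exact onHomology_projection (underlying_join hK hK') (underlying_join hL hL') (φ.join φ') (φ₂.join φ₂') (congrArg₂ lexMap h h') n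
  · exact ((torSumMap_comp _ _ _ _ n).trans
      (congrArg₂ (fun f g => torSumMap f g n) h₁ h₂)).trans (torSumMap_comp _ _ _ _ n).symm

end KunnethSequences

end Functoriality

-- Linear independence in the product space.

section LinearIndependence

variable {F : Type u} [Field F] {V V' : Type u} {N N' : ℕ}

/-- Over the join the family is the sum of two families in the complementary summands of the
product. Independence of the blocks gives independence of the sum; conversely it restricts to each
block and is reflected by the linear inclusions. -/
lemma linearIndepOn_pairMap (f : V → Fin N → F) (f' : V' → Fin N' → F) (σ : Finset V)
    (σ' : Finset V') :
    LinearIndepOn F (pairMap F f f') (joinFinset σ σ' : Set (V ⊕ₗ V')) ↔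
      LinearIndepOn F f (σ : Set V) ∧ LinearIndepOn F f' (σ' : Set V') := by
  let e : (σ : Set V) ⊕ (σ' : Set V') → (joinFinset σ σ' : Set (V ⊕ₗ V')) :=
    Sum.elim (fun v => ⟨Sum.inlₗ v.1, inl_mem_joinFinset.2 v.2⟩)
      (fun v => ⟨Sum.inrₗ v.1, inr_mem_joinFinset.2 v.2⟩)
  have he : Function.Bijective e := by
    constructor
    · rintro (⟨v, hv⟩ | ⟨v, hv⟩) (⟨w, hw⟩ | ⟨w, hw⟩) h
      all_goals simp [e] at h ⊢
      all_goals exact h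
    · rintro ⟨v | v, hv⟩
      · exact ⟨Sum.inl ⟨v, inl_mem_joinFinset.1 hv⟩, rfl⟩
      · exact ⟨Sum.inr ⟨v, inr_mem_joinFinset.1 hv⟩, rfl⟩
  have key : LinearIndepOn F (pairMap F f f') (joinFinset σ σ' : Set (V ⊕ₗ V')) ↔
      LinearIndependent F (Sum.elim
        (LinearMap.inl F (Fin N → F) (Fin N' → F) ∘ fun v : (σ : Set V) => f v)
        (LinearMap.inr F (Fin N → F) (Fin N' → F) ∘ fun v : (σ' : Set V') => f' v)) := by
    refine (linearIndependent_equiv' (Equiv.ofBijective e he) ?_).symm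
    ext (v | v) <;> rfl
  rw [key]
  refine ⟨fun h => ⟨?_, ?_⟩, fun h => linearIndependent_inl_union_inr' h.1 h.2⟩
  · exact (h.comp Sum.inl Sum.inl_injective).of_comp (LinearMap.inl F _ _)
  · exact (h.comp Sum.inr Sum.inr_injective).of_comp (LinearMap.inr F _ _)

lemma mem_simplicialJoin_matroidComplex (S : Finset (Fin N → F)) (S' : Finset (Fin N' → F))
    (τ : Finset (S ⊕ₗ S')) :
    τ ∈ (simplicialJoin (matroidComplex (vectorMatroid F S))
        (matroidComplex (vectorMatroid F S'))).faces ↔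
      τ.Nonempty ∧ LinearIndepOn F
        (pairMap F (fun s : S => (s : Fin N → F)) (fun s : S' => (s : Fin N' → F)))
        (τ : Set (S ⊕ₗ S')) := by
  -- A join allows one side to be empty, and the empty set is independent, so the two alternatives
  -- merge into a single independence condition.
  have key : ∀ {M : ℕ} (T : Finset (Fin M → F)) (ρ : Finset T),
      (ρ = ∅ ∨ ρ ∈ (matroidComplex (vectorMatroid F T)).faces) ↔
        LinearIndepOn F (fun s : T => (s : Fin M → F)) (ρ : Set T) := by
    intro M T ρ
    constructor
    · rintro (rfl | h)
      · simp
      · exact h.2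
    · intro h
      rcases ρ.eq_empty_or_nonempty with h0 | h0
      · exact Or.inl h0
      · exact Or.inr ⟨h0, h⟩
  refine and_congr_right fun _ => ⟨?_, fun h => ?_⟩
  · rintro ⟨σ, σ', h, h', rfl⟩
    exact (linearIndepOn_pairMap _ _ _ _).2 ⟨(key S σ).1 h, (key S' σ').1 h'⟩
  · obtain ⟨σ, σ', rfl⟩ := exists_joinFinset τ
    have := (linearIndepOn_pairMap _ _ _ _).1 h
    exact ⟨σ, σ', (key S σ).2 this.1, (key S' σ').2 this.2, rfl⟩

end LinearIndependence

end RegularKunneth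

theorem theorem8p9 {R : Type u} [CommRing R] [IsDomain R] [IsPrincipalIdealRing R] :
    -- natural connecting maps, which turn the cross products into Künneth sequences
    ∃ κ : KunnethSequences R,
      ∀ {F : Type u} [Field F] {V V' : Type u} [LinearOrder V] [LinearOrder V']
        (G : SimpleGraph V) (G' : SimpleGraph V') (k k' N N' : ℕ)
        (S : Finset (Fin N → F)) (S' : Finset (Fin N' → F)) [LinearOrder S] [LinearOrder S']
        (f : V → Fin N → F) (f' : V' → Fin N' → F)
        (hf : IsRegular F G k f) (hf' : IsRegular F G' k' f')
        (hS : ∀ v, f v ∈ S) (hS' : ∀ v, f' v ∈ S'),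
        -- the four rows of the diagram are short exact sequences
        (∀ n : ℕ,
          (κ.directedSeq ((directedInd G).skeleton k) ((directedInd G').skeleton k') n).ShortExact ∧
          (κ.directedSeq (directedMatroidComplex (vectorMatroid F S))
            (directedMatroidComplex (vectorMatroid F S')) n).ShortExact ∧
          (κ.simplicialSeq (simplicialSkeleton (Ind G) k)
            (simplicialSkeleton (Ind G') k') n).ShortExact ∧
          (κ.simplicialSeq (matroidComplex (vectorMatroid F S))
            (matroidComplex (vectorMatroid F S')) n).ShortExact) ∧
        -- the diagram commutes
        (∀ n : ℕ,
          κ.directedSeqMap (hf.directedMap hS) (hf'.directedMap hS') n ≫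
              κ.projectionSeq (underlying_directedMatroidComplex (vectorMatroid F S))
                (underlying_directedMatroidComplex (vectorMatroid F S')) n =
            κ.projectionSeq (underlying_skeleton_directedInd G k)
                (underlying_skeleton_directedInd G' k') n ≫
              κ.simplicialSeqMap (hf.simplicialMap hS) (hf'.simplicialMap hS') n) ∧
        -- `(f, f')` is `(G, k; G', k')`-regular, the simplices of the join of the two matroids are
        -- the linearly independent sets of vectors in `(S, 0) ⊔ (0, S')`, and the maps in the
        -- middle of the sequences are induced by `(f, f')`
        IsPairRegular F G k G' k' (pairMap F f f') ∧
        (∀ τ : Finset (S ⊕ₗ S'),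
          τ ∈ (simplicialJoin (matroidComplex (vectorMatroid F S))
              (matroidComplex (vectorMatroid F S'))).faces ↔
            τ.Nonempty ∧ LinearIndepOn F
              (pairMap F (fun s : S => (s : Fin N → F)) (fun s : S' => (s : Fin N' → F)))
              (τ : Set (S ⊕ₗ S'))) ∧
        (∀ v : V ⊕ₗ V',
          pairMap F (fun s : S => (s : Fin N → F)) (fun s : S' => (s : Fin N' → F))
              (((hf.directedMap hS).join (hf'.directedMap hS')).toFun v) = pairMap F f f' v ∧
          pairMap F (fun s : S => (s : Fin N → F)) (fun s : S' => (s : Fin N' → F))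
              (((hf.simplicialMap hS).join (hf'.simplicialMap hS')).toFun v) =
            pairMap F f f' v) ∧
        -- functoriality in the graphs, for inclusions of induced subgraphs
        (∀ n : ℕ,
          κ.directedSeqMap (directedIndMap (SimpleGraph.Embedding.refl (G := G)) k)
              (directedIndMap (SimpleGraph.Embedding.refl (G := G')) k') n = 𝟙 _ ∧
          κ.simplicialSeqMap (indMap (SimpleGraph.Embedding.refl (G := G)) k)
              (indMap (SimpleGraph.Embedding.refl (G := G')) k') n = 𝟙 _) ∧
        (∀ {W W' : Type u} [LinearOrder W] [LinearOrder W'] (H : SimpleGraph W)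
          (H' : SimpleGraph W') (e : H ↪g G) (e' : H' ↪g G'),
          (∀ n : ℕ,
            κ.directedSeqMap (directedIndMap e k) (directedIndMap e' k') n ≫
                κ.directedSeqMap (hf.directedMap hS) (hf'.directedMap hS') n =
              κ.directedSeqMap ((hf.comp e).directedMap fun w => hS (e w))
                ((hf'.comp e').directedMap fun w => hS' (e' w)) n ∧
            κ.simplicialSeqMap (indMap e k) (indMap e' k') n ≫
                κ.simplicialSeqMap (hf.simplicialMap hS) (hf'.simplicialMap hS') n =
              κ.simplicialSeqMap ((hf.comp e).simplicialMap fun w => hS (e w))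
                ((hf'.comp e').simplicialMap fun w => hS' (e' w)) n ∧
            κ.directedSeqMap (directedIndMap e k) (directedIndMap e' k') n ≫
                κ.projectionSeq (underlying_skeleton_directedInd G k)
                  (underlying_skeleton_directedInd G' k') n =
              κ.projectionSeq (underlying_skeleton_directedInd H k)
                  (underlying_skeleton_directedInd H' k') n ≫
                κ.simplicialSeqMap (indMap e k) (indMap e' k') n) ∧
          ∀ {U U' : Type u} [LinearOrder U] [LinearOrder U'] (D : SimpleGraph U)
            (D' : SimpleGraph U') (d : D ↪g H) (d' : D' ↪g H') (n : ℕ),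
            κ.directedSeqMap (directedIndMap d k) (directedIndMap d' k') n ≫
                κ.directedSeqMap (directedIndMap e k) (directedIndMap e' k') n =
              κ.directedSeqMap (directedIndMap (e.comp d) k) (directedIndMap (e'.comp d') k') n ∧
            κ.simplicialSeqMap (indMap d k) (indMap d' k') n ≫
                κ.simplicialSeqMap (indMap e k) (indMap e' k') n =
              κ.simplicialSeqMap (indMap (e.comp d) k) (indMap (e'.comp d') k') n) := by
  refine ⟨kunnethSequences R, ?_⟩
  intro F _ V V' _ _ G G' k k' N N' S S' _ _ f f' hf hf' hS hS'
  refine ⟨fun n => ⟨KunnethSequences.directed_shortExact _ _ _ n,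
    KunnethSequences.directed_shortExact _ _ _ n, KunnethSequences.simplicial_shortExact _ _ _ n,
    KunnethSequences.simplicial_shortExact _ _ _ n⟩, fun n => ?_, ?_, ?_, ?_, fun n => ⟨?_, ?_⟩, ?_⟩
  -- The directed and the simplicial map induced by `f` have the same vertex map by definition, and
  -- likewise for `f'`.
  · exact KunnethSequences.directedSeqMap_projectionSeq _ _ _ _ _ _ _ _ _ rfl rfl n
  · intro σ σ' hσ hk hσ' hk'
    exact (linearIndepOn_pairMap _ _ _ _).2 ⟨hf σ hσ hk, hf' σ' hσ' hk'⟩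
  · exact mem_simplicialJoin_matroidComplex S S'
  · exact forall_lexSum.2 ⟨fun _ => ⟨rfl, rfl⟩, fun _ => ⟨rfl, rfl⟩⟩
  · exact KunnethSequences.directedSeqMap_id _ _ _ rfl rfl n
  · exact KunnethSequences.simplicialSeqMap_id _ _ _ rfl rfl n
  · intro W W' _ _ H H' e e'
    refine ⟨fun n => ⟨?_, ?_, ?_⟩, fun D D' d d' n => ⟨?_, ?_⟩⟩
    · exact KunnethSequences.directedSeqMap_comp _ _ _ _ _ _ _ rfl rfl n
    · exact KunnethSequences.simplicialSeqMap_comp _ _ _ _ _ _ _ rfl rfl n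
    · exact KunnethSequences.directedSeqMap_projectionSeq _ _ _ _ _ _ _ _ _ rfl rfl n
    · exact KunnethSequences.directedSeqMap_comp _ _ _ _ _ _ _ rfl rfl n
    · exact KunnethSequences.simplicialSeqMap_comp _ _ _ _ _ _ _ rfl rfl n
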